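/- Let $n\ge 1$ and let $\mathfrak a$ be one of the complex Lie algebras $\mathfrak o_{2n+1}$, $\mathfrak{sp}_{2n}$, or $\mathfrak o_{2n}$, where $n\ge 2$ in the last case. Put $N=2n+1$ for $\mathfrak o_{2n+1}$ and $N=2n$ otherwise. Let the indices $i,j$ run over $\{-n,\dots,n\}$, with $0$ skipped if $N=2n$. Put $\theta_{ij}=1$ and $\kappa=N/2-1$ in the orthogonal case, and $\theta_{ij}=\operatorname{sgn} i\cdot\operatorname{sgn} j$ and $\kappa=N/2+1$ in the symplectic case. With the matrix units $e_{ij}\in\operatorname{End}\mathbb C^N$ let $$P=\sum_{i,j}e_{ij}\otimes e_{ji},\qquad Q=\sum_{i,j}\theta_{ij}\,e_{ij}\otimes e_{-i,-j},\qquad R(u)=1-\frac{P}{u}+\frac{Q}{u-\kappa}.$$ The extended Yangian $X(\mathfrak a)$ is the associative unital $\mathbb C$-algebra with generators $t_{ij}^{(r)}$, $r\ge1$, and the defining relations $$R(u-v)\,T_1(u)\,T_2(v)=T_2(v)\,T_1(u)\,R(u-v),$$ where $T(u)=\sum_{i,j}e_{ij}\otimes t_{ij}(u)$, $t_{ij}(u)=\delta_{ij}+\sum_{r\ge1}t_{ij}^{(r)}u^{-r}$,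 and $T_1(u)$, $T_2(v)$ are $T(u)$, $T(v)$ placed in the first and the second copy of $\operatorname{End}\mathbb C^N$. The Yangian $Y(\mathfrak a)\subset X(\mathfrak a)$ is the subalgebra of the elements fixed by all the automorphisms $T(u)\mapsto f(u)T(u)$ with $f(u)\in 1+u^{-1}\mathbb C[[u^{-1}]]$. Let $T^t(u)$ be the transpose of $T(u)$ for $(e_{ij})^t=\theta_{ij}\,e_{-j,-i}$. There is a series $z(u)=1+z_1u^{-1}+z_2u^{-2}+\cdots$ with coefficients in $X(\mathfrak a)$ such that $$T^t(u+\kappa)\,T(u)=T(u)\,T^t(u+\kappa)=z(u)\,1 ,$$ and it is unique. Let $ZX(\mathfrak a)$ be the subalgebra of $X(\mathfrak a)$ generated by $z_1,z_2,\dots$. Then: (i) The center of $Y(\mathfrak a)$ is trivial, that is, equal to $\mathbb C\cdot 1$. (ii) The center of $X(\mathfrak a)$ coincides with $ZX(\mathfrak a)$. (iii) The elements $z_1,z_2,\dots$ of the center are algebraically independent over $\mathbb C$, so that $ZX(\mathfrak a)$ is isomorphic to the algebra of polynomials in countably many variables, with the variables corresponding to $z_1,z_2,\dots$. -/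

import Mathlib

open PowerSeries
open scoped Kronecker

noncomputable section

namespace ExtendedYangian

/-- `B n`, `C n`, `D n` stand for `𝔬_{2n+1}`, `𝔰𝔭_{2n}`, `𝔬_{2n}`. -/
inductive ClassicalType : Type
  | B : ClassicalType
  | C : ClassicalType
  | D : ClassicalType

/-- The size `N` of the matrices. -/
def size : ClassicalType → ℕ → ℕ
  | .B, n => 2 * n + 1
  | .C, n => 2 * n
  | .D, n => 2 * n

/-- `κ = N / 2 - 1` in the orthogonal case and `κ = N / 2 + 1` in the symplectic case. -/
def kappa : ClassicalType → ℕ → ℂ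
  | .B, n => (size .B n : ℂ) / 2 - 1
  | .C, n => (size .C n : ℂ) / 2 + 1
  | .D, n => (size .D n : ℂ) / 2 - 1

/-- The rows and columns are numbered by `-n, …, n`, where `0` is skipped if `N = 2 n`. -/
def idxSet : ClassicalType → ℕ → Finset ℤ
  | .B, n => Finset.Icc (-(n : ℤ)) n
  | .C, n => (Finset.Icc (-(n : ℤ)) n).erase 0
  | .D, n => (Finset.Icc (-(n : ℤ)) n).erase 0

abbrev Idx (τ : ClassicalType) (n : ℕ) : Type := {i : ℤ // i ∈ idxSet τ n}

theorem neg_mem_idxSet (τ : ClassicalType) (n : ℕ) (i : ℤ) (hi : i ∈ idxSet τ n) :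
    -i ∈ idxSet τ n := by
  cases τ <;> simp only [idxSet, Finset.mem_erase, Finset.mem_Icc] at hi ⊢ <;> omega

/-- The involution `i ↦ -i` of the index set. -/
def neg {τ : ClassicalType} {n : ℕ} (i : Idx τ n) : Idx τ n :=
  ⟨-i.1, neg_mem_idxSet τ n i.1 i.2⟩

/-- The sign `θ_{ij}`. -/
def theta : (τ : ClassicalType) → {n : ℕ} → Idx τ n → Idx τ n → ℤ
  | .B, _, _, _ => 1
  | .C, _, i, j => Int.sign i.1 * Int.sign j.1
  | .D, _, _, _ => 1

section Relations

variable (τ : ClassicalType) (n : ℕ) (A : Type) [Ring A] [Algebra ℂ A]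

/-- The permutation operator `P = ∑ e_{ij} ⊗ e_{ji}`. -/
def permMatrix (S : Type) [Ring S] : Matrix (Idx τ n × Idx τ n) (Idx τ n × Idx τ n) S :=
  fun a b => if a.1 = b.2 ∧ a.2 = b.1 then 1 else 0

/-- The operator `Q = ∑ θ_{ij} e_{ij} ⊗ e_{-i,-j}`. -/
def qMatrix (S : Type) [Ring S] : Matrix (Idx τ n × Idx τ n) (Idx τ n × Idx τ n) S :=
  fun a b => if a.2 = neg a.1 ∧ b.2 = neg b.1 then ((theta τ a.1 b.1 : ℤ) : S) else 0

/-- A power series over `A` in `x = u⁻¹` stands for an element of `A[[u⁻¹]]`. The ring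
`A⟦X⟧⟦X⟧` stands for `A[[u⁻¹, v⁻¹]]`: the inner variable is `x = u⁻¹`. -/
def uInv : A⟦X⟧⟦X⟧ := PowerSeries.C (PowerSeries.X : A⟦X⟧)

/-- The outer variable of `A⟦X⟧⟦X⟧` is `y = v⁻¹`. -/
def vInv : A⟦X⟧⟦X⟧ := PowerSeries.X

/-- The constant `κ` in `A⟦X⟧⟦X⟧`. -/
def kappaC : A⟦X⟧⟦X⟧ := PowerSeries.C (PowerSeries.C (algebraMap ℂ A (kappa τ n)))

/-- The `R`-matrix `R(u - v) = 1 - P / (u - v) + Q / (u - v - κ)` times the common denominator.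
In terms of `x = u⁻¹` and `y = v⁻¹` we have `u - v = (y - x) / (x y)` and
`u - v - κ = (y - x - κ x y) / (x y)`, and this is `(y - x) (y - x - κ x y) R(u - v)`. -/
def rMatrix : Matrix (Idx τ n × Idx τ n) (Idx τ n × Idx τ n) A⟦X⟧⟦X⟧ :=
  let x := uInv A
  let y := vInv A
  let k := kappaC τ n A
  ((y - x) * (y - x - k * x * y)) • (1 : Matrix (Idx τ n × Idx τ n) (Idx τ n × Idx τ n) A⟦X⟧⟦X⟧)
    - (x * y * (y - x - k * x * y)) • permMatrix τ n A⟦X⟧⟦X⟧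
    + (x * y * (y - x)) • qMatrix τ n A⟦X⟧⟦X⟧

variable {τ n A}

/-- `T₁(u) = ∑ e_{ij} ⊗ 1 ⊗ t_{ij}(u)`. -/
def leg1 (T : Matrix (Idx τ n) (Idx τ n) A⟦X⟧) :
    Matrix (Idx τ n × Idx τ n) (Idx τ n × Idx τ n) A⟦X⟧⟦X⟧ :=
  (T.map (PowerSeries.C : A⟦X⟧ →+* A⟦X⟧⟦X⟧)) ⊗ₖ (1 : Matrix (Idx τ n) (Idx τ n) A⟦X⟧⟦X⟧)

/-- `T₂(v) = ∑ 1 ⊗ e_{ij} ⊗ t_{ij}(v)`. -/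
def leg2 (T : Matrix (Idx τ n) (Idx τ n) A⟦X⟧) :
    Matrix (Idx τ n × Idx τ n) (Idx τ n × Idx τ n) A⟦X⟧⟦X⟧ :=
  (1 : Matrix (Idx τ n) (Idx τ n) A⟦X⟧⟦X⟧) ⊗ₖ
    (T.map (PowerSeries.map (PowerSeries.C : A →+* A⟦X⟧)))

/-- The left-hand side of the `RTT` relation, `R(u - v) T₁(u) T₂(v)`, times the denominator. -/
def rttLeft (T : Matrix (Idx τ n) (Idx τ n) A⟦X⟧) :
    Matrix (Idx τ n × Idx τ n) (Idx τ n × Idx τ n) A⟦X⟧⟦X⟧ :=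
  rMatrix τ n A * leg1 T * leg2 T

/-- The right-hand side of the `RTT` relation, `T₂(v) T₁(u) R(u - v)`, times the denominator. -/
def rttRight (T : Matrix (Idx τ n) (Idx τ n) A⟦X⟧) :
    Matrix (Idx τ n × Idx τ n) (Idx τ n × Idx τ n) A⟦X⟧⟦X⟧ :=
  leg2 T * leg1 T * rMatrix τ n A

end Relations

/-- The free algebra on the symbols `t_{ij}^{(r)}`, `r ≥ 1`; the symbol `(i, j, r)` stands for
`t_{ij}^{(r+1)}`. -/
abbrev Free (τ : ClassicalType) (n : ℕ) : Type := FreeAlgebra ℂ (Idx τ n × Idx τ n × ℕ)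

/-- `T(u)` over the free algebra, with `t_{ij}^{(0)} = δ_{ij}`. -/
def freeT (τ : ClassicalType) (n : ℕ) : Matrix (Idx τ n) (Idx τ n) (Free τ n)⟦X⟧ :=
  fun i j => PowerSeries.mk fun r =>
    match r with
    | 0 => if i = j then 1 else 0
    | r + 1 => FreeAlgebra.ι ℂ (i, j, r)

/-- The defining relations: all entries and all coefficients of the `RTT` relation. -/
def Rel (τ : ClassicalType) (n : ℕ) (a b : Free τ n) : Prop :=
  ∃ (p q : Idx τ n × Idx τ n) (r s : ℕ),
    a = coeff r (coeff s (rttLeft (freeT τ n) p q)) ∧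
    b = coeff r (coeff s (rttRight (freeT τ n) p q))

/-- The extended Yangian `X(𝔞)`. -/
abbrev EY (τ : ClassicalType) (n : ℕ) : Type := RingQuot (Rel τ n)

/-- The matrix `T(u) = (t_{ij}(u))` over `X(𝔞)[[u⁻¹]]`. -/
def T (τ : ClassicalType) (n : ℕ) : Matrix (Idx τ n) (Idx τ n) (EY τ n)⟦X⟧ :=
  (freeT τ n).map (PowerSeries.map (RingQuot.mkAlgHom ℂ (Rel τ n) : Free τ n →+* EY τ n))

section Maps

variable {τ : ClassicalType} {n : ℕ} {A B : Type} [Ring A] [Algebra ℂ A] [Ring B] [Algebra ℂ B]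

/-- The map `A[[u⁻¹, v⁻¹]] → B[[u⁻¹, v⁻¹]]` induced by a homomorphism `A → B`. -/
def map2 (φ : A →ₐ[ℂ] B) : A⟦X⟧⟦X⟧ →+* B⟦X⟧⟦X⟧ :=
  PowerSeries.map (PowerSeries.map (φ : A →+* B))

theorem rMatrix_map (φ : A →ₐ[ℂ] B) : (rMatrix τ n A).map (map2 φ) = rMatrix τ n B := by
  ext1 p q
  have hx : map2 φ (uInv A) = uInv B := by simp [map2, uInv]
  have hy : map2 φ (vInv A) = vInv B := by simp [map2, vInv]
  have hk : map2 φ (kappaC τ n A) = kappaC τ n B := by simp [map2, kappaC]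
  simp only [rMatrix, Matrix.map_apply, Matrix.add_apply, Matrix.sub_apply, Matrix.smul_apply,
    smul_eq_mul, map_add, map_sub, map_mul, hx, hy, hk, Matrix.one_apply, permMatrix, qMatrix,
    apply_ite (map2 φ), map_one, map_zero, map_intCast]

theorem leg1_map (φ : A →ₐ[ℂ] B) (M : Matrix (Idx τ n) (Idx τ n) A⟦X⟧) :
    (leg1 M).map (map2 φ) = leg1 (M.map (PowerSeries.map (φ : A →+* B))) := by
  ext1 p q
  have h : map2 φ (PowerSeries.C (M p.1 q.1)) =
      PowerSeries.C (PowerSeries.map (φ : A →+* B) (M p.1 q.1)) := by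
    simp [map2]
  simp only [leg1, Matrix.map_apply, Matrix.kroneckerMap_apply, Matrix.one_apply, map_mul, h,
    apply_ite (map2 φ), map_one, map_zero]

theorem leg2_map (φ : A →ₐ[ℂ] B) (M : Matrix (Idx τ n) (Idx τ n) A⟦X⟧) :
    (leg2 M).map (map2 φ) = leg2 (M.map (PowerSeries.map (φ : A →+* B))) := by
  ext1 p q
  have h : map2 φ (PowerSeries.map PowerSeries.C (M p.2 q.2)) =
      PowerSeries.map PowerSeries.C (PowerSeries.map (φ : A →+* B) (M p.2 q.2)) := by
    ext1 s
    simp [map2]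
  simp only [leg2, Matrix.map_apply, Matrix.kroneckerMap_apply, Matrix.one_apply, map_mul, h,
    apply_ite (map2 φ), map_one, map_zero]

theorem rttLeft_map (φ : A →ₐ[ℂ] B) (M : Matrix (Idx τ n) (Idx τ n) A⟦X⟧) :
    (rttLeft M).map (map2 φ) = rttLeft (M.map (PowerSeries.map (φ : A →+* B))) := by
  simp only [rttLeft, Matrix.map_mul, rMatrix_map, leg1_map, leg2_map]

theorem rttRight_map (φ : A →ₐ[ℂ] B) (M : Matrix (Idx τ n) (Idx τ n) A⟦X⟧) :
    (rttRight M).map (map2 φ) = rttRight (M.map (PowerSeries.map (φ : A →+* B))) := by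
  simp only [rttRight, Matrix.map_mul, rMatrix_map, leg1_map, leg2_map]

/-- The homomorphism of the free algebra that sends `t_{ij}(u)` to the entries of `M`. -/
def freeLift (M : Matrix (Idx τ n) (Idx τ n) A⟦X⟧) : Free τ n →ₐ[ℂ] A :=
  FreeAlgebra.lift ℂ fun g => coeff (g.2.2 + 1) (M g.1 g.2.1)

theorem freeT_map (M : Matrix (Idx τ n) (Idx τ n) A⟦X⟧)
    (h0 : ∀ i j, coeff 0 (M i j) = if i = j then 1 else 0) :
    (freeT τ n).map (PowerSeries.map (freeLift M : Free τ n →+* A)) = M := by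
  ext i j r
  cases r with
  | zero =>
    rw [h0]
    by_cases h : i = j <;> simp [freeT, h]
  | succ r => simp [freeT, freeLift]

/-- A matrix `M(u) = 1 + O(u⁻¹)` over `A[[u⁻¹]]` that satisfies the `RTT` relation defines a
homomorphism `X(𝔞) → A`, `T(u) ↦ M(u)`. -/
def lift (M : Matrix (Idx τ n) (Idx τ n) A⟦X⟧)
    (h0 : ∀ i j, coeff 0 (M i j) = if i = j then 1 else 0)
    (hM : rttLeft M = rttRight M) : EY τ n →ₐ[ℂ] A :=
  RingQuot.liftAlgHom ℂ ⟨freeLift M, by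
    rintro a b ⟨p, q, r, s, rfl, rfl⟩
    have hl := congrFun (congrFun (rttLeft_map (freeLift M) (freeT τ n)) p) q
    have hr := congrFun (congrFun (rttRight_map (freeLift M) (freeT τ n)) p) q
    rw [freeT_map M h0] at hl hr
    have h := congrArg (fun g => coeff r (coeff s g)) (hl.trans ((congrFun (congrFun hM p) q).trans
      hr.symm))
    simpa [map2] using h⟩

theorem map_lift_T (M : Matrix (Idx τ n) (Idx τ n) A⟦X⟧)
    (h0 : ∀ i j, coeff 0 (M i j) = if i = j then 1 else 0)
    (hM : rttLeft M = rttRight M) :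
    (T τ n).map (PowerSeries.map (lift M h0 hM : EY τ n →+* A)) = M := by
  conv_rhs => rw [← freeT_map M h0]
  ext i j r
  simp only [T, lift, Matrix.map_apply, PowerSeries.coeff_map, RingHom.coe_coe]
  exact RingQuot.liftAlgHom_mkAlgHom_apply ℂ (freeLift M) _ _

theorem rtt_T (τ : ClassicalType) (n : ℕ) : rttLeft (T τ n) = rttRight (T τ n) := by
  rw [T, ← rttLeft_map, ← rttRight_map]
  ext p q s r
  simp only [map2, Matrix.map_apply, PowerSeries.coeff_map, RingHom.coe_coe]
  exact RingQuot.mkAlgHom_rel ℂ (s := Rel τ n) ⟨p, q, r, s, rfl, rfl⟩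

theorem coeff_zero_T (τ : ClassicalType) (n : ℕ) (i j : Idx τ n) :
    coeff 0 (T τ n i j) = if i = j then 1 else 0 := by
  by_cases h : i = j <;> simp [T, freeT, h]

/-- The image of a scalar series `f(u)` in `A[[u⁻¹]]`. -/
def scal (A : Type) [Ring A] [Algebra ℂ A] (f : ℂ⟦X⟧) : A⟦X⟧ :=
  PowerSeries.map (algebraMap ℂ A) f

theorem scal_comm (f : ℂ⟦X⟧) (g : A⟦X⟧) : scal A f * g = g * scal A f := by
  ext r
  rw [coeff_mul, coeff_mul, ← Finset.Nat.sum_antidiagonal_swap]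
  refine Finset.sum_congr rfl fun x _ => ?_
  simp [scal, Algebra.commutes]

theorem scal_comm1 (f : ℂ⟦X⟧) (g : A⟦X⟧⟦X⟧) :
    PowerSeries.C (scal A f) * g = g * PowerSeries.C (scal A f) := by
  ext1 r
  simp [scal_comm]

theorem scal_comm2 (f : ℂ⟦X⟧) (g : A⟦X⟧⟦X⟧) :
    PowerSeries.map PowerSeries.C (scal A f) * g =
      g * PowerSeries.map PowerSeries.C (scal A f) := by
  ext1 r
  rw [coeff_mul, coeff_mul, ← Finset.Nat.sum_antidiagonal_swap]
  refine Finset.sum_congr rfl fun x _ => ?_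
  ext1 s
  simp [scal, Algebra.commutes]

/-- The matrix `f(u) M(u)`. -/
def scaled (f : ℂ⟦X⟧) (M : Matrix (Idx τ n) (Idx τ n) A⟦X⟧) :
    Matrix (Idx τ n) (Idx τ n) A⟦X⟧ :=
  fun i j => scal A f * M i j

theorem rtt_scaled (f : ℂ⟦X⟧) (M : Matrix (Idx τ n) (Idx τ n) A⟦X⟧)
    (hM : rttLeft M = rttRight M) : rttLeft (scaled f M) = rttRight (scaled f M) := by
  set F : A⟦X⟧⟦X⟧ := PowerSeries.C (scal A f)
  set G : A⟦X⟧⟦X⟧ := PowerSeries.map PowerSeries.C (scal A f)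
  have h1 : leg1 (scaled f M) = F • leg1 M := by
    ext1 p q
    simp [leg1, scaled, F, mul_assoc]
  have h2 : leg2 (scaled f M) = G • leg2 M := by
    ext1 p q
    simp only [leg2, scaled, Matrix.kroneckerMap_apply, Matrix.map_apply, map_mul, Matrix.smul_apply,
      smul_eq_mul, G, Matrix.one_apply]
    split_ifs <;> simp
  have cF : ∀ (L K : Matrix (Idx τ n × Idx τ n) (Idx τ n × Idx τ n) A⟦X⟧⟦X⟧),
      L * (F • K) = F • (L * K) := by
    intro L K
    ext1 p q
    simp only [Matrix.mul_apply, Matrix.smul_apply, smul_eq_mul, Finset.mul_sum]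
    refine Finset.sum_congr rfl fun x _ => ?_
    rw [← mul_assoc, ← mul_assoc, scal_comm1]
  have cG : ∀ (L K : Matrix (Idx τ n × Idx τ n) (Idx τ n × Idx τ n) A⟦X⟧⟦X⟧),
      L * (G • K) = G • (L * K) := by
    intro L K
    ext1 p q
    simp only [Matrix.mul_apply, Matrix.smul_apply, smul_eq_mul, Finset.mul_sum]
    refine Finset.sum_congr rfl fun x _ => ?_
    rw [← mul_assoc, ← mul_assoc, scal_comm2]
  have hFG : F * G = G * F := scal_comm1 f G
  simp only [rttLeft, rttRight] at hM ⊢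
  rw [h1, h2]
  simp only [cF, cG, Matrix.smul_mul, smul_smul]
  rw [hFG, hM]

end Maps

/-- The map `μ_f : T(u) ↦ f(u) T(u)` for `f(u) = 1 + f₁ u⁻¹ + …`. -/
def mulHom (τ : ClassicalType) (n : ℕ) (f : ℂ⟦X⟧) (hf : constantCoeff f = 1) :
    EY τ n →ₐ[ℂ] EY τ n :=
  lift (scaled f (T τ n))
    (by
      intro i j
      have h := coeff_zero_T τ n i j
      rw [scaled, coeff_mul, Finset.Nat.antidiagonal_zero, Finset.sum_singleton]
      rw [h, scal, PowerSeries.coeff_map, coeff_zero_eq_constantCoeff_apply, hf, map_one, one_mul])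
    (rtt_scaled f _ (rtt_T τ n))

/-- The Yangian `Y(𝔞)`: the subalgebra of the elements of `X(𝔞)` that are stable under
all `μ_f`. -/
def Yangian (τ : ClassicalType) (n : ℕ) : Subalgebra ℂ (EY τ n) :=
  ⨅ (f : ℂ⟦X⟧) (hf : constantCoeff f = 1),
    AlgHom.equalizer (mulHom τ n f hf) (AlgHom.id ℂ (EY τ n))

/-- The series `(u + c)⁻¹ = x / (1 + c x)`, where `x = u⁻¹`. -/
def shiftInv (c : ℂ) : ℂ⟦X⟧ := PowerSeries.X * (1 + PowerSeries.C c * PowerSeries.X)⁻¹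

/-- The shift `g(u) ↦ g(u + c)`: if `g(u) = ∑ g_r u^{-r}`, then `g(u + c) = ∑ g_r (u + c)^{-r}`,
and `(u + c)^{-r}` contributes to the coefficient of `u^{-m}` for `r ≤ m` only. -/
def shift {A : Type} [Ring A] [Algebra ℂ A] (c : ℂ) (g : A⟦X⟧) : A⟦X⟧ :=
  PowerSeries.mk fun m => ∑ r ∈ Finset.range (m + 1), coeff m (shiftInv c ^ r) • coeff r g

/-- The matrix `Tᵗ(u + κ)`, where `(e_{ij})ᵗ = θ_{ij} e_{-j,-i}`: the `(k, l)` entry is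
`θ_{kl} t_{-l,-k}(u + κ)`. -/
def Tt (τ : ClassicalType) (n : ℕ) : Matrix (Idx τ n) (Idx τ n) (EY τ n)⟦X⟧ :=
  fun k l => theta τ k l • shift (kappa τ n) (T τ n (neg l) (neg k))

/-- The series `z(u)` such that `Tᵗ(u + κ) T(u) = z(u) 1`, as the normalized trace of the
left-hand side. -/
def z (τ : ClassicalType) (n : ℕ) : (EY τ n)⟦X⟧ :=
  ((size τ n : ℂ)⁻¹) • Matrix.trace (Tt τ n * T τ n)

/-- The subalgebra `ZX(𝔞)` generated by the coefficients `z₁, z₂, …` of `z(u)`. -/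
def ZX (τ : ClassicalType) (n : ℕ) : Subalgebra ℂ (EY τ n) :=
  Algebra.adjoin ℂ (Set.range fun r : ℕ => coeff (r + 1) (z τ n))

end ExtendedYangian

end

/-! The series `z(u)` exists because the substitution `u = v + κ` in the RTT relation, with
denominators cleared, leaves only the `Q` terms; the resulting identity says that `Mᵗ(u + κ) M(u)`
and `M(u) Mᵗ(u + κ)` are one and the same scalar matrix (`transp_mul_and_mul_transp`). This is
proved for every matrix `M` that satisfies the RTT relation over any algebra.

For the center, filter the algebra by giving `t_{ij}^{(r)}` the degree `2 r - 1`. Commutators then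
drop the degree by at least one, and their leading part is an explicit bracket linear in the
generators (`gen_commutator`), while `Tᵗ T = z` says that `t_{ij} + θ_{ij} t_{-j,-i}` equals `δ_{ij}
z` up to lower terms. Accordingly the leading term of a generator is the polynomial `sigma`, in
variables for the generators and for the coefficients of `z(u)`. A priori `symbol` is only a
relation between elements and polynomials. That a polynomial is determined by the element is the
Poincaré–Birkhoff–Witt theorem (`symbol_unique`). It follows from the existence of operators on the
algebra whose symbols are the partial derivatives. Those for the generators come from the coproduct
followed by the vector representation, `T(u) ↦ T(u) R(u - c)`, which rests on the Yang–Baxter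
equation (`rtt_vecRep`); those for `z(u)` come from `T(u) ↦ (1 + η u^{-r-1}) T(u)`. Conversely,
`sub_ev_mem` recovers an element from its symbol up to lower degree.

Centrality of `z(u)` (`zSeries_coeff_commute`): `z` is multiplicative under these homomorphisms. A
first nonzero commutator of a coefficient of `z(u)` with one of `T(u)` would therefore be killed by
all the operators above, hence be a scalar, and a character shows that this scalar is zero.

An element `w` that commutes with `Y(𝔞)` commutes with all `t_{oo}(u)⁻¹ t_{kl}(u)`. Its symbol is
then annihilated by the symbols `adSymbol` of all inner derivations. Bracketing these with a partial
derivative in a variable of very high index shows that the symbol involves only the variables of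
`z(u)` (`pderiv_eq_zero_of_invariant`). Subtracting the corresponding polynomial in the `z_r` and
descending in degree gives `mem_adjoin_of_commute`: the centralizer of `Y(𝔞)` lies in `ZX(𝔞)`. This
is (ii), and it puts the center of `Y(𝔞)` inside `ZX(𝔞)`.

The character `T(u) ↦ g(u) 1` sends `z(u)` to `g(u) g(u + κ)`, which can be any series with constant
term one. So a polynomial in the `z_r` is determined by its values at characters, which gives (iii).
On an element of `Y(𝔞)` all these characters take the same value, so a polynomial in the `z_r` that
lies in `Y(𝔞)` is a scalar, which gives (i). -/

noncomputable section

set_option linter.unusedSectionVars false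
set_option linter.unusedSimpArgs false

namespace ExtendedYangian

/-! ### Signs -/

/-- The sign `s_i` with `θ_{ij} = s_i s_j`. -/
def sg : (τ : ClassicalType) → {n : ℕ} → Idx τ n → ℤ
  | .B, _, _ => 1
  | .C, _, i => Int.sign i.1
  | .D, _, _ => 1

/-- `1` in the orthogonal and `-1` in the symplectic case. -/
def eps : ClassicalType → ℤ
  | .B => 1
  | .C => -1
  | .D => 1

section Signs

variable {τ : ClassicalType} {n : ℕ}

theorem theta_eq (i j : Idx τ n) : theta τ i j = sg τ i * sg τ j := by
  cases τ <;> simp [theta, sg]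

/-- In the symplectic case this depends on `0` not being an index. -/
theorem sg_mul_self (i : Idx τ n) : sg τ i * sg τ i = 1 := by
  cases τ
  · simp [sg]
  · have h := i.2
    simp only [idxSet, Finset.mem_erase] at h
    rcases lt_trichotomy i.1 0 with h' | h' | h'
    · simp [sg, Int.sign_eq_neg_one_of_neg h']
    · exact absurd h' h.1
    · simp [sg, Int.sign_eq_one_of_pos h']
  · simp [sg]

@[simp] theorem neg_neg' (i : Idx τ n) : neg (neg i) = i := by
  simp [neg]

theorem sg_neg (i : Idx τ n) : sg τ (neg i) = eps τ * sg τ i := by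
  cases τ <;> simp [sg, eps, neg]

theorem eps_mul_self (τ : ClassicalType) : eps τ * eps τ = 1 := by
  cases τ <;> simp [eps]

theorem neg_injective : Function.Injective (neg : Idx τ n → Idx τ n) :=
  Function.LeftInverse.injective neg_neg'

theorem neg_eq_iff {i j : Idx τ n} : neg i = j ↔ i = neg j :=
  ⟨fun h => by rw [← h, neg_neg'], fun h => by rw [h, neg_neg']⟩

/-- The involution `i ↦ -i` as a permutation. -/
def negEquiv (τ : ClassicalType) (n : ℕ) : Idx τ n ≃ Idx τ n :=
  ⟨neg, neg, neg_neg', neg_neg'⟩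

theorem sum_neg {M : Type*} [AddCommMonoid M] (f : Idx τ n → M) :
    ∑ i, f (neg i) = ∑ i, f i :=
  (negEquiv τ n).sum_comp f

theorem theta_self (i : Idx τ n) : theta τ i i = 1 := by
  rw [theta_eq, sg_mul_self]

theorem theta_comm (i j : Idx τ n) : theta τ i j = theta τ j i := by
  rw [theta_eq, theta_eq, mul_comm]

theorem theta_mul (i j k : Idx τ n) : theta τ i j * theta τ j k = theta τ i k := by
  simp only [theta_eq]
  linear_combination sg τ i * sg τ k * sg_mul_self j

theorem theta_neg_neg (i j : Idx τ n) : theta τ (neg i) (neg j) = theta τ i j := by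
  simp only [theta_eq, sg_neg]
  linear_combination sg τ i * sg τ j * eps_mul_self τ

theorem theta_mul_self (i j : Idx τ n) : theta τ i j * theta τ i j = 1 := by
  simp only [theta_eq]
  linear_combination sg τ j * sg τ j * sg_mul_self i + sg_mul_self j

theorem theta_neg_left (i j : Idx τ n) : theta τ (neg i) j = theta τ i (neg j) := by
  rw [← theta_neg_neg, neg_neg']

theorem theta_neg_self (i : Idx τ n) : theta τ i (neg i) = eps τ := by
  rw [theta_eq, sg_neg]
  linear_combination eps τ * sg_mul_self i

theorem card_idx (τ : ClassicalType) (n : ℕ) : Fintype.card (Idx τ n) = size τ n := by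
  rw [Fintype.card_coe]
  cases τ
  · simp [idxSet, size]; omega
  · rw [idxSet, Finset.card_erase_of_mem (by simp)]; simp [size]; omega
  · rw [idxSet, Finset.card_erase_of_mem (by simp)]; simp [size]; omega

/-- This relation between `N` and `κ` is what makes the last coefficient in the Yang–Baxter equation
vanish. -/
theorem size_eq (τ : ClassicalType) (n : ℕ) :
    (size τ n : ℂ) = 2 * kappa τ n + 2 * (eps τ : ℤ) := by
  cases τ <;> simp [kappa, eps] <;> ring

/-- The excluded algebra `𝔬₂` is exactly the case `κ = 0`, where the two poles of the `R`-matrix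
collide. -/
theorem kappa_ne_zero (hn : 1 ≤ n) (hD : τ = ClassicalType.D → 2 ≤ n) : kappa τ n ≠ 0 := by
  intro h
  have h2 : (size τ n : ℂ) = 2 * (eps τ : ℤ) := by rw [size_eq, h]; ring
  have h3 : (size τ n : ℤ) = 2 * eps τ := by exact_mod_cast h2
  cases τ <;> simp [size, eps] at h3 hD <;> omega

theorem size_ne_zero (hn : 1 ≤ n) : (size τ n : ℂ) ≠ 0 := by
  have : size τ n ≠ 0 := by cases τ <;> simp [size] <;> omega
  exact_mod_cast this

theorem idx_nonempty (hn : 1 ≤ n) : Nonempty (Idx τ n) :=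
  ⟨⟨1, by cases τ <;> simp [idxSet] <;> omega⟩⟩

end Signs

/-! ### Entries of the `RTT` relation -/

section Entries

variable {τ : ClassicalType} {n : ℕ} {A : Type} [Ring A] [Algebra ℂ A]

/-- `g(u)` as a series in `u⁻¹, v⁻¹`. -/
abbrev atU (g : A⟦X⟧) : A⟦X⟧⟦X⟧ := PowerSeries.C g

/-- `g(v)` as a series in `u⁻¹, v⁻¹`. -/
abbrev atV (g : A⟦X⟧) : A⟦X⟧⟦X⟧ := PowerSeries.map PowerSeries.C g

theorem coeff_atU_mul_atV (g h : A⟦X⟧) (r s : ℕ) :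
    coeff r (coeff s (atU g * atV h)) = coeff r g * coeff s h := by
  simp [atU, atV]

theorem coeff_atV_mul_atU (g h : A⟦X⟧) (r s : ℕ) :
    coeff r (coeff s (atV h * atU g)) = coeff s h * coeff r g := by
  simp [atU, atV]

theorem leg1_mul_leg2_apply (M K : Matrix (Idx τ n) (Idx τ n) A⟦X⟧) (a b j l : Idx τ n) :
    (leg1 M * leg2 K) (a, b) (j, l) = atU (M a j) * atV (K b l) := by
  rw [Matrix.mul_apply, Fintype.sum_prod_type]
  simp only [leg1, leg2, Matrix.kroneckerMap_apply, Matrix.one_apply, Matrix.map_apply]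
  rw [Finset.sum_eq_single j, Finset.sum_eq_single b]
  · simp
  · intro c _ hc
    simp [Ne.symm hc]
  · simp
  · intro c _ hc
    simp [hc]
  · simp

theorem leg2_mul_leg1_apply (M K : Matrix (Idx τ n) (Idx τ n) A⟦X⟧) (a b j l : Idx τ n) :
    (leg2 K * leg1 M) (a, b) (j, l) = atV (K b l) * atU (M a j) := by
  rw [Matrix.mul_apply, Fintype.sum_prod_type]
  simp only [leg1, leg2, Matrix.kroneckerMap_apply, Matrix.one_apply, Matrix.map_apply]
  rw [Finset.sum_eq_single a, Finset.sum_eq_single l]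
  · simp
  · intro c _ hc
    simp [hc]
  · simp
  · intro c _ hc
    simp [Ne.symm hc]
  · simp

theorem permMatrix_mul_apply (L : Matrix (Idx τ n × Idx τ n) (Idx τ n × Idx τ n) A⟦X⟧⟦X⟧)
    (i k : Idx τ n) (q : Idx τ n × Idx τ n) :
    (permMatrix τ n A⟦X⟧⟦X⟧ * L) (i, k) q = L (k, i) q := by
  rw [Matrix.mul_apply, Finset.sum_eq_single (k, i)]
  · simp [permMatrix]
  · rintro ⟨a, b⟩ _ h
    have : ¬ (i = b ∧ k = a) := by rintro ⟨rfl, rfl⟩; exact h rfl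
    simp [permMatrix, this]
  · simp

theorem mul_permMatrix_apply (L : Matrix (Idx τ n × Idx τ n) (Idx τ n × Idx τ n) A⟦X⟧⟦X⟧)
    (p : Idx τ n × Idx τ n) (j l : Idx τ n) :
    (L * permMatrix τ n A⟦X⟧⟦X⟧) p (j, l) = L p (l, j) := by
  rw [Matrix.mul_apply, Finset.sum_eq_single (l, j)]
  · simp [permMatrix]
  · rintro ⟨a, b⟩ _ h
    have : ¬ (a = l ∧ b = j) := by rintro ⟨rfl, rfl⟩; exact h rfl
    simp [permMatrix, this]
  · simp

theorem qMatrix_mul_apply (L : Matrix (Idx τ n × Idx τ n) (Idx τ n × Idx τ n) A⟦X⟧⟦X⟧)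
    (i k : Idx τ n) (q : Idx τ n × Idx τ n) :
    (qMatrix τ n A⟦X⟧⟦X⟧ * L) (i, k) q =
      if k = neg i then ∑ a, theta τ i a • L (a, neg a) q else 0 := by
  rw [Matrix.mul_apply, Fintype.sum_prod_type]
  simp only [qMatrix]
  split_ifs with h
  · refine Finset.sum_congr rfl fun a _ => ?_
    rw [Finset.sum_eq_single (neg a)]
    · simp [h]
    · intro b _ hb
      simp [hb]
    · simp
  · simp [h]

theorem mul_qMatrix_apply (L : Matrix (Idx τ n × Idx τ n) (Idx τ n × Idx τ n) A⟦X⟧⟦X⟧)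
    (p : Idx τ n × Idx τ n) (j l : Idx τ n) :
    (L * qMatrix τ n A⟦X⟧⟦X⟧) p (j, l) =
      if l = neg j then ∑ a, theta τ a j • L p (a, neg a) else 0 := by
  rw [Matrix.mul_apply, Fintype.sum_prod_type]
  simp only [qMatrix]
  split_ifs with h
  · refine Finset.sum_congr rfl fun a _ => ?_
    rw [Finset.sum_eq_single (neg a)]
    · simp [h, (Int.cast_commute _ _).eq]
    · intro b _ hb
      simp [hb]
    · simp
  · simp [h]

theorem uInv_comm (G : A⟦X⟧⟦X⟧) : Commute (uInv A) G := by
  show _ = _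
  rw [uInv]
  ext1 s
  simp [(PowerSeries.commute_X _).eq]

theorem vInv_comm (G : A⟦X⟧⟦X⟧) : Commute (vInv A) G :=
  (PowerSeries.commute_X G).symm

theorem kappaC_comm (G : A⟦X⟧⟦X⟧) : Commute (kappaC τ n A) G := by
  show _ = _
  rw [kappaC]
  ext s r
  simp [Algebra.commutes]

variable (τ n A) in
/-- `y - x - κ x y = x y (u - v - κ)`. -/
def denQ : A⟦X⟧⟦X⟧ := vInv A - uInv A - kappaC τ n A * uInv A * vInv A

variable (A) in
/-- `y - x = x y (u - v)`. -/
def denP : A⟦X⟧⟦X⟧ := vInv A - uInv A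

theorem denP_comm (G : A⟦X⟧⟦X⟧) : Commute (denP A) G :=
  (vInv_comm G).sub_left (uInv_comm G)

theorem denQ_comm (G : A⟦X⟧⟦X⟧) : Commute (denQ τ n A) G :=
  (denP_comm G).sub_left (((kappaC_comm G).mul_left (uInv_comm G)).mul_left (vInv_comm G))

theorem rMatrix_eq : rMatrix τ n A =
    (denP A * denQ τ n A) • (1 : Matrix (Idx τ n × Idx τ n) (Idx τ n × Idx τ n) A⟦X⟧⟦X⟧)
    - (uInv A * vInv A * denQ τ n A) • permMatrix τ n A⟦X⟧⟦X⟧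
    + (uInv A * vInv A * denP A) • qMatrix τ n A⟦X⟧⟦X⟧ := rfl

theorem mul_central_smul {ι : Type} [Fintype ι] {c : A⟦X⟧⟦X⟧}
    (hc : ∀ G, Commute c G) (L K : Matrix ι ι A⟦X⟧⟦X⟧) : L * (c • K) = c • (L * K) := by
  ext1 p q
  simp only [Matrix.mul_apply, Matrix.smul_apply, smul_eq_mul, Finset.mul_sum]
  refine Finset.sum_congr rfl fun x _ => ?_
  rw [← mul_assoc, ← mul_assoc, (hc _).eq]

theorem coefA_comm (G : A⟦X⟧⟦X⟧) : Commute (denP A * denQ τ n A) G :=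
  (denP_comm G).mul_left (denQ_comm G)

theorem coefB_comm (G : A⟦X⟧⟦X⟧) : Commute (uInv A * vInv A * denQ τ n A) G :=
  ((uInv_comm G).mul_left (vInv_comm G)).mul_left (denQ_comm G)

theorem coefC_comm (G : A⟦X⟧⟦X⟧) : Commute (uInv A * vInv A * denP A) G :=
  ((uInv_comm G).mul_left (vInv_comm G)).mul_left (denP_comm G)

theorem rttLeft_apply (M : Matrix (Idx τ n) (Idx τ n) A⟦X⟧) (i j k l : Idx τ n) :
    rttLeft M (i, k) (j, l) =
      denP A * denQ τ n A * (atU (M i j) * atV (M k l))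
      - uInv A * vInv A * denQ τ n A * (atU (M k j) * atV (M i l))
      + uInv A * vInv A * denP A * (if k = neg i then
          ∑ a, theta τ i a • (atU (M a j) * atV (M (neg a) l)) else 0) := by
  rw [rttLeft, mul_assoc, rMatrix_eq, Matrix.add_mul, Matrix.sub_mul, Matrix.smul_mul,
    Matrix.smul_mul, Matrix.smul_mul, Matrix.one_mul]
  simp only [Matrix.add_apply, Matrix.sub_apply, Matrix.smul_apply, permMatrix_mul_apply,
    qMatrix_mul_apply, leg1_mul_leg2_apply, smul_eq_mul]

theorem rttRight_apply (M : Matrix (Idx τ n) (Idx τ n) A⟦X⟧) (i j k l : Idx τ n) :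
    rttRight M (i, k) (j, l) =
      denP A * denQ τ n A * (atV (M k l) * atU (M i j))
      - uInv A * vInv A * denQ τ n A * (atV (M k j) * atU (M i l))
      + uInv A * vInv A * denP A * (if l = neg j then
          ∑ a, theta τ a j • (atV (M k (neg a)) * atU (M i a)) else 0) := by
  rw [rttRight, rMatrix_eq, Matrix.mul_add, Matrix.mul_sub, mul_central_smul coefA_comm,
    mul_central_smul coefB_comm, mul_central_smul coefC_comm, Matrix.mul_one]
  simp only [Matrix.add_apply, Matrix.sub_apply, Matrix.smul_apply, mul_permMatrix_apply,
    mul_qMatrix_apply, leg2_mul_leg1_apply, smul_eq_mul]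

theorem rearrange {G : Type*} [AddCommGroup G] {a b c a' b' c' : G}
    (h : a - b + c = a' - b' + c') : a - a' = b - b' - (c - c') := by
  have h' : a = a' - b' + c' - c + b := by rw [← h]; abel
  rw [h']
  abel

/-- The commutation relations of the entries, with denominators cleared. -/
theorem rtt_entry {M : Matrix (Idx τ n) (Idx τ n) A⟦X⟧} (hM : rttLeft M = rttRight M)
    (i j k l : Idx τ n) :
    denP A * denQ τ n A * (atU (M i j) * atV (M k l) - atV (M k l) * atU (M i j)) =
      uInv A * vInv A * denQ τ n A *
        (atU (M k j) * atV (M i l) - atV (M k j) * atU (M i l))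
      - uInv A * vInv A * denP A *
        ((if k = neg i then ∑ a, theta τ i a • (atU (M a j) * atV (M (neg a) l)) else 0)
          - (if l = neg j then ∑ a, theta τ a j • (atV (M k (neg a)) * atU (M i a)) else 0)) := by
  have h := congrFun (congrFun hM (i, k)) (j, l)
  rw [rttLeft_apply, rttRight_apply] at h
  simp only [mul_sub]
  exact rearrange h

end Entries

/-! ### The shift `g(u) ↦ g(u + c)` -/

section Shift

variable {A B : Type} [Ring A] [Algebra ℂ A] [Ring B] [Algebra ℂ B]

theorem shiftInv_mul (c : ℂ) :
    shiftInv c * (1 + PowerSeries.C c * PowerSeries.X) = PowerSeries.X := by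
  rw [shiftInv, mul_assoc, PowerSeries.inv_mul_cancel _ (by simp), mul_one]

theorem coeff_shiftInv_pow_of_lt (c : ℂ) {m r : ℕ} (h : m < r) : coeff m (shiftInv c ^ r) = 0 := by
  rw [shiftInv, mul_pow, coeff_X_pow_mul', if_neg (not_le.2 h)]

theorem coeff_shiftInv_pow_self (c : ℂ) (m : ℕ) : coeff m (shiftInv c ^ m) = 1 := by
  rw [shiftInv, mul_pow, coeff_X_pow_mul', if_pos le_rfl, Nat.sub_self,
    coeff_zero_eq_constantCoeff_apply]
  simp

/-- Since `(u + c)^{-r}` starts at `u^{-r}`, any longer summation range gives the same coefficient;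
sums for different `m` can thus share one range. -/
theorem coeff_shift (c : ℂ) (g : A⟦X⟧) {m K : ℕ} (h : m < K) :
    coeff m (shift c g) = ∑ r ∈ Finset.range K, coeff m (shiftInv c ^ r) • coeff r g := by
  rw [shift, coeff_mk]
  refine Finset.sum_subset (Finset.range_subset_range.2 h) fun r _ hr => ?_
  rw [coeff_shiftInv_pow_of_lt c (by simpa using hr), zero_smul]

theorem coeff_shift_eq (c : ℂ) (g : A⟦X⟧) (m : ℕ) :
    coeff m (shift c g) =
      ∑ r ∈ Finset.range m, coeff m (shiftInv c ^ r) • coeff r g + coeff m g := by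
  rw [coeff_shift c g (Nat.lt_succ_self m), Finset.sum_range_succ, coeff_shiftInv_pow_self, one_smul]

theorem coeff_zero_shift (c : ℂ) (g : A⟦X⟧) : coeff 0 (shift c g) = coeff 0 g := by
  rw [coeff_shift_eq, Finset.sum_range_zero, zero_add]

/-- The shift as a `ℂ`-linear map. -/
def shiftₗ (A : Type) [Ring A] [Algebra ℂ A] (c : ℂ) : A⟦X⟧ →ₗ[ℂ] A⟦X⟧ where
  toFun := shift c
  map_add' g h := by
    ext m
    simp [shift, Finset.sum_add_distrib]
  map_smul' a g := by
    ext m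
    simp [shift, Finset.smul_sum, smul_comm a]

theorem shiftₗ_apply (c : ℂ) (g : A⟦X⟧) : shiftₗ A c g = shift c g := rfl

theorem shift_sum {ι : Type*} (s : Finset ι) (c : ℂ) (g : ι → A⟦X⟧) :
    shift c (∑ i ∈ s, g i) = ∑ i ∈ s, shift c (g i) :=
  map_sum (shiftₗ A c) g s

theorem shift_zsmul (c : ℂ) (a : ℤ) (g : A⟦X⟧) : shift c (a • g) = a • shift c g :=
  map_zsmul (shiftₗ A c) a g

theorem shift_C (c : ℂ) (a : A) : shift c (PowerSeries.C a) = PowerSeries.C a := by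
  ext m
  rw [coeff_shift_eq]
  rcases m with _ | m
  · simp
  · rw [Finset.sum_eq_single 0]
    · simp [coeff_C, coeff_one]
    · intro r _ hr
      simp [coeff_C, hr]
    · simp

theorem shift_mul (c : ℂ) (g h : A⟦X⟧) : shift c (g * h) = shift c g * shift c h := by
  ext m
  have key : ∀ i j, coeff m (shiftInv c ^ (i + j)) =
      ∑ p ∈ Finset.HasAntidiagonal.antidiagonal m, coeff p.1 (shiftInv c ^ i) * coeff p.2 (shiftInv c ^ j) := by
    intro i j
    rw [pow_add, coeff_mul]
  have hR : coeff m (shift c g * shift c h) = ∑ i ∈ Finset.range (m + 1),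
      ∑ j ∈ Finset.range (m + 1), coeff m (shiftInv c ^ (i + j)) • (coeff i g * coeff j h) := by
    rw [coeff_mul]
    simp only [key, Finset.sum_smul]
    rw [Finset.sum_congr rfl fun i _ => Finset.sum_comm, Finset.sum_comm]
    refine Finset.sum_congr rfl fun p hp => ?_
    have hp' : p.1 + p.2 = m := by simpa using hp
    rw [coeff_shift c g (show p.1 < m + 1 by omega), coeff_shift c h (show p.2 < m + 1 by omega),
      Finset.sum_mul_sum]
    simp only [smul_mul_smul_comm]
  have hL : coeff m (shift c (g * h)) = ∑ i ∈ Finset.range (m + 1),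
      ∑ j ∈ Finset.range (m + 1 - i), coeff m (shiftInv c ^ (i + j)) •
        (coeff i g * coeff j h) := by
    rw [coeff_shift c _ (Nat.lt_succ_self m), ← Finset.sum_range_diag_flip (m + 1)
      fun i j => coeff m (shiftInv c ^ (i + j)) • (coeff i g * coeff j h)]
    refine Finset.sum_congr rfl fun r _ => ?_
    rw [coeff_mul, Finset.smul_sum, Finset.Nat.sum_antidiagonal_eq_sum_range_succ
      (fun i j => coeff m (shiftInv c ^ r) • (coeff i g * coeff j h))]
    refine Finset.sum_congr rfl fun k hk => ?_
    rw [Nat.add_sub_cancel' (by simpa [Nat.lt_succ_iff] using hk)]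
  rw [hL, hR]
  -- One side runs over the triangle `i + j ≤ m`, the other over the whole square; off the triangle
  -- `(u + c)^{-(i+j)}` has no `u^{-m}` term.
  refine Finset.sum_congr rfl fun i _ => ?_
  refine Finset.sum_subset (Finset.range_subset_range.2 (Nat.sub_le _ _)) fun j _ hj => ?_
  rw [coeff_shiftInv_pow_of_lt c (by simp at hj; omega), zero_smul]

theorem shift_map (c : ℂ) (φ : A →ₐ[ℂ] B) (g : A⟦X⟧) :
    shift c (PowerSeries.map (φ : A →+* B) g) = PowerSeries.map (φ : A →+* B) (shift c g) := by
  ext m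
  simp [shift]

theorem scal_X : scal A (PowerSeries.X : ℂ⟦X⟧) = PowerSeries.X := by
  simp [scal]

theorem scal_mul (f g : ℂ⟦X⟧) : scal A (f * g) = scal A f * scal A g := by
  simp [scal]

theorem scal_add (f g : ℂ⟦X⟧) : scal A (f + g) = scal A f + scal A g := by
  simp [scal]

theorem scal_C_mul (a : ℂ) (g : A⟦X⟧) : scal A (PowerSeries.C a) * g = a • g := by
  ext m
  rw [PowerSeries.coeff_smul, scal, PowerSeries.map_C, coeff_C_mul, Algebra.smul_def]

theorem shift_X_mul (c : ℂ) (g : A⟦X⟧) :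
    shift c (PowerSeries.X * g) = scal A (shiftInv c) * shift c g := by
  rw [shift_mul]
  congr 1
  ext m
  rw [coeff_shift c _ (show m < m + 2 by omega), Finset.sum_eq_single 1]
  · simp [scal, Algebra.smul_def]
  · intro r _ hr
    simp [coeff_X, hr]
  · simp

end Shift

/-! ### The substitution `u = v + κ` -/

section Diagonal

variable {A : Type} [Ring A] [Algebra ℂ A]

/-- The substitution `u = v + c` in a series in `u⁻¹, v⁻¹`. -/
def substShift (A : Type) [Ring A] [Algebra ℂ A] (c : ℂ) : A⟦X⟧⟦X⟧ →+ A⟦X⟧ where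
  toFun G := PowerSeries.mk fun m =>
    ∑ p ∈ Finset.HasAntidiagonal.antidiagonal m, coeff p.1 (shiftₗ A c (coeff p.2 G))
  map_zero' := by
    ext m
    simp
  map_add' G H := by
    ext m
    simp [Finset.sum_add_distrib]

theorem coeff_substShift (c : ℂ) (G : A⟦X⟧⟦X⟧) (m : ℕ) :
    coeff m (substShift A c G) =
      ∑ p ∈ Finset.HasAntidiagonal.antidiagonal m, coeff p.1 (shift c (coeff p.2 G)) := by
  simp [substShift, shiftₗ_apply]

/-- Full multiplicativity of the substitution is never needed: the RTT relation involves only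
products of one series in `u` and one in `v`, in either order, and the central factors treated
below. -/
theorem substShift_atU_mul_atV (c : ℂ) (g h : A⟦X⟧) :
    substShift A c (atU g * atV h) = shift c g * h := by
  ext m
  rw [coeff_substShift, coeff_mul]
  refine Finset.sum_congr rfl fun p _ => ?_
  rw [coeff_C_mul, PowerSeries.coeff_map, shift_mul, shift_C, coeff_mul_C]

theorem substShift_atV_mul_atU (c : ℂ) (g h : A⟦X⟧) :
    substShift A c (atV h * atU g) = h * shift c g := by
  ext m
  rw [coeff_substShift, coeff_mul, ← Finset.Nat.sum_antidiagonal_swap]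
  refine Finset.sum_congr rfl fun p _ => ?_
  rw [coeff_mul_C, PowerSeries.coeff_map, shift_mul, shift_C, coeff_C_mul]
  rfl

theorem substShift_uInv_mul (c : ℂ) (G : A⟦X⟧⟦X⟧) :
    substShift A c (uInv A * G) = scal A (shiftInv c) * substShift A c G := by
  ext m
  rw [coeff_substShift, coeff_mul]
  simp only [uInv, coeff_C_mul, shift_X_mul, coeff_substShift]
  simp only [coeff_mul, Finset.mul_sum, Finset.sum_sigma']
  refine Finset.sum_nbij' (fun s => ⟨(s.2.1, s.2.2 + s.1.2), (s.2.2, s.1.2)⟩)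
    (fun s => ⟨(s.1.1 + s.2.1, s.2.2), (s.1.1, s.2.1)⟩) ?_ ?_ ?_ ?_ ?_ <;>
    simp only [Finset.mem_sigma, Finset.HasAntidiagonal.mem_antidiagonal, Sigma.forall, Prod.forall]
  · rintro a b a' b' ⟨h, h'⟩
    exact ⟨by show a' + (b' + b) = m; omega, trivial⟩
  · rintro a b a' b' ⟨h, h'⟩
    exact ⟨by show a + a' + b' = m; omega, trivial⟩
  · rintro a b a' b' ⟨h, h'⟩
    subst h'
    rfl
  · rintro a b a' b' ⟨h, h'⟩
    subst h'
    rfl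
  · intros
    trivial

theorem substShift_vInv_mul (c : ℂ) (G : A⟦X⟧⟦X⟧) :
    substShift A c (vInv A * G) = PowerSeries.X * substShift A c G := by
  ext m
  rcases m with _ | m
  · rw [coeff_substShift]
    simp [vInv, ← shiftₗ_apply]
  · rw [coeff_succ_X_mul, coeff_substShift, coeff_substShift, vInv,
      Finset.Nat.sum_antidiagonal_succ']
    simp [← shiftₗ_apply, coeff_succ_X_mul]

variable {τ : ClassicalType} {n : ℕ}

theorem substShift_kappaC_mul (c : ℂ) (G : A⟦X⟧⟦X⟧) :
    substShift A c (kappaC τ n A * G) = scal A (PowerSeries.C (kappa τ n)) * substShift A c G := by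
  ext m
  rw [scal_C_mul, coeff_substShift, kappaC]
  rw [PowerSeries.coeff_smul, coeff_substShift, Finset.smul_sum]
  refine Finset.sum_congr rfl fun p _ => ?_
  rw [coeff_C_mul, shift_mul, shift_C, coeff_C_mul, Algebra.smul_def]

/-- This is `v⁻¹ - (v + κ)⁻¹ = κ v⁻¹ (v + κ)⁻¹`. -/
theorem substShift_denP_mul (G : A⟦X⟧⟦X⟧) :
    substShift A (kappa τ n) (denP A * G) =
      scal A (PowerSeries.C (kappa τ n) * PowerSeries.X * shiftInv (kappa τ n)) *
        substShift A (kappa τ n) G := by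
  have h : (PowerSeries.X : ℂ⟦X⟧) =
      PowerSeries.C (kappa τ n) * PowerSeries.X * shiftInv (kappa τ n) + shiftInv (kappa τ n) := by
    conv_lhs => rw [← shiftInv_mul (kappa τ n)]
    ring
  rw [denP, sub_mul, map_sub, substShift_uInv_mul, substShift_vInv_mul, ← scal_X, ← sub_mul]
  congr 1
  conv_lhs => rw [h]
  rw [scal_add, add_sub_cancel_right]

theorem substShift_denQ_mul (G : A⟦X⟧⟦X⟧) :
    substShift A (kappa τ n) (denQ τ n A * G) = 0 := by
  have h : denQ τ n A * G = denP A * G - kappaC τ n A * (uInv A * (vInv A * G)) := by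
    simp [denQ, denP, sub_mul, mul_assoc]
  rw [h, map_sub, substShift_denP_mul, substShift_kappaC_mul, substShift_uInv_mul,
    substShift_vInv_mul]
  conv_lhs => rw [← scal_X (A := A)]
  rw [← mul_assoc, ← mul_assoc, ← scal_mul, ← scal_mul, sub_eq_zero]
  congr 2
  ring

/-- The algebra may have zero divisors, but a nonzero scalar series is a power of the variable times
a unit, and both can be cancelled. -/
theorem scal_mul_cancel {f : ℂ⟦X⟧} (hf : f ≠ 0) {g : A⟦X⟧} (h : scal A f * g = 0) : g = 0 := by
  obtain ⟨k, w, hw, rfl⟩ : ∃ (k : ℕ) (w : ℂ⟦X⟧), constantCoeff w ≠ 0 ∧ f = PowerSeries.X ^ k * w := by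
    refine ⟨f.order.toNat, divXPowOrder f, ?_, (X_pow_order_mul_divXPowOrder).symm⟩
    rw [constantCoeff_divXPowOrder]
    exact coeff_order hf
  have h1 : PowerSeries.X ^ k * (scal A w * g) = 0 := by
    rw [← h, scal_mul, ← mul_assoc]
    congr 2
    simp [scal]
  have h2 : scal A w * g = 0 := by
    ext m
    have := congrArg (coeff (m + k)) h1
    rwa [coeff_X_pow_mul, map_zero] at this
  have h3 : scal A w⁻¹ * (scal A w * g) = g := by
    rw [← mul_assoc, ← scal_mul, PowerSeries.inv_mul_cancel _ hw]
    simp [scal]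
  rw [← h3, h2, mul_zero]

/-- The matrix `Mᵗ(u + κ)`. -/
def transp (M : Matrix (Idx τ n) (Idx τ n) A⟦X⟧) : Matrix (Idx τ n) (Idx τ n) A⟦X⟧ :=
  fun k l => theta τ k l • shift (kappa τ n) (M (neg l) (neg k))

/-- The normalized trace of `Mᵗ(u + κ) M(u)`. -/
def zSeries (M : Matrix (Idx τ n) (Idx τ n) A⟦X⟧) : A⟦X⟧ :=
  ((size τ n : ℂ)⁻¹) • Matrix.trace (transp M * M)

/-- At `u = v + κ` the factor `u - v - κ` kills every term except the one with `Q`, which carries a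
scalar factor that is nonzero for `κ ≠ 0`. In effect this is the residue of the RTT relation at that
pole. -/
theorem rtt_specialized {M : Matrix (Idx τ n) (Idx τ n) A⟦X⟧} (hκ : kappa τ n ≠ 0)
    (hM : rttLeft M = rttRight M) (i j k l : Idx τ n) :
    (if k = neg i then ∑ a, theta τ i a • (shift (kappa τ n) (M a j) * M (neg a) l) else 0) =
      if l = neg j then ∑ a, theta τ a j • (M k (neg a) * shift (kappa τ n) (M i a)) else 0 := by
  set c := kappa τ n
  have h := congrArg (substShift A c) (rtt_entry hM i j k l)
  rw [(denP_comm _).eq, mul_assoc, substShift_denQ_mul, map_sub,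
    (denQ_comm (uInv A * vInv A)).symm.eq, mul_assoc (denQ τ n A), substShift_denQ_mul,
    mul_assoc, mul_assoc, substShift_uInv_mul, substShift_vInv_mul, substShift_denP_mul, ← scal_X,
    ← mul_assoc, ← mul_assoc, ← scal_mul, ← scal_mul, zero_sub, eq_comm, neg_eq_zero] at h
  have hs : shiftInv c ≠ 0 := by
    intro h0
    have := shiftInv_mul c
    rw [h0, zero_mul] at this
    exact PowerSeries.X_ne_zero this.symm
  have h' := scal_mul_cancel (by
    refine mul_ne_zero (mul_ne_zero hs X_ne_zero) (mul_ne_zero (mul_ne_zero ?_ X_ne_zero) hs)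
    intro h0
    exact hκ (by simpa using congrArg constantCoeff h0)) h
  rw [map_sub, sub_eq_zero] at h'
  convert h' using 1
  · split_ifs
    · simp only [map_sum, map_zsmul, substShift_atU_mul_atV, c]
    · simp
  · split_ifs
    · simp only [map_sum, map_zsmul, substShift_atV_mul_atU, c]
    · simp

theorem transp_mul_self_apply {M : Matrix (Idx τ n) (Idx τ n) A⟦X⟧} (i j l : Idx τ n) :
    ∑ a, theta τ i a • (shift (kappa τ n) (M a j) * M (neg a) l) =
      theta τ i j • (transp M * M) (neg j) l := by
  rw [Matrix.mul_apply, ← sum_neg, Finset.smul_sum]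
  refine Finset.sum_congr rfl fun a _ => ?_
  simp only [transp, neg_neg']
  rw [smul_mul_assoc, smul_smul, theta_neg_left, theta_mul]

theorem self_mul_transp_apply {M : Matrix (Idx τ n) (Idx τ n) A⟦X⟧} (i j k : Idx τ n) :
    ∑ a, theta τ a j • (M k (neg a) * shift (kappa τ n) (M i a)) =
      theta τ i j • (M * transp M) k (neg i) := by
  rw [Matrix.mul_apply, ← sum_neg, Finset.smul_sum]
  refine Finset.sum_congr rfl fun a _ => ?_
  simp only [transp, neg_neg']
  have h : theta τ (neg a) j = theta τ i j * theta τ a (neg i) := by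
    rw [theta_neg_left a, theta_comm a (neg i), theta_neg_left, theta_comm i j, theta_mul,
      theta_comm, theta_neg_left]
  rw [mul_smul_comm, smul_smul, h]

theorem theta_smul_cancel {i j : Idx τ n} {x y : A⟦X⟧} (h : theta τ i j • x = theta τ i j • y) :
    x = y := by
  have h' := congrArg (theta τ i j • ·) h
  simpa only [smul_smul, theta_mul_self, one_smul] using h'

/-- A matrix with the `RTT` relation satisfies `Mᵗ(u + κ) M(u) = M(u) Mᵗ(u + κ) = z(u) 1`. -/
theorem transp_mul_and_mul_transp {M : Matrix (Idx τ n) (Idx τ n) A⟦X⟧} (hn : 1 ≤ n)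
    (hκ : kappa τ n ≠ 0) (hM : rttLeft M = rttRight M) :
    transp M * M = Matrix.diagonal (fun _ => zSeries M) ∧
      M * transp M = Matrix.diagonal (fun _ => zSeries M) := by
  have key := rtt_specialized hκ hM
  simp only [transp_mul_self_apply, self_mul_transp_apply] at key
  -- When both index conditions of `key` hold, a diagonal entry of one product equals a diagonal
  -- entry of the other, with independent indices. When only one holds, an off-diagonal entry
  -- vanishes; this gives `h2` and `h3`.
  have h1 : ∀ i j, (transp M * M) j j = (M * transp M) i i := by
    intro i j
    have := key (neg i) (neg j) i j
    simp only [neg_neg', if_true] at this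
    exact theta_smul_cancel this
  have h2 : ∀ j l, j ≠ l → (transp M * M) j l = 0 := by
    intro j l hjl
    have := key j (neg j) (neg j) l
    rw [if_pos rfl, neg_neg', if_neg (Ne.symm hjl)] at this
    exact theta_smul_cancel (this.trans (smul_zero _).symm)
  have h3 : ∀ k i, k ≠ i → (M * transp M) k i = 0 := by
    intro k i hki
    have := key (neg i) k k (neg k)
    rw [neg_neg', if_neg hki, if_pos rfl] at this
    exact theta_smul_cancel (this.symm.trans (smul_zero _).symm)
  obtain ⟨o⟩ := idx_nonempty (τ := τ) hn
  have h4 : ∀ i, (M * transp M) i i = zSeries M := by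
    intro i
    rw [zSeries, Matrix.trace]
    simp only [Matrix.diag_apply, h1 i]
    rw [Finset.sum_const, Finset.card_univ, card_idx, ← Nat.cast_smul_eq_nsmul ℂ, smul_smul,
      inv_mul_cancel₀ (size_ne_zero hn), one_smul]
  constructor
  · ext1 i j
    by_cases h : i = j
    · subst h
      rw [Matrix.diagonal_apply_eq, h1 o, h4]
    · rw [Matrix.diagonal_apply_ne _ h, h2 i j h]
  · ext1 i j
    by_cases h : i = j
    · subst h
      rw [Matrix.diagonal_apply_eq, h4]
    · rw [Matrix.diagonal_apply_ne _ h, h3 i j h]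

end Diagonal

/-! ### The Yang–Baxter equation -/

section YangBaxter

/-- The relations between `P₁₂, …, Q₂₃` from which the Yang–Baxter equation follows. -/
structure BrauerRelations {E : Type*} [Ring E] (e N : E) (P12 P13 P23 Q12 Q13 Q23 : E) : Prop where
  ppp : P12 * P13 * P23 = P23 * P13 * P12
  p13_p23 : P13 * P23 = P12 * P13
  p13_p12 : P13 * P12 = P12 * P23
  p23_p12 : P23 * P12 = P12 * P13
  p23_p13 : P23 * P13 = P12 * P23
  p12_q13 : P12 * Q13 = Q23 * P12
  q13_p12 : Q13 * P12 = P12 * Q23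
  p13_q23 : P13 * Q23 = Q12 * P13
  q23_p13 : Q23 * P13 = P13 * Q12
  q13_p23 : Q13 * P23 = P23 * Q12
  p23_q13 : P23 * Q13 = Q12 * P23
  q12_q13 : Q12 * Q13 = Q12 * P23
  q13_q12 : Q13 * Q12 = P23 * Q12
  q12_q23 : Q12 * Q23 = Q12 * P13
  q23_q12 : Q23 * Q12 = P13 * Q12
  q13_q23 : Q13 * Q23 = P12 * Q23
  q23_q13 : Q23 * Q13 = Q23 * P12
  p12_q12 : P12 * Q12 = e * Q12
  q12_p12 : Q12 * P12 = e * Q12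
  p23_q23 : P23 * Q23 = e * Q23
  q23_p23 : Q23 * P23 = e * Q23
  q12_q12 : Q12 * Q12 = N * Q12

/-- Modulo the Brauer relations every word in the expansion is reduced to a few normal forms. The
two sides then differ by four commutator-like differences, whose coefficients are the left-hand
sides of `h1`–`h4`. -/
theorem yangBaxter {K E : Type*} [CommRing K] [Ring E] [Algebra K E] {e N : K}
    {P12 P13 P23 Q12 Q13 Q23 : E}
    (H : BrauerRelations (algebraMap K E e) (algebraMap K E N) P12 P13 P23 Q12 Q13 Q23)
    {a b c a' b' c' a'' b'' c'' : K}
    (h1 : a * b' * b'' - a' * b * b'' + a'' * b * b' = 0)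
    (h2 : -(a * c' * b'') + a' * c * b'' + a'' * c * c' = 0)
    (h3 : a * c' * c'' + a' * b * c'' - a'' * b * c' = 0)
    (h4 : a * b' * c'' + a' * c * c'' + a'' * c * b' + e * b * b' * c'' - e * b * c' * b''
      + e * c * b' * b'' + N * c * b' * c'' + e * c * c' * c'' = 0) :
    (a • (1 : E) + b • P12 + c • Q12) * (a' • (1 : E) + b' • P13 + c' • Q13) *
        (a'' • (1 : E) + b'' • P23 + c'' • Q23) =
      (a'' • (1 : E) + b'' • P23 + c'' • Q23) * (a' • (1 : E) + b' • P13 + c' • Q13) *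
        (a • (1 : E) + b • P12 + c • Q12) := by
  obtain ⟨ppp, p13_p23, p13_p12, p23_p12, p23_p13, p12_q13, q13_p12, p13_q23, q23_p13, q13_p23,
    p23_q13, q12_q13, q13_q12, q12_q23, q23_q12, q13_q23, q23_q13, p12_q12, q12_p12, p23_q23,
    q23_p23, q12_q12⟩ := H
  have ppq : P12 * P13 * Q23 = e • (Q12 * P13) := by
    rw [mul_assoc, p13_q23, ← mul_assoc, p12_q12, mul_assoc, Algebra.smul_def]
  have qpp' : Q23 * P13 * P12 = e • (P13 * Q12) := by
    rw [q23_p13, mul_assoc, q12_p12, Algebra.smul_def, ← mul_assoc, ← mul_assoc, Algebra.commutes]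
  have pqp : P12 * Q13 * P23 = e • (P13 * Q12) := by
    rw [p12_q13, mul_assoc, ← p23_p13, ← mul_assoc, q23_p23, mul_assoc, q23_p13, Algebra.smul_def]
  have pqp' : P23 * Q13 * P12 = e • (Q12 * P13) := by
    rw [p23_q13, mul_assoc, p23_p12, ← mul_assoc, q12_p12, mul_assoc, Algebra.smul_def]
  have pqq : P12 * Q13 * Q23 = Q23 * P12 * Q23 := by rw [p12_q13]
  have pqq' : Q23 * Q13 * P12 = Q23 * P12 * Q23 := by rw [mul_assoc, q13_p12, mul_assoc]
  have qpp : Q12 * P13 * P23 = e • (Q12 * P13) := by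
    rw [mul_assoc, p13_p23, ← mul_assoc, q12_p12, mul_assoc, Algebra.smul_def]
  have ppq' : P23 * P13 * Q12 = e • (P13 * Q12) := by
    rw [p23_p13, ← p13_p12, mul_assoc, p12_q12, ← mul_assoc, ← Algebra.commutes, mul_assoc,
      Algebra.smul_def]
  have qpq : Q12 * P13 * Q23 = N • (Q12 * P13) := by
    rw [mul_assoc, p13_q23, ← mul_assoc, q12_q12, mul_assoc, Algebra.smul_def]
  have qpq' : Q23 * P13 * Q12 = N • (P13 * Q12) := by
    rw [q23_p13, mul_assoc, q12_q12, ← mul_assoc, ← Algebra.commutes, mul_assoc, Algebra.smul_def]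
  have qqp : Q12 * Q13 * P23 = Q12 * P23 * Q12 := by rw [mul_assoc, q13_p23, mul_assoc]
  have qqp' : P23 * Q13 * Q12 = Q12 * P23 * Q12 := by rw [p23_q13]
  have qqq : Q12 * Q13 * Q23 = e • (Q12 * P13) := by
    rw [q12_q13, mul_assoc, p23_q23, ← mul_assoc, ← Algebra.commutes, mul_assoc, q12_q23,
      Algebra.smul_def]
  have qqq' : Q23 * Q13 * Q12 = e • (P13 * Q12) := by
    rw [q23_q13, mul_assoc, p12_q12, ← mul_assoc, ← Algebra.commutes, mul_assoc, q23_q12,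
      Algebra.smul_def]
  rw [← sub_eq_zero]
  trans (a * b' * b'' - a' * b * b'' + a'' * b * b') • (P12 * P13 - P12 * P23) +
    (-(a * c' * b'') + a' * c * b'' + a'' * c * c') • (Q12 * P23 - P23 * Q12) +
    (a * c' * c'' + a' * b * c'' - a'' * b * c') • (P12 * Q23 - Q23 * P12) +
    (a * b' * c'' + a' * c * c'' + a'' * c * b' + e * b * b' * c'' - e * b * c' * b''
      + e * c * b' * b'' + N * c * b' * c'' + e * c * c' * c'') • (Q12 * P13 - P13 * Q12)
  · simp only [add_mul, mul_add, smul_mul_assoc, mul_smul_comm, one_mul, mul_one, smul_add,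
      smul_smul]
    simp only [ppp, ppq, pqp, pqq, qpp, qpq, qqp, qqq, qpp', pqp', pqq', ppq', qpq', qqp', qqq']
    simp only [p13_p23, p13_p12, p23_p12, p23_p13, p12_q13, q13_p12, p13_q23, q23_p13, q13_p23,
      p23_q13, q12_q13, q13_q12, q12_q23, q23_q12, q13_q23, q23_q13]
    module
  · rw [h1, h2, h3, h4]
    simp

end YangBaxter

/-! ### The operators `P` and `Q` on the triple tensor power -/

section Operators

variable (τ : ClassicalType) (n : ℕ) (K : Type) [CommRing K]

/-- The triple tensor power of the vector representation. -/
abbrev Tens : Type := (Idx τ n × Idx τ n) × Idx τ n → K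

/-- The sign `s_i` in the ring `K`. -/
def sgK {τ : ClassicalType} {n : ℕ} (i : Idx τ n) : K := ((sg τ i : ℤ) : K)

variable {τ n} in
theorem sgK_mul_self (i : Idx τ n) : sgK K i * sgK K i = 1 := by
  rw [sgK, ← Int.cast_mul, sg_mul_self, Int.cast_one]

variable {τ n} in
theorem sgK_neg (i : Idx τ n) : sgK K (neg i) = ((eps τ : ℤ) : K) * sgK K i := by
  rw [sgK, sgK, ← Int.cast_mul, sg_neg]

theorem epsK_mul_self : ((eps τ : ℤ) : K) * ((eps τ : ℤ) : K) = 1 := by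
  rw [← Int.cast_mul, eps_mul_self, Int.cast_one]

def opP12 : Module.End K (Tens τ n K) where
  toFun f x := f ((x.1.2, x.1.1), x.2)
  map_add' _ _ := rfl
  map_smul' _ _ := rfl

def opP13 : Module.End K (Tens τ n K) where
  toFun f x := f ((x.2, x.1.2), x.1.1)
  map_add' _ _ := rfl
  map_smul' _ _ := rfl

def opP23 : Module.End K (Tens τ n K) where
  toFun f x := f ((x.1.1, x.2), x.1.2)
  map_add' _ _ := rfl
  map_smul' _ _ := rfl

/-- Splitting `θ_{ap}` as `s_a s_p` makes the contraction sum independent of the output index, so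
`Q` is visibly of rank one on its two factors. -/
def opQ12 : Module.End K (Tens τ n K) where
  toFun f x := if x.1.2 = neg x.1.1 then
    sgK K x.1.1 * ∑ p, sgK K p * f ((p, neg p), x.2) else 0
  map_add' f g := by
    ext x
    simp only [Pi.add_apply, mul_add, Finset.sum_add_distrib]
    split_ifs <;> simp
  map_smul' a f := by
    ext x
    simp only [Pi.smul_apply, smul_eq_mul, RingHom.id_apply, mul_left_comm _ a, ← Finset.mul_sum]
    split_ifs <;> simp

def opQ13 : Module.End K (Tens τ n K) where
  toFun f x := if x.2 = neg x.1.1 then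
    sgK K x.1.1 * ∑ p, sgK K p * f ((p, x.1.2), neg p) else 0
  map_add' f g := by
    ext x
    simp only [Pi.add_apply, mul_add, Finset.sum_add_distrib]
    split_ifs <;> simp
  map_smul' a f := by
    ext x
    simp only [Pi.smul_apply, smul_eq_mul, RingHom.id_apply, mul_left_comm _ a, ← Finset.mul_sum]
    split_ifs <;> simp

def opQ23 : Module.End K (Tens τ n K) where
  toFun f x := if x.2 = neg x.1.2 then
    sgK K x.1.2 * ∑ p, sgK K p * f ((x.1.1, p), neg p) else 0
  map_add' f g := by
    ext x
    simp only [Pi.add_apply, mul_add, Finset.sum_add_distrib]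
    split_ifs <;> simp
  map_smul' a f := by
    ext x
    simp only [Pi.smul_apply, smul_eq_mul, RingHom.id_apply, mul_left_comm _ a, ← Finset.mul_sum]
    split_ifs <;> simp

variable {τ n K}

theorem opP12_apply (f : Tens τ n K) (a b c : Idx τ n) :
    opP12 τ n K f ((a, b), c) = f ((b, a), c) := rfl

theorem opP13_apply (f : Tens τ n K) (a b c : Idx τ n) :
    opP13 τ n K f ((a, b), c) = f ((c, b), a) := rfl

theorem opP23_apply (f : Tens τ n K) (a b c : Idx τ n) :
    opP23 τ n K f ((a, b), c) = f ((a, c), b) := rfl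

theorem opQ12_apply (f : Tens τ n K) (a b c : Idx τ n) :
    opQ12 τ n K f ((a, b), c) =
      if b = neg a then sgK K a * ∑ p, sgK K p * f ((p, neg p), c) else 0 := rfl

theorem opQ13_apply (f : Tens τ n K) (a b c : Idx τ n) :
    opQ13 τ n K f ((a, b), c) =
      if c = neg a then sgK K a * ∑ p, sgK K p * f ((p, b), neg p) else 0 := rfl

theorem opQ23_apply (f : Tens τ n K) (a b c : Idx τ n) :
    opQ23 τ n K f ((a, b), c) =
      if c = neg b then sgK K b * ∑ p, sgK K p * f ((a, p), neg p) else 0 := rfl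

/-- The invariant form is symmetric or skew: reindexing by `p ↦ -p` exchanges its arguments at the
cost of `ε`. -/
theorem sum_sgK_swap (g : Idx τ n → Idx τ n → K) :
    ∑ p, sgK K p * g (neg p) p = ((eps τ : ℤ) : K) * ∑ p, sgK K p * g p (neg p) := by
  rw [← sum_neg, Finset.mul_sum]
  simp only [neg_neg', sgK_neg, mul_assoc]

theorem eq_neg_comm {a b : Idx τ n} : a = neg b ↔ b = neg a :=
  ⟨fun h => by rw [h, neg_neg'], fun h => by rw [h, neg_neg']⟩

theorem brauerRelations : BrauerRelations (algebraMap K (Module.End K (Tens τ n K)) (eps τ : ℤ))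
    (algebraMap K (Module.End K (Tens τ n K)) (size τ n))
    (opP12 τ n K) (opP13 τ n K) (opP23 τ n K) (opQ12 τ n K) (opQ13 τ n K) (opQ23 τ n K) := by
  have hs : ∀ (a : Idx τ n) (x : K), sgK K a * (sgK K a * x) = x := fun a x => by
    rw [← mul_assoc, sgK_mul_self, one_mul]
  have he : ∀ x : K, ((eps τ : ℤ) : K) * (((eps τ : ℤ) : K) * x) = x := fun x => by
    rw [← mul_assoc, epsK_mul_self, one_mul]
  constructor <;> refine LinearMap.ext fun f => funext fun ⟨⟨a, b⟩, c⟩ => ?_ <;>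
    simp only [Module.End.mul_apply, opP12_apply, opP13_apply, opP23_apply, opQ12_apply,
      opQ13_apply, opQ23_apply, Module.algebraMap_end_apply, Pi.smul_apply, smul_eq_mul, neg_neg']
  -- The relations left over are those where the legs of a contraction are exchanged, where a
  -- contraction sum collapses to one term, and `Q² = N Q`.
  all_goals try (simp [eq_neg_comm, mul_ite, Finset.sum_ite_eq, hs]; done)
  · by_cases h : b = neg a
    · subst h
      have := sum_sgK_swap fun p q => f ((c, p), q)
      simp only [neg_neg', if_true, sgK_neg, this]
      ring
    · rw [if_neg h, if_neg (fun h' => h (eq_neg_comm.1 h'))]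
  · by_cases h : c = neg b
    · subst h
      have := sum_sgK_swap fun p q => f ((p, q), a)
      simp only [neg_neg', if_true, sgK_neg, this]
      ring
    · rw [if_neg h, if_neg (fun h' => h (eq_neg_comm.1 h'))]
  · by_cases h : b = neg a
    · rw [if_pos h, if_pos h, Finset.sum_eq_single (neg c)]
      · rw [neg_neg', if_pos rfl, hs]
      · intro p _ hp
        rw [if_neg (fun h' => hp (eq_neg_comm.1 h')), mul_zero]
      · simp
    · rw [if_neg h, if_neg h]
  · by_cases h : c = neg a
    · rw [if_pos h, if_pos h, Finset.sum_eq_single (neg b)]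
      · rw [neg_neg', if_pos rfl, hs]
      · intro p _ hp
        rw [if_neg (fun h' => hp (eq_neg_comm.1 h')), mul_zero]
      · simp
    · rw [if_neg h, if_neg h]
  · by_cases h : b = neg a
    · have := sum_sgK_swap fun p q => f ((c, p), q)
      rw [if_pos h, if_pos h, Finset.sum_eq_single c]
      · rw [if_pos rfl, sgK_neg, this, mul_assoc, mul_left_comm (sgK K c), hs]
      · intro p _ hp
        rw [if_neg (Ne.symm hp), mul_zero]
      · simp
    · rw [if_neg h, if_neg h]
  · by_cases h : c = neg b
    · subst h
      rw [if_pos rfl, if_pos (neg_neg' b).symm, Finset.sum_eq_single (neg a)]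
      · rw [if_pos rfl, neg_neg', sgK_neg, sgK_neg]
        linear_combination (((eps τ : ℤ) : K) * sgK K b * ∑ p, sgK K p * f ((p, neg p), a)) *
          sgK_mul_self K a
      · intro p _ hp
        rw [if_neg hp, mul_zero]
      · simp
    · rw [if_neg h, if_neg (fun h' => h (eq_neg_comm.1 h'))]
  · by_cases h : b = neg a
    · subst h
      simp only [neg_neg', if_true, sgK_neg]
      ring
    · rw [if_neg h, if_neg (fun h' => h (eq_neg_comm.1 h')), mul_zero]
  · have := sum_sgK_swap fun p q => f ((p, q), c)
    rw [this]
    split_ifs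
    · ring
    · ring
  · by_cases h : c = neg b
    · subst h
      simp only [neg_neg', if_true, sgK_neg]
      ring
    · rw [if_neg h, if_neg (fun h' => h (eq_neg_comm.1 h')), mul_zero]
  · have := sum_sgK_swap fun p q => f ((a, p), q)
    rw [this]
    split_ifs
    · ring
    · ring
  · simp only [if_true, hs, Finset.sum_const, Finset.card_univ, card_idx, nsmul_eq_mul, mul_ite,
      mul_zero]
    split_ifs
    · ring
    · rfl

end Operators

/-! ### The vector representation -/

section Flatten

variable {J : Type} [Fintype J] [DecidableEq J] (R : Type) [Ring R]

variable (J) in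
/-- A series of matrices as a matrix of series. -/
def flatten : (Matrix J J R)⟦X⟧ →+* Matrix J J R⟦X⟧ where
  toFun G := Matrix.of fun a b => PowerSeries.mk fun r => coeff r G a b
  map_one' := by
    ext a b r
    by_cases h : r = 0 <;> by_cases h' : a = b <;> simp [coeff_one, Matrix.one_apply, h, h']
  map_mul' G H := by
    ext a b r
    rw [Matrix.of_apply, coeff_mk, coeff_mul, Matrix.sum_apply, Matrix.mul_apply, map_sum]
    simp only [Matrix.mul_apply, coeff_mul, coeff_mk, Matrix.of_apply]
    exact Finset.sum_comm
  map_zero' := by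
    ext a b r
    simp
  map_add' G H := by
    ext a b r
    simp

theorem coeff_flatten (G : (Matrix J J R)⟦X⟧) (a b : J) (r : ℕ) :
    coeff r (flatten J R G a b) = coeff r G a b := by
  simp [flatten]

variable (J) in
/-- A double series of matrices as a matrix of double series. -/
def flatten2 : (Matrix J J R)⟦X⟧⟦X⟧ →+* Matrix J J R⟦X⟧⟦X⟧ :=
  (flatten J R⟦X⟧).comp (PowerSeries.map (flatten J R))

theorem coeff_flatten2 (G : (Matrix J J R)⟦X⟧⟦X⟧) (a b : J) (s : ℕ) :
    coeff s (flatten2 J R G a b) = flatten J R (coeff s G) a b := by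
  rw [flatten2, RingHom.comp_apply, coeff_flatten, PowerSeries.coeff_map]

theorem flatten2_injective : Function.Injective (flatten2 J R) := by
  intro G H h
  ext s r a b
  have := congrArg (coeff r) (congrArg (coeff s) (congrFun (congrFun h a) b))
  simpa only [coeff_flatten2, coeff_flatten] using this

theorem flatten2_atU (g : (Matrix J J R)⟦X⟧) (a b : J) :
    flatten2 J R (PowerSeries.C g) a b = PowerSeries.C (flatten J R g a b) := by
  ext1 s
  rw [coeff_flatten2]
  by_cases h : s = 0 <;> simp [coeff_C, h]

theorem flatten2_atV (g : (Matrix J J R)⟦X⟧) (a b : J) :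
    flatten2 J R (PowerSeries.map PowerSeries.C g) a b =
      PowerSeries.map PowerSeries.C (flatten J R g a b) := by
  ext s r
  rw [coeff_flatten2, coeff_flatten, PowerSeries.coeff_map, PowerSeries.coeff_map, coeff_flatten]
  by_cases h : r = 0 <;> simp [coeff_C, h]

end Flatten

/-! ### The matrix `R(u - c)` over `(End V)[c]` -/

section VectorRep

variable (τ : ClassicalType) (n : ℕ)

/-- `1 / (u - a) = ∑ a^r u^{-r-1}`. -/
def geom (a : Polynomial ℂ) : (Polynomial ℂ)⟦X⟧ :=
  PowerSeries.X * PowerSeries.mk fun r => a ^ r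

theorem coeff_zero_geom (a : Polynomial ℂ) : coeff 0 (geom a) = 0 := by
  simp [geom]

theorem coeff_succ_geom (a : Polynomial ℂ) (r : ℕ) : coeff (r + 1) (geom a) = a ^ r := by
  rw [geom, coeff_succ_X_mul, coeff_mk]

theorem geom_mul (a : Polynomial ℂ) :
    geom a * (1 - PowerSeries.C a * PowerSeries.X) = PowerSeries.X := by
  have h : (PowerSeries.mk fun r => a ^ r) * (1 - PowerSeries.C a * PowerSeries.X) = 1 := by
    ext r
    rw [mul_sub, mul_one, map_sub, ← mul_assoc, mul_comm _ (PowerSeries.C a), mul_assoc, coeff_C_mul]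
    rcases r with _ | r
    · simp
    · rw [coeff_succ_mul_X, coeff_mk, coeff_mk, coeff_one, if_neg (Nat.succ_ne_zero r), pow_succ',
        sub_self]
  rw [geom, mul_assoc, h, mul_one]

/-- The shifted parameter `c + κ`. -/
def cShift : Polynomial ℂ := Polynomial.X + Polynomial.C (kappa τ n)

/-- The matrix `R(u - c)`, as a matrix with coefficients in `(End V)[c]`, where
`1 / (u - c) = ∑ c^r u^{-r-1}`. -/
def vecRep : Matrix (Idx τ n) (Idx τ n) (Matrix (Idx τ n) (Idx τ n) (Polynomial ℂ))⟦X⟧ :=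
  fun i j => PowerSeries.mk fun r => Matrix.of fun a b =>
    (if i = j ∧ a = b then coeff r 1 else 0)
    - (if j = a ∧ i = b then coeff r (geom Polynomial.X) else 0)
    + (if a = neg i ∧ b = neg j then ((theta τ i j : ℤ) : Polynomial ℂ) *
        coeff r (geom (cShift τ n)) else 0)

theorem flatten_vecRep (i j a b : Idx τ n) :
    flatten (Idx τ n) (Polynomial ℂ) (vecRep τ n i j) a b =
      (if i = j ∧ a = b then 1 else 0)
      - (if j = a ∧ i = b then geom Polynomial.X else 0)
      + (if a = neg i ∧ b = neg j then ((theta τ i j : ℤ) : (Polynomial ℂ)⟦X⟧) *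
          geom (cShift τ n) else 0) := by
  ext1 r
  rw [coeff_flatten, vecRep, coeff_mk, map_add, map_sub, Matrix.of_apply]
  congr 1
  · congr 1 <;> split_ifs <;> simp
  · split_ifs
    · rw [← map_intCast (PowerSeries.C : Polynomial ℂ →+* (Polynomial ℂ)⟦X⟧), coeff_C_mul]
    · simp

section Coefficients

variable {K : Type} [CommRing K]

theorem toMatrix_opP12 (x y : (Idx τ n × Idx τ n) × Idx τ n) :
    LinearMap.toMatrix' (opP12 τ n K) x y =
      if x.1.1 = y.1.2 ∧ x.1.2 = y.1.1 ∧ x.2 = y.2 then 1 else 0 := by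
  obtain ⟨⟨a, b⟩, c⟩ := x
  obtain ⟨⟨a', b'⟩, c'⟩ := y
  rw [LinearMap.toMatrix'_apply, opP12_apply]
  simp only [Pi.single_apply, Prod.mk.injEq]
  congr 1
  grind

theorem toMatrix_opP13 (x y : (Idx τ n × Idx τ n) × Idx τ n) :
    LinearMap.toMatrix' (opP13 τ n K) x y =
      if x.1.1 = y.2 ∧ x.2 = y.1.1 ∧ x.1.2 = y.1.2 then 1 else 0 := by
  obtain ⟨⟨a, b⟩, c⟩ := x
  obtain ⟨⟨a', b'⟩, c'⟩ := y
  rw [LinearMap.toMatrix'_apply, opP13_apply]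
  simp only [Pi.single_apply, Prod.mk.injEq]
  congr 1
  grind

theorem toMatrix_opP23 (x y : (Idx τ n × Idx τ n) × Idx τ n) :
    LinearMap.toMatrix' (opP23 τ n K) x y =
      if x.1.2 = y.2 ∧ x.2 = y.1.2 ∧ x.1.1 = y.1.1 then 1 else 0 := by
  obtain ⟨⟨a, b⟩, c⟩ := x
  obtain ⟨⟨a', b'⟩, c'⟩ := y
  rw [LinearMap.toMatrix'_apply, opP23_apply]
  simp only [Pi.single_apply, Prod.mk.injEq]
  congr 1
  grind

theorem sgK_mul (i j : Idx τ n) : sgK K i * sgK K j = ((theta τ i j : ℤ) : K) := by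
  rw [sgK, sgK, theta_eq, Int.cast_mul]

theorem toMatrix_opQ12 (x y : (Idx τ n × Idx τ n) × Idx τ n) :
    LinearMap.toMatrix' (opQ12 τ n K) x y =
      if x.1.2 = neg x.1.1 ∧ y.1.2 = neg y.1.1 ∧ x.2 = y.2 then
        ((theta τ x.1.1 y.1.1 : ℤ) : K) else 0 := by
  obtain ⟨⟨a, b⟩, c⟩ := x
  obtain ⟨⟨a', b'⟩, c'⟩ := y
  rw [LinearMap.toMatrix'_apply, opQ12_apply, Finset.sum_eq_single a']
  · simp only [Pi.single_apply, Prod.mk.injEq, true_and, mul_ite, mul_one, mul_zero, sgK_mul]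
    rw [← ite_and]
    congr 1
    grind
  · intro p _ hp
    simp [hp]
  · simp

theorem toMatrix_opQ13 (x y : (Idx τ n × Idx τ n) × Idx τ n) :
    LinearMap.toMatrix' (opQ13 τ n K) x y =
      if x.2 = neg x.1.1 ∧ y.2 = neg y.1.1 ∧ x.1.2 = y.1.2 then
        ((theta τ x.1.1 y.1.1 : ℤ) : K) else 0 := by
  obtain ⟨⟨a, b⟩, c⟩ := x
  obtain ⟨⟨a', b'⟩, c'⟩ := y
  rw [LinearMap.toMatrix'_apply, opQ13_apply, Finset.sum_eq_single a']
  · simp only [Pi.single_apply, Prod.mk.injEq, true_and, mul_ite, mul_one, mul_zero, sgK_mul]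
    rw [← ite_and]
    congr 1
    grind
  · intro p _ hp
    simp [hp]
  · simp

theorem toMatrix_opQ23 (x y : (Idx τ n × Idx τ n) × Idx τ n) :
    LinearMap.toMatrix' (opQ23 τ n K) x y =
      if x.2 = neg x.1.2 ∧ y.2 = neg y.1.2 ∧ x.1.1 = y.1.1 then
        ((theta τ x.1.2 y.1.2 : ℤ) : K) else 0 := by
  obtain ⟨⟨a, b⟩, c⟩ := x
  obtain ⟨⟨a', b'⟩, c'⟩ := y
  rw [LinearMap.toMatrix'_apply, opQ23_apply, Finset.sum_eq_single b']
  · simp only [Pi.single_apply, Prod.mk.injEq, true_and, mul_ite, mul_one, mul_zero, sgK_mul]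
    rw [← ite_and]
    congr 1
    grind
  · intro p _ hp
    simp [hp]
  · simp

end Coefficients

/-- These are the four coefficient conditions of `yangBaxter` for `R₁₂(u - v)` with cleared
denominators, `R₁₃(u - c)` and `R₂₃(v - c)`, where `f, g` and `f', g'` stand for `1 / (u - c)`, `1 /
(u - c - κ)` and the same with `v`. Over a field they are identities of rational functions; `N = 2κ
+ 2ε` enters only the last one. -/
theorem yangBaxter_coefficients {F : Type} [Field F] {x y c k e N f f' g g' d₁ d₂ d₃ d₄ : F}
    (hN : N = 2 * k + 2 * e) (hd₁ : d₁ = 1 - c * x) (hd₂ : d₂ = 1 - c * y)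
    (hd₃ : d₃ = 1 - (c + k) * x) (hd₄ : d₄ = 1 - (c + k) * y)
    (hf : f * d₁ = x) (hf' : f' * d₂ = y) (hg : g * d₃ = x) (hg' : g' * d₄ = y)
    (h1 : d₁ ≠ 0) (h2 : d₂ ≠ 0) (h3 : d₃ ≠ 0) (h4 : d₄ ≠ 0)
    {α β γ : F} (hα : α = (y - x) * (y - x - k * x * y)) (hβ : β = -(x * y * (y - x - k * x * y)))
    (hγ : γ = x * y * (y - x)) :
    α * (-f) * (-f') - 1 * β * (-f') + 1 * β * (-f) = 0 ∧
    -(α * g * (-f')) + 1 * γ * (-f') + 1 * γ * g = 0 ∧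
    α * g * g' + 1 * β * g' - 1 * β * g = 0 ∧
    α * (-f) * g' + 1 * γ * g' + 1 * γ * (-f) + e * β * (-f) * g' - e * β * g * (-f')
      + e * γ * (-f) * (-f') + N * γ * (-f) * g' + e * γ * g * g' = 0 := by
  rw [← eq_div_iff h1] at hf
  rw [← eq_div_iff h2] at hf'
  rw [← eq_div_iff h3] at hg
  rw [← eq_div_iff h4] at hg'
  subst hN hf hf' hg hg' hα hβ hγ
  refine ⟨?_, ?_, ?_, ?_⟩ <;> field_simp <;> subst hd₁ hd₂ hd₃ hd₄ <;> ring

end VectorRep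

/-! ### The RTT relation for `R(u - c)` -/

section VectorRepRTT

variable (τ : ClassicalType) (n : ℕ)

/-- A matrix over double series with coefficients in `(End V)[c]` as a matrix on the triple tensor
power. -/
def unfold3 : Matrix (Idx τ n × Idx τ n) (Idx τ n × Idx τ n)
      (Matrix (Idx τ n) (Idx τ n) (Polynomial ℂ))⟦X⟧⟦X⟧ →+*
    Matrix ((Idx τ n × Idx τ n) × Idx τ n) ((Idx τ n × Idx τ n) × Idx τ n) (Polynomial ℂ)⟦X⟧⟦X⟧ :=
  ((Matrix.compRingEquiv (Idx τ n × Idx τ n) (Idx τ n) (Polynomial ℂ)⟦X⟧⟦X⟧) : _ →+* _).comp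
    (flatten2 (Idx τ n) (Polynomial ℂ)).mapMatrix

theorem unfold3_apply (M : Matrix (Idx τ n × Idx τ n) (Idx τ n × Idx τ n)
      (Matrix (Idx τ n) (Idx τ n) (Polynomial ℂ))⟦X⟧⟦X⟧)
    (p q : Idx τ n × Idx τ n) (a b : Idx τ n) :
    unfold3 τ n M (p, a) (q, b) = flatten2 (Idx τ n) (Polynomial ℂ) (M p q) a b := rfl

theorem unfold3_injective : Function.Injective (unfold3 τ n) := by
  intro M M' h
  ext1 p q
  apply flatten2_injective
  ext1 a b
  exact congrFun (congrFun h (p, a)) (q, b)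

local notation "K₀" => PowerSeries (PowerSeries (Polynomial ℂ))

/-- `x = u⁻¹`. -/
def xK : K₀ := PowerSeries.C PowerSeries.X

/-- `y = v⁻¹`. -/
def yK : K₀ := PowerSeries.X

/-- Scalars. -/
def cK (a : Polynomial ℂ) : K₀ := PowerSeries.C (PowerSeries.C a)

theorem flatten2_scalar {G : (Matrix (Idx τ n) (Idx τ n) (Polynomial ℂ))⟦X⟧⟦X⟧} {g : K₀}
    (h : ∀ r s, coeff r (coeff s G) = Matrix.diagonal fun _ => coeff r (coeff s g)) :
    flatten2 (Idx τ n) (Polynomial ℂ) G = Matrix.diagonal fun _ => g := by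
  ext a b s r
  rw [coeff_flatten2, coeff_flatten, h, Matrix.diagonal_apply, Matrix.diagonal_apply]
  split_ifs <;> simp

theorem flatten2_uInv : flatten2 (Idx τ n) (Polynomial ℂ) (uInv _) = Matrix.diagonal fun _ => xK := by
  apply flatten2_scalar
  intro r s
  rw [uInv, xK, coeff_C, coeff_C]
  split_ifs
  · rw [coeff_X, coeff_X]
    split_ifs
    · rfl
    · simp
  · simp

theorem flatten2_vInv : flatten2 (Idx τ n) (Polynomial ℂ) (vInv _) = Matrix.diagonal fun _ => yK := by
  apply flatten2_scalar
  intro r s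
  rw [vInv, yK, coeff_X, coeff_X]
  split_ifs
  · rw [coeff_one, coeff_one]
    split_ifs
    · rfl
    · simp
  · simp

theorem flatten2_kappaC : flatten2 (Idx τ n) (Polynomial ℂ) (kappaC τ n _) =
    Matrix.diagonal fun _ => cK (Polynomial.C (kappa τ n)) := by
  apply flatten2_scalar
  intro r s
  rw [kappaC, cK, coeff_C, coeff_C]
  split_ifs
  · rw [coeff_C, coeff_C]
    split_ifs
    · rw [Matrix.algebraMap_eq_diagonal]
      rfl
    · simp
  · simp

/-- The coefficients of the `R`-matrix in the commutative ring `ℂ[c][[u⁻¹, v⁻¹]]`. -/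
def denPK : K₀ := yK - xK

def denQK : K₀ := yK - xK - cK (Polynomial.C (kappa τ n)) * xK * yK

theorem flatten2_denP : flatten2 (Idx τ n) (Polynomial ℂ) (denP _) = Matrix.diagonal fun _ => denPK := by
  rw [denP, map_sub, flatten2_uInv, flatten2_vInv, Matrix.diagonal_sub]
  rfl

theorem flatten2_denQ : flatten2 (Idx τ n) (Polynomial ℂ) (denQ τ n _) =
    Matrix.diagonal fun _ => denQK τ n := by
  rw [denQ, map_sub, map_sub, map_mul, map_mul, flatten2_uInv, flatten2_vInv, flatten2_kappaC,
    Matrix.diagonal_mul_diagonal, Matrix.diagonal_mul_diagonal, Matrix.diagonal_sub,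
    Matrix.diagonal_sub]
  rfl

theorem unfold3_smul {G : (Matrix (Idx τ n) (Idx τ n) (Polynomial ℂ))⟦X⟧⟦X⟧} {g : K₀}
    (h : flatten2 (Idx τ n) (Polynomial ℂ) G = Matrix.diagonal fun _ => g) (M) :
    unfold3 τ n (G • M) = g • unfold3 τ n M := by
  ext1 ⟨p, a⟩ ⟨q, b⟩
  rw [unfold3_apply, Matrix.smul_apply, Matrix.smul_apply, smul_eq_mul, map_mul, h,
    Matrix.diagonal_mul, unfold3_apply, smul_eq_mul]

theorem unfold3_permMatrix : unfold3 τ n (permMatrix τ n _) = LinearMap.toMatrix' (opP12 τ n K₀) := by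
  ext1 ⟨⟨a, b⟩, c⟩ ⟨⟨a', b'⟩, c'⟩
  rw [unfold3_apply, toMatrix_opP12, permMatrix]
  by_cases h : a = b' ∧ b = a'
  · rw [if_pos h, map_one, Matrix.one_apply]
    simp [h]
  · rw [if_neg h, map_zero, if_neg (fun h' => h ⟨h'.1, h'.2.1⟩), Matrix.zero_apply]

theorem unfold3_qMatrix : unfold3 τ n (qMatrix τ n _) = LinearMap.toMatrix' (opQ12 τ n K₀) := by
  ext1 ⟨⟨a, b⟩, c⟩ ⟨⟨a', b'⟩, c'⟩
  rw [unfold3_apply, toMatrix_opQ12, qMatrix]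
  by_cases h : b = neg a ∧ b' = neg a'
  · rw [if_pos h, map_intCast]
    simp only [h, true_and]
    by_cases h' : c = c'
    · subst h'
      simp [Matrix.intCast_apply]
    · simp [h', Matrix.intCast_apply]
  · rw [if_neg h, map_zero, if_neg (fun h' => h ⟨h'.1, h'.2.1⟩), Matrix.zero_apply]

theorem unfold3_rMatrix : unfold3 τ n (rMatrix τ n _) = LinearMap.toMatrix'
    ((denPK * denQK τ n) • (1 : Module.End K₀ (Tens τ n K₀)) +
      (-(xK * yK * denQK τ n)) • opP12 τ n K₀ + (xK * yK * denPK) • opQ12 τ n K₀) := by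
  have hu := flatten2_uInv τ n
  have hv := flatten2_vInv τ n
  have hp := flatten2_denP τ n
  have hq := flatten2_denQ τ n
  rw [rMatrix_eq, map_add, map_sub, unfold3_smul τ n (g := denPK * denQK τ n),
    unfold3_smul τ n (g := xK * yK * denQK τ n), unfold3_smul τ n (g := xK * yK * denPK),
    unfold3_permMatrix, unfold3_qMatrix, map_one, map_add, map_add, map_smul, map_smul, map_smul,
    LinearMap.toMatrix'_one, neg_smul, sub_eq_add_neg]
  · rw [map_mul, map_mul, hu, hv, hp, Matrix.diagonal_mul_diagonal, Matrix.diagonal_mul_diagonal]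
  · rw [map_mul, map_mul, hu, hv, hq, Matrix.diagonal_mul_diagonal, Matrix.diagonal_mul_diagonal]
  · rw [map_mul, hp, hq, Matrix.diagonal_mul_diagonal]

/-- The representation space is the third tensor factor, so the two legs become `R₁₃(u - c)` and
`R₂₃(v - c)`, and the RTT relation becomes the Yang–Baxter equation. -/
theorem unfold3_leg1 : unfold3 τ n (leg1 (vecRep τ n)) = LinearMap.toMatrix'
    ((1 : K₀) • (1 : Module.End K₀ (Tens τ n K₀)) +
      (-PowerSeries.C (geom Polynomial.X)) • opP13 τ n K₀ +
      (PowerSeries.C (geom (cShift τ n)) : K₀) • opQ13 τ n K₀) := by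
  ext1 ⟨⟨a, b⟩, c⟩ ⟨⟨a', b'⟩, c'⟩
  rw [unfold3_apply, leg1, Matrix.kroneckerMap_apply, Matrix.map_apply, map_add, map_add, map_smul,
    map_smul, map_smul, LinearMap.toMatrix'_one, Matrix.add_apply, Matrix.add_apply,
    Matrix.smul_apply, Matrix.smul_apply, Matrix.smul_apply, toMatrix_opP13, toMatrix_opQ13,
    one_smul]
  by_cases h : b = b'
  · subst h
    rw [Matrix.one_apply_eq, mul_one, flatten2_atU, flatten_vecRep, Matrix.one_apply, map_add,
      map_sub, sub_eq_add_neg]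
    congr 1
    · congr 1
      · simp only [Prod.mk.injEq, and_true]
        split_ifs <;> simp
      · simp only [and_true, smul_eq_mul]
        by_cases h : a' = c ∧ a = c'
        · rw [if_pos h, if_pos ⟨h.2, h.1.symm⟩, mul_one]
        · rw [if_neg h, if_neg (fun h' => h ⟨h'.2.symm, h'.1⟩)]
          simp
    · simp only [and_true, smul_eq_mul]
      split_ifs
      · rw [map_mul, map_intCast, mul_comm]
      · simp
  · rw [Matrix.one_apply_ne h, mul_zero, map_zero]
    simp [h]

theorem unfold3_leg2 : unfold3 τ n (leg2 (vecRep τ n)) = LinearMap.toMatrix'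
    ((1 : K₀) • (1 : Module.End K₀ (Tens τ n K₀)) +
      (-PowerSeries.map PowerSeries.C (geom Polynomial.X)) • opP23 τ n K₀ +
      (PowerSeries.map PowerSeries.C (geom (cShift τ n)) : K₀) • opQ23 τ n K₀) := by
  ext1 ⟨⟨a, b⟩, c⟩ ⟨⟨a', b'⟩, c'⟩
  rw [unfold3_apply, leg2, Matrix.kroneckerMap_apply, Matrix.map_apply, map_add, map_add, map_smul,
    map_smul, map_smul, LinearMap.toMatrix'_one, Matrix.add_apply, Matrix.add_apply,
    Matrix.smul_apply, Matrix.smul_apply, Matrix.smul_apply, toMatrix_opP23, toMatrix_opQ23,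
    one_smul]
  by_cases h : a = a'
  · subst h
    rw [Matrix.one_apply_eq, one_mul, flatten2_atV, flatten_vecRep, Matrix.one_apply, map_add,
      map_sub, sub_eq_add_neg]
    congr 1
    · congr 1
      · simp only [Prod.mk.injEq, true_and]
        split_ifs <;> simp
      · simp only [and_true, smul_eq_mul]
        by_cases h : b' = c ∧ b = c'
        · rw [if_pos h, if_pos ⟨h.2, h.1.symm⟩, mul_one]
        · rw [if_neg h, if_neg (fun h' => h ⟨h'.2.symm, h'.1⟩)]
          simp
    · simp only [and_true, smul_eq_mul]
      split_ifs
      · rw [map_mul, map_intCast, mul_comm]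
      · simp
  · rw [Matrix.one_apply_ne h, zero_mul, map_zero]
    simp [h]

theorem C_geom_mul (a : Polynomial ℂ) :
    (PowerSeries.C (geom a) : K₀) * (1 - cK a * xK) = xK := by
  rw [cK, xK, ← map_mul, ← map_one PowerSeries.C, ← map_sub, ← map_mul, geom_mul]

theorem map_geom_mul (a : Polynomial ℂ) :
    (PowerSeries.map PowerSeries.C (geom a) : K₀) * (1 - cK a * yK) = yK := by
  have := congrArg (PowerSeries.map (PowerSeries.C : Polynomial ℂ →+* _)) (geom_mul a)
  simpa [cK, yK] using this

theorem vecRep_coefficients :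
    let α : K₀ := denPK * denQK τ n
    let β : K₀ := -(xK * yK * denQK τ n)
    let γ : K₀ := xK * yK * denPK
    let f : K₀ := PowerSeries.C (geom Polynomial.X)
    let g : K₀ := PowerSeries.C (geom (cShift τ n))
    let f' : K₀ := PowerSeries.map PowerSeries.C (geom Polynomial.X)
    let g' : K₀ := PowerSeries.map PowerSeries.C (geom (cShift τ n))
    let e : K₀ := (eps τ : ℤ)
    let N : K₀ := (size τ n : ℕ)
    α * (-f) * (-f') - 1 * β * (-f') + 1 * β * (-f) = 0 ∧
    -(α * g * (-f')) + 1 * γ * (-f') + 1 * γ * g = 0 ∧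
    α * g * g' + 1 * β * g' - 1 * β * g = 0 ∧
    α * (-f) * g' + 1 * γ * g' + 1 * γ * (-f) + e * β * (-f) * g' - e * β * g * (-f')
      + e * γ * (-f) * (-f') + N * γ * (-f) * g' + e * γ * g * g' = 0 := by
  intro α β γ f g f' g' e N
  -- The identities are checked in the fraction field; the denominators `1 - c x` and the like have
  -- constant term one, hence stay nonzero there.
  let ι := algebraMap K₀ (FractionRing K₀)
  have hι : Function.Injective ι := IsFractionRing.injective K₀ (FractionRing K₀)
  have hne : ∀ G : K₀, constantCoeff (constantCoeff G) = 1 → ι G ≠ 0 := by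
    intro G hG h0
    rw [map_eq_zero_iff ι hι] at h0
    simp [h0] at hG
  have hc : cK (cShift τ n) = cK Polynomial.X + cK (Polynomial.C (kappa τ n)) := by
    simp [cK, cShift]
  have hN : N = 2 * cK (Polynomial.C (kappa τ n)) + 2 * e := by
    have h := size_eq τ n
    have h' := congrArg (fun a : ℂ => cK (Polynomial.C a)) h
    simp only [cK, map_add, map_mul, map_natCast, map_intCast, map_ofNat] at h'
    exact h'
  have key := yangBaxter_coefficients (x := ι xK) (y := ι yK) (c := ι (cK Polynomial.X))
    (k := ι (cK (Polynomial.C (kappa τ n)))) (e := ι e) (N := ι N) (f := ι f) (g := ι g)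
    (f' := ι f') (g' := ι g') (d₁ := ι (1 - cK Polynomial.X * xK))
    (d₂ := ι (1 - cK Polynomial.X * yK)) (d₃ := ι (1 - cK (cShift τ n) * xK))
    (d₄ := ι (1 - cK (cShift τ n) * yK)) (α := ι α) (β := ι β) (γ := ι γ)
    (by rw [hN]; simp only [map_add, map_mul, map_ofNat]) (by simp only [map_sub, map_mul, map_one])
    (by simp only [map_sub, map_mul, map_one])
    (by rw [hc]; simp only [map_sub, map_add, map_mul, map_one])
    (by rw [hc]; simp only [map_sub, map_add, map_mul, map_one])
    (by rw [← map_mul, C_geom_mul]) (by rw [← map_mul, map_geom_mul])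
    (by rw [← map_mul, C_geom_mul]) (by rw [← map_mul, map_geom_mul])
    (hne _ (by simp [xK, cK])) (hne _ (by simp [yK, cK])) (hne _ (by simp [xK, cK]))
    (hne _ (by simp [yK, cK]))
    (by simp only [α, denPK, denQK, map_sub, map_mul])
    (by simp only [β, denQK, map_sub, map_mul, map_neg])
    (by simp only [γ, denPK, map_sub, map_mul])
  obtain ⟨k1, k2, k3, k4⟩ := key
  refine ⟨hι ?_, hι ?_, hι ?_, hι ?_⟩
  · simpa only [map_add, map_sub, map_mul, map_neg, map_one, map_zero] using k1
  · simpa only [map_add, map_sub, map_mul, map_neg, map_one, map_zero] using k2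
  · simpa only [map_add, map_sub, map_mul, map_neg, map_one, map_zero] using k3
  · simpa only [map_add, map_sub, map_mul, map_neg, map_one, map_zero] using k4

/-- The matrix `R(u - c)` satisfies the `RTT` relation. -/
theorem rtt_vecRep : rttLeft (vecRep τ n) = rttRight (vecRep τ n) := by
  apply unfold3_injective
  obtain ⟨h1, h2, h3, h4⟩ := vecRep_coefficients τ n
  have h := yangBaxter brauerRelations h1 h2 h3 h4
  rw [rttLeft, rttRight, map_mul, map_mul, map_mul, map_mul, unfold3_rMatrix, unfold3_leg1,
    unfold3_leg2, ← LinearMap.toMatrix'_mul, ← LinearMap.toMatrix'_mul, ← LinearMap.toMatrix'_mul,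
    ← LinearMap.toMatrix'_mul, h]

end VectorRepRTT

/-! ### Products of solutions of the `RTT` relation -/

section Products

variable {τ : ClassicalType} {n : ℕ} {A B : Type} [Ring A] [Algebra ℂ A] [Ring B] [Algebra ℂ B]

/-- The coefficients of the entries of two matrices commute. -/
def EntriesCommute (M K : Matrix (Idx τ n) (Idx τ n) A⟦X⟧) : Prop :=
  ∀ i j k l r s, Commute (coeff r (M i j)) (coeff s (K k l))

theorem commute_of_coeff {g h : A⟦X⟧} (H : ∀ r s, Commute (coeff r g) (coeff s h)) :
    Commute g h := by
  show _ = _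
  ext m
  rw [coeff_mul, coeff_mul, ← Finset.Nat.sum_antidiagonal_swap]
  exact Finset.sum_congr rfl fun p _ => (H _ _).eq

theorem leg1_mul (M K : Matrix (Idx τ n) (Idx τ n) A⟦X⟧) : leg1 (M * K) = leg1 M * leg1 K := by
  ext1 ⟨a, b⟩ ⟨c, d⟩
  rw [Matrix.mul_apply, Fintype.sum_prod_type]
  simp only [leg1, Matrix.kroneckerMap_apply, Matrix.map_apply, Matrix.mul_apply, map_sum, map_mul,
    Finset.sum_mul]
  refine Finset.sum_congr rfl fun p _ => ?_
  rw [Finset.sum_eq_single b]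
  · simp only [Matrix.one_apply_eq, mul_one, mul_assoc]
  · intro q _ hq
    simp [Matrix.one_apply_ne (Ne.symm hq)]
  · simp

theorem leg2_mul (M K : Matrix (Idx τ n) (Idx τ n) A⟦X⟧) : leg2 (M * K) = leg2 M * leg2 K := by
  ext1 ⟨a, b⟩ ⟨c, d⟩
  rw [Matrix.mul_apply, Fintype.sum_prod_type, Finset.sum_eq_single a]
  · simp only [leg2, Matrix.kroneckerMap_apply, Matrix.map_apply, Matrix.mul_apply, map_sum,
      map_mul, Finset.mul_sum, Matrix.one_apply_eq, one_mul]
    refine Finset.sum_congr rfl fun p _ => ?_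
    by_cases h : a = c
    · subst h
      simp only [Matrix.one_apply_eq, one_mul]
    · simp only [Matrix.one_apply_ne h, zero_mul, mul_zero]
  · intro q _ hq
    simp [leg2, Matrix.one_apply_ne (Ne.symm hq)]
  · simp

theorem leg1_leg2_comm {M K : Matrix (Idx τ n) (Idx τ n) A⟦X⟧} (h : EntriesCommute M K) :
    leg1 M * leg2 K = leg2 K * leg1 M := by
  ext1 ⟨a, b⟩ ⟨c, d⟩
  rw [leg1_mul_leg2_apply, leg2_mul_leg1_apply]
  ext s r
  rw [coeff_atU_mul_atV, coeff_atV_mul_atU, (h _ _ _ _ _ _).eq]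

theorem EntriesCommute.symm {M K : Matrix (Idx τ n) (Idx τ n) A⟦X⟧} (h : EntriesCommute M K) :
    EntriesCommute K M := fun _ _ _ _ _ _ => (h _ _ _ _ _ _).symm

/-- The product of two solutions of the `RTT` relation with commuting entries is a solution. -/
theorem rtt_mul {M K : Matrix (Idx τ n) (Idx τ n) A⟦X⟧} (hM : rttLeft M = rttRight M)
    (hK : rttLeft K = rttRight K) (h : EntriesCommute M K) :
    rttLeft (M * K) = rttRight (M * K) := by
  simp only [rttLeft, rttRight] at hM hK ⊢
  have h1 := leg1_leg2_comm h
  have h2 := leg1_leg2_comm h.symm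
  rw [leg1_mul, leg2_mul]
  calc rMatrix τ n A * (leg1 M * leg1 K) * (leg2 M * leg2 K)
      = rMatrix τ n A * leg1 M * (leg1 K * leg2 M) * leg2 K := by simp only [mul_assoc]
    _ = rMatrix τ n A * leg1 M * leg2 M * (leg1 K * leg2 K) := by rw [h2]; simp only [mul_assoc]
    _ = leg2 M * leg1 M * (rMatrix τ n A * leg1 K * leg2 K) := by rw [hM]; simp only [mul_assoc]
    _ = leg2 M * (leg1 M * leg2 K) * (leg1 K * rMatrix τ n A) := by
      rw [hK]; simp only [mul_assoc]
    _ = _ := by rw [h1]; simp only [mul_assoc]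

theorem rtt_map (φ : A →ₐ[ℂ] B) {M : Matrix (Idx τ n) (Idx τ n) A⟦X⟧}
    (hM : rttLeft M = rttRight M) : rttLeft (M.map (PowerSeries.map (φ : A →+* B))) =
      rttRight (M.map (PowerSeries.map (φ : A →+* B))) := by
  rw [← rttLeft_map, ← rttRight_map, hM]

theorem permMatrix_comm_apply (G : A⟦X⟧⟦X⟧) (p q : Idx τ n × Idx τ n) :
    Commute (permMatrix τ n A⟦X⟧⟦X⟧ p q) G := by
  rw [permMatrix]
  split_ifs
  · exact Commute.one_left G
  · exact Commute.zero_left G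

theorem qMatrix_comm_apply (G : A⟦X⟧⟦X⟧) (p q : Idx τ n × Idx τ n) :
    Commute (qMatrix τ n A⟦X⟧⟦X⟧ p q) G := by
  rw [qMatrix]
  split_ifs
  · exact Int.cast_commute _ _
  · exact Commute.zero_left G

theorem rMatrix_comm_apply (G : A⟦X⟧⟦X⟧) (p q : Idx τ n × Idx τ n) :
    Commute (rMatrix τ n A p q) G := by
  rw [rMatrix_eq, Matrix.add_apply, Matrix.sub_apply, Matrix.smul_apply, Matrix.smul_apply,
    Matrix.smul_apply, Matrix.one_apply]
  refine Commute.add_left (Commute.sub_left ((coefA_comm G).mul_left ?_)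
    ((coefB_comm G).mul_left (permMatrix_comm_apply G p q)))
    ((coefC_comm G).mul_left (qMatrix_comm_apply G p q))
  split_ifs
  · exact Commute.one_left G
  · exact Commute.zero_left G

theorem leg1_diagonal (g : A⟦X⟧) :
    leg1 (Matrix.diagonal fun _ : Idx τ n => g) = Matrix.diagonal fun _ => atU g := by
  ext1 ⟨a, b⟩ ⟨c, d⟩
  rw [leg1, Matrix.kroneckerMap_apply, Matrix.map_apply, Matrix.diagonal_apply,
    Matrix.diagonal_apply, Matrix.one_apply]
  by_cases h : a = c <;> by_cases h' : b = d <;> simp [h, h']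

theorem leg2_diagonal (g : A⟦X⟧) :
    leg2 (Matrix.diagonal fun _ : Idx τ n => g) = Matrix.diagonal fun _ => atV g := by
  ext1 ⟨a, b⟩ ⟨c, d⟩
  rw [leg2, Matrix.kroneckerMap_apply, Matrix.map_apply, Matrix.diagonal_apply,
    Matrix.diagonal_apply, Matrix.one_apply]
  by_cases h : a = c <;> by_cases h' : b = d <;> simp [h, h']

/-- A scalar matrix with commuting coefficients satisfies the `RTT` relation. -/
theorem rtt_diagonal {g : A⟦X⟧} (h : ∀ r s, Commute (coeff r g) (coeff s g)) :
    rttLeft (Matrix.diagonal fun _ : Idx τ n => g) =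
      rttRight (Matrix.diagonal fun _ : Idx τ n => g) := by
  have hc : atU g * atV g = atV g * atU g := by
    ext s r
    rw [coeff_atU_mul_atV, coeff_atV_mul_atU, (h _ _).eq]
  rw [rttLeft, rttRight, leg1_diagonal, leg2_diagonal, mul_assoc, Matrix.diagonal_mul_diagonal,
    Matrix.diagonal_mul_diagonal, ← hc]
  ext1 p q
  rw [Matrix.mul_diagonal, Matrix.diagonal_mul, (rMatrix_comm_apply _ p q).eq]

/-- A transposition reverses products only if entries of different factors commute. -/
theorem transp_mul {M K : Matrix (Idx τ n) (Idx τ n) A⟦X⟧} (h : EntriesCommute M K) :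
    transp (M * K) = transp K * transp M := by
  ext1 k l
  rw [Matrix.mul_apply, transp, Matrix.mul_apply, shift_sum, Finset.smul_sum, ← sum_neg]
  refine Finset.sum_congr rfl fun p _ => ?_
  rw [shift_mul, transp, transp, smul_mul_assoc, mul_smul_comm, smul_smul, theta_mul,
    ← shift_mul, ← shift_mul, (commute_of_coeff fun r s => h _ _ _ _ r s).eq]

theorem transp_map (φ : A →ₐ[ℂ] B) (M : Matrix (Idx τ n) (Idx τ n) A⟦X⟧) :
    transp (M.map (PowerSeries.map (φ : A →+* B))) =
      (transp M).map (PowerSeries.map (φ : A →+* B)) := by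
  ext1 k l
  simp only [transp, Matrix.map_apply, shift_map, map_zsmul]

theorem zSeries_map (φ : A →ₐ[ℂ] B) (M : Matrix (Idx τ n) (Idx τ n) A⟦X⟧) :
    zSeries (M.map (PowerSeries.map (φ : A →+* B))) =
      PowerSeries.map (φ : A →+* B) (zSeries M) := by
  rw [zSeries, transp_map, ← Matrix.map_mul]
  ext m
  simp only [zSeries, Matrix.trace, Matrix.diag_apply, Matrix.map_apply, PowerSeries.coeff_smul,
    map_sum, PowerSeries.coeff_map, RingHom.coe_coe, map_smul]

/-- From `(MK)ᵗ MK = Kᵗ (Mᵗ M) K = Kᵗ z_M K = z_M Kᵗ K`: this is the group-like behaviour of `z(u)`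
under the coproduct. -/
theorem zSeries_mul {M K : Matrix (Idx τ n) (Idx τ n) A⟦X⟧} (hn : 1 ≤ n) (hκ : kappa τ n ≠ 0)
    (hM : rttLeft M = rttRight M) (hK : rttLeft K = rttRight K) (h : EntriesCommute M K)
    (hz : ∀ k l r s, Commute (coeff r (zSeries M)) (coeff s (K k l))) :
    zSeries (M * K) = zSeries M * zSeries K := by
  obtain ⟨o⟩ := idx_nonempty (τ := τ) hn
  have h1 := (transp_mul_and_mul_transp hn hκ (rtt_mul hM hK h)).1
  have h2 : transp (M * K) * (M * K) = Matrix.diagonal fun _ => zSeries M * zSeries K := by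
    rw [transp_mul h, mul_assoc, ← mul_assoc (transp M), (transp_mul_and_mul_transp hn hκ hM).1]
    have h3 : Matrix.diagonal (fun _ => zSeries M) * K = K * Matrix.diagonal fun _ => zSeries M := by
      ext1 k l
      rw [Matrix.diagonal_mul, Matrix.mul_diagonal, (commute_of_coeff (hz k l)).eq]
    have h4 : Commute (zSeries K) (zSeries M) := by
      rw [zSeries]
      refine Commute.smul_left ?_ _
      rw [Matrix.trace]
      refine Commute.sum_left _ _ _ fun i _ => ?_
      rw [Matrix.diag_apply, Matrix.mul_apply]
      refine Commute.sum_left _ _ _ fun p _ => Commute.mul_left ?_ ?_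
      · rw [transp]
        refine Commute.smul_left (commute_of_coeff fun r s => ?_) _
        rw [shift, coeff_mk]
        exact Commute.sum_left _ _ _ fun a _ => Commute.smul_left (hz _ _ _ _).symm _
      · exact commute_of_coeff fun r s => (hz _ _ _ _).symm
    rw [h3, ← mul_assoc, (transp_mul_and_mul_transp hn hκ hK).1, Matrix.diagonal_mul_diagonal]
    simp only [h4.eq]
  rw [h1] at h2
  simpa using congrFun (congrFun h2 o) o

end Products

/-! ### `Rᵗ(u + κ) R(u)` is a scalar -/

section Crossing

variable (τ : ClassicalType) (n : ℕ)

/-- The matrix coefficients of `R(u - c)`. -/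
def vecEntry (i j a b : Idx τ n) : (Polynomial ℂ)⟦X⟧ :=
  flatten (Idx τ n) (Polynomial ℂ) (vecRep τ n i j) a b

/-- Both `P` and `Q` are invariant under the exchange of the two tensor factors. -/
theorem vecEntry_swap (i j a b : Idx τ n) : vecEntry τ n i j a b = vecEntry τ n a b i j := by
  simp only [vecEntry, flatten_vecRep]
  congr 1
  · congr 1
    · simp only [and_comm]
    · have : (j = a ∧ i = b) ↔ (b = i ∧ a = j) := by grind
      simp only [this]
  · by_cases h : a = neg i ∧ b = neg j
    · obtain ⟨rfl, rfl⟩ := h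
      simp [theta_neg_neg]
    · rw [if_neg h, if_neg]
      rintro ⟨rfl, rfl⟩
      simp at h

/-- Transposing `R` in the first factor or in the second has the same effect, since either
transposition interchanges `P` and `Q`. -/
theorem vecEntry_cross (k d p a : Idx τ n) :
    theta τ a p • vecEntry τ n k d (neg p) (neg a) =
      theta τ k d • vecEntry τ n (neg d) (neg k) a p := by
  simp only [vecEntry, flatten_vecRep, smul_add, smul_sub]
  congr 1
  · congr 1
    · by_cases h : k = d ∧ p = a
      · obtain ⟨rfl, rfl⟩ := h
        simp [theta_self]
      · rw [if_neg (fun h' => h ⟨h'.1, neg_injective h'.2⟩),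
          if_neg (fun h' => h ⟨(neg_injective h'.1).symm, h'.2.symm⟩), smul_zero, smul_zero]
    · by_cases h : d = neg p ∧ k = neg a
      · obtain ⟨rfl, rfl⟩ := h
        simp [theta_neg_neg]
      · rw [if_neg h, if_neg, smul_zero, smul_zero]
        rintro ⟨h1, h2⟩
        exact h ⟨neg_eq_iff.1 h2, neg_eq_iff.1 h1⟩
  · by_cases h : p = k ∧ a = d
    · obtain ⟨rfl, rfl⟩ := h
      simp [theta_neg_neg, theta_comm]
    · rw [if_neg (fun h' => h ⟨neg_injective h'.1, neg_injective h'.2⟩), if_neg, smul_zero,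
        smul_zero]
      rintro ⟨h1, h2⟩
      rw [neg_neg'] at h1 h2
      exact h ⟨h2, h1⟩

theorem flatten_shift (c : ℂ) (g : (Matrix (Idx τ n) (Idx τ n) (Polynomial ℂ))⟦X⟧) (a b : Idx τ n) :
    flatten (Idx τ n) (Polynomial ℂ) (shift c g) a b =
      shift c (flatten (Idx τ n) (Polynomial ℂ) g a b) := by
  ext1 m
  rw [coeff_flatten, shift, coeff_mk, shift, coeff_mk, Matrix.sum_apply]
  simp only [Matrix.smul_apply, coeff_flatten]

theorem flatten_transp_mul (k l a b : Idx τ n) :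
    flatten (Idx τ n) (Polynomial ℂ) ((transp (vecRep τ n) * vecRep τ n) k l) a b =
      ∑ p, ∑ d, theta τ k p • (shift (kappa τ n) (vecEntry τ n (neg p) (neg k) a d) *
        vecEntry τ n p l d b) := by
  rw [Matrix.mul_apply, map_sum, Matrix.sum_apply]
  refine Finset.sum_congr rfl fun p _ => ?_
  rw [map_mul, Matrix.mul_apply]
  refine Finset.sum_congr rfl fun d _ => ?_
  rw [transp, map_zsmul, Matrix.smul_apply, flatten_shift, smul_mul_assoc]
  rfl

/-- By the two symmetries of `R`, the product `Rᵗ(u + κ) R(u)` is symmetric in the auxiliary space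
and the representation space. -/
theorem flatten_transp_mul_swap (k l a b : Idx τ n) :
    flatten (Idx τ n) (Polynomial ℂ) ((transp (vecRep τ n) * vecRep τ n) k l) a b =
      flatten (Idx τ n) (Polynomial ℂ) ((transp (vecRep τ n) * vecRep τ n) a b) k l := by
  rw [flatten_transp_mul, flatten_transp_mul, Finset.sum_comm]
  refine Finset.sum_congr rfl fun d _ => Finset.sum_congr rfl fun p _ => ?_
  rw [← smul_mul_assoc, ← smul_mul_assoc, ← shift_zsmul, ← shift_zsmul, vecEntry_swap τ n (neg d),
    vecEntry_cross, vecEntry_swap τ n p l]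

/-- `Rᵗ(u + κ) R(u)` is a scalar series. -/
theorem exists_zSeries_vecRep (hn : 1 ≤ n) (hκ : kappa τ n ≠ 0) :
    ∃ g : (Polynomial ℂ)⟦X⟧, ∀ m, coeff m (zSeries (vecRep τ n)) =
      Matrix.diagonal fun _ => coeff m g := by
  obtain ⟨o⟩ := idx_nonempty (τ := τ) hn
  -- The RTT relation makes the product scalar in the auxiliary space; the symmetry transfers this
  -- to the representation space.
  have h := flatten_transp_mul_swap τ n
  rw [(transp_mul_and_mul_transp hn hκ (rtt_vecRep τ n)).1] at h
  refine ⟨flatten (Idx τ n) (Polynomial ℂ) (zSeries (vecRep τ n)) o o, fun m => ?_⟩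
  ext1 a b
  rw [← coeff_flatten, Matrix.diagonal_apply]
  split_ifs with hab
  · subst hab
    have := h o o a a
    rw [Matrix.diagonal_apply_eq, Matrix.diagonal_apply_eq] at this
    rw [this]
  · have := h o o a b
    rw [Matrix.diagonal_apply_eq, Matrix.diagonal_apply_ne _ hab, map_zero] at this
    rw [this]
    simp

end Crossing

/-! ### The filtration with `deg t_{ij}^{(r)} = 2 r - 1` -/

section Filtration

variable {τ : ClassicalType} {n : ℕ} {A : Type} [Ring A] [Algebra ℂ A]
  {M : Matrix (Idx τ n) (Idx τ n) A⟦X⟧}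

/-- The symbol `(i, j, r)` stands for `t_{ij}^{(r+1)}`. -/
abbrev Gen (τ : ClassicalType) (n : ℕ) : Type := Idx τ n × Idx τ n × ℕ

variable (M) in
/-- The generators of the extended Yangian. -/
def gen (g : Gen τ n) : A := coeff (g.2.2 + 1) (M g.1 g.2.1)

/-- The weight of a generator. -/
def wt (g : Gen τ n) : ℕ := 2 * g.2.2 + 1

/-- The weight of a word in the generators. -/
def wtL (L : List (Gen τ n)) : ℕ := (L.map wt).sum

variable (M) in
/-- The value of a word in the generators. -/
def word (L : List (Gen τ n)) : A := (L.map (gen M)).prod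

theorem wtL_nil : wtL ([] : List (Gen τ n)) = 0 := rfl

theorem wtL_cons (g : Gen τ n) (L : List (Gen τ n)) : wtL (g :: L) = wt g + wtL L := by
  simp [wtL]

theorem wtL_append (L L' : List (Gen τ n)) : wtL (L ++ L') = wtL L + wtL L' := by
  simp [wtL]

theorem word_nil : word M ([] : List (Gen τ n)) = 1 := rfl

theorem word_cons (g : Gen τ n) (L : List (Gen τ n)) : word M (g :: L) = gen M g * word M L := by
  simp [word]

theorem word_append (L L' : List (Gen τ n)) : word M (L ++ L') = word M L * word M L' := by
  simp [word]

theorem eq_nil_of_wtL {L : List (Gen τ n)} (h : wtL L = 0) : L = [] := by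
  cases L with
  | nil => rfl
  | cons g L => rw [wtL_cons, wt] at h; omega

variable (M) in
/-- The filtration of the extended Yangian. -/
def filt (e : ℤ) : Submodule ℂ A :=
  Submodule.span ℂ {x | ∃ L : List (Gen τ n), (wtL L : ℤ) ≤ e ∧ x = word M L}

theorem word_mem {L : List (Gen τ n)} {e : ℤ} (h : (wtL L : ℤ) ≤ e) : word M L ∈ filt M e :=
  Submodule.subset_span ⟨L, h, rfl⟩

theorem filt_mono {a b : ℤ} (h : a ≤ b) : filt M a ≤ filt M b :=
  Submodule.span_mono fun _ ⟨L, hL, hx⟩ => ⟨L, hL.trans h, hx⟩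

theorem one_mem_filt {e : ℤ} (h : 0 ≤ e) : (1 : A) ∈ filt M e :=
  word_mem (L := []) (by simpa [wtL_nil] using h)

theorem gen_mem (g : Gen τ n) : gen M g ∈ filt M (wt g) := by
  have := word_mem (M := M) (L := [g]) (e := wt g) (by simp [wtL_cons, wtL_nil])
  simpa [word_cons, word_nil] using this

theorem mul_mem_filt {a b : ℤ} {x y : A} (hx : x ∈ filt M a) (hy : y ∈ filt M b) :
    x * y ∈ filt M (a + b) := by
  induction hx using Submodule.span_induction with
  | mem x hx =>
    obtain ⟨L, hL, rfl⟩ := hx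
    induction hy using Submodule.span_induction with
    | mem y hy =>
      obtain ⟨L', hL', rfl⟩ := hy
      rw [← word_append]
      exact word_mem (by rw [wtL_append]; push_cast; omega)
    | zero => rw [mul_zero]; exact zero_mem _
    | add y y' _ _ h h' => rw [mul_add]; exact add_mem h h'
    | smul c y _ h => rw [mul_smul_comm]; exact Submodule.smul_mem _ _ h
  | zero => rw [zero_mul]; exact zero_mem _
  | add x x' _ _ h h' => rw [add_mul]; exact add_mem h h'
  | smul c x _ h => rw [smul_mul_assoc]; exact Submodule.smul_mem _ _ h

theorem mul_mem_filt' {a b c : ℤ} {x y : A} (hx : x ∈ filt M a) (hy : y ∈ filt M b)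
    (h : a + b ≤ c) : x * y ∈ filt M c :=
  filt_mono h (mul_mem_filt hx hy)

theorem filt_of_neg {e : ℤ} (h : e < 0) : filt M e = ⊥ := by
  rw [filt, Submodule.span_eq_bot]
  rintro x ⟨L, hL, -⟩
  omega

theorem mem_filt_zero {x : A} (h : x ∈ filt M 0) : ∃ c : ℂ, x = c • 1 := by
  induction h using Submodule.span_induction with
  | mem x hx =>
    obtain ⟨L, hL, rfl⟩ := hx
    rw [eq_nil_of_wtL (by omega : wtL L = 0)]
    exact ⟨1, by rw [word_nil, one_smul]⟩
  | zero => exact ⟨0, by rw [zero_smul]⟩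
  | add x y _ _ h h' =>
    obtain ⟨c, rfl⟩ := h
    obtain ⟨d, rfl⟩ := h'
    exact ⟨c + d, by rw [add_smul]⟩
  | smul a x _ h =>
    obtain ⟨c, rfl⟩ := h
    exact ⟨a * c, by rw [mul_smul]⟩

/-! ### Filtrations of series -/

variable (M) in
/-- Series whose coefficient of `u^{-r}` lies in the part of degree `2 r + e`. -/
def uniFilt (e : ℤ) : AddSubgroup A⟦X⟧ where
  carrier := {g | ∀ r : ℕ, coeff r g ∈ filt M (2 * r + e)}
  zero_mem' r := by simp
  add_mem' hg hh r := by rw [map_add]; exact add_mem (hg r) (hh r)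
  neg_mem' hg r := by rw [map_neg]; exact neg_mem (hg r)

variable (M) in
/-- Double series whose coefficient of `u^{-r} v^{-s}` lies in the part of degree
`2 (r + s) + e`. -/
def biFilt (e : ℤ) : AddSubgroup A⟦X⟧⟦X⟧ where
  carrier := {G | ∀ r s : ℕ, coeff r (coeff s G) ∈ filt M (2 * (r + s) + e)}
  zero_mem' r s := by simp
  add_mem' hg hh r s := by rw [map_add, map_add]; exact add_mem (hg r s) (hh r s)
  neg_mem' hg r s := by rw [map_neg, map_neg]; exact neg_mem (hg r s)

theorem uniFilt_mono {a b : ℤ} (h : a ≤ b) : uniFilt M a ≤ uniFilt M b :=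
  fun _ hg r => filt_mono (by omega) (hg r)

theorem biFilt_mono {a b : ℤ} (h : a ≤ b) : biFilt M a ≤ biFilt M b :=
  fun _ hg r s => filt_mono (by omega) (hg r s)

theorem mul_mem_uniFilt {a b : ℤ} {g h : A⟦X⟧} (hg : g ∈ uniFilt M a)
    (hh : h ∈ uniFilt M b) : g * h ∈ uniFilt M (a + b) := by
  intro r
  rw [coeff_mul]
  refine sum_mem fun p hp => mul_mem_filt' (hg _) (hh _) ?_
  have : p.1 + p.2 = r := by simpa using hp
  omega

theorem atU_mul_atV_mem {a b : ℤ} {g h : A⟦X⟧} (hg : g ∈ uniFilt M a)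
    (hh : h ∈ uniFilt M b) : atU g * atV h ∈ biFilt M (a + b) := by
  intro r s
  rw [coeff_atU_mul_atV]
  exact mul_mem_filt' (hg r) (hh s) (by omega)

theorem atV_mul_atU_mem {a b : ℤ} {g h : A⟦X⟧} (hg : g ∈ uniFilt M a)
    (hh : h ∈ uniFilt M b) : atV h * atU g ∈ biFilt M (a + b) := by
  intro r s
  rw [coeff_atV_mul_atU]
  exact mul_mem_filt' (hh s) (hg r) (by omega)

theorem atU_mem {a : ℤ} {g : A⟦X⟧} (hg : g ∈ uniFilt M a) : atU g ∈ biFilt M a := by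
  intro r s
  rw [atU, coeff_C]
  split_ifs
  · exact filt_mono (by omega) (hg r)
  · simp

theorem uInv_mul_mem {e : ℤ} {G : A⟦X⟧⟦X⟧} (h : G ∈ biFilt M e) :
    uInv _ * G ∈ biFilt M (e - 2) := by
  intro r s
  rw [uInv, coeff_C_mul]
  rcases r with _ | r
  · simp
  · rw [coeff_succ_X_mul]
    exact filt_mono (by push_cast; omega) (h r s)

theorem vInv_mul_mem {e : ℤ} {G : A⟦X⟧⟦X⟧} (h : G ∈ biFilt M e) :
    vInv _ * G ∈ biFilt M (e - 2) := by
  intro r s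
  rw [vInv]
  rcases s with _ | s
  · simp
  · rw [coeff_succ_X_mul]
    exact filt_mono (by push_cast; omega) (h r s)

theorem coeff_kappaC_mul (G : A⟦X⟧⟦X⟧) (r s : ℕ) :
    coeff r (coeff s (kappaC τ n _ * G)) = kappa τ n • coeff r (coeff s G) := by
  rw [kappaC, coeff_C_mul, coeff_C_mul, Algebra.smul_def]

theorem kappaC_mul_mem {e : ℤ} {G : A⟦X⟧⟦X⟧} (h : G ∈ biFilt M e) :
    kappaC τ n _ * G ∈ biFilt M e := by
  intro r s
  rw [coeff_kappaC_mul]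
  exact Submodule.smul_mem _ _ (h r s)

theorem denP_mul_mem {e : ℤ} {G : A⟦X⟧⟦X⟧} (h : G ∈ biFilt M e) :
    denP _ * G ∈ biFilt M (e - 2) := by
  rw [denP, sub_mul]
  exact sub_mem (vInv_mul_mem h) (uInv_mul_mem h)

theorem denQ_eq : denQ τ n (A) =
    denP (A) - kappaC τ n (A) * (uInv (A) * vInv (A)) := by
  rw [denQ, denP, mul_assoc]

theorem denQ_mul_mem {e : ℤ} {G : A⟦X⟧⟦X⟧} (h : G ∈ biFilt M e) :
    denQ τ n _ * G ∈ biFilt M (e - 2) := by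
  rw [denQ_eq, sub_mul, mul_assoc, mul_assoc]
  exact sub_mem (denP_mul_mem h)
    (biFilt_mono (by omega) (kappaC_mul_mem (uInv_mul_mem (vInv_mul_mem h))))

theorem coeff_denP_mul (G : A⟦X⟧⟦X⟧) (r s : ℕ) :
    coeff (r + 1) (coeff (s + 1) (denP _ * G)) =
      coeff (r + 1) (coeff s G) - coeff r (coeff (s + 1) G) := by
  rw [denP, sub_mul, map_sub, map_sub, vInv, uInv, coeff_succ_X_mul, coeff_C_mul, coeff_succ_X_mul]

theorem coeff_denQ_mul (G : A⟦X⟧⟦X⟧) (r s : ℕ) :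
    coeff (r + 1) (coeff (s + 1) (denQ τ n _ * G)) =
      coeff (r + 1) (coeff s G) - coeff r (coeff (s + 1) G) - kappa τ n • coeff r (coeff s G) := by
  rw [denQ_eq, sub_mul, map_sub, map_sub, coeff_denP_mul, mul_assoc, coeff_kappaC_mul, mul_assoc,
    vInv, uInv, coeff_C_mul, coeff_succ_X_mul, coeff_succ_X_mul]

/-- Division by `y - x` is a recursion on the power of `y`: each coefficient is the one with a power
of `y` traded for a power of `x`, minus a coefficient of the product. The hypothesis `h0` starts it.
-/
theorem mem_of_denP_mul_mem {e : ℤ} {G : A⟦X⟧⟦X⟧} (h0 : coeff 0 G = 0)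
    (h : denP _ * G ∈ biFilt M (e - 2)) : G ∈ biFilt M e := by
  intro r s
  induction s generalizing r with
  | zero => simp [h0]
  | succ s ih =>
    have h1 := h (r + 1) (s + 1)
    rw [coeff_denP_mul] at h1
    have h2 := sub_mem (ih (r + 1)) (filt_mono (by push_cast; omega) h1)
    rw [sub_sub_cancel] at h2
    exact filt_mono (by push_cast; omega) h2

theorem mem_of_denQ_mul_mem {e : ℤ} {G : A⟦X⟧⟦X⟧} (h0 : coeff 0 G = 0)
    (h : denQ τ n _ * G ∈ biFilt M (e - 2)) : G ∈ biFilt M e := by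
  intro r s
  induction s generalizing r with
  | zero => simp [h0]
  | succ s ih =>
    have h1 := h (r + 1) (s + 1)
    rw [coeff_denQ_mul] at h1
    have h2 := sub_mem (ih (r + 1)) (add_mem (filt_mono (by push_cast; omega) h1)
      (Submodule.smul_mem _ (kappa τ n) (filt_mono (by push_cast; omega) (ih r))))
    rw [sub_add_cancel, sub_sub_cancel] at h2
    exact filt_mono (by push_cast; omega) h2

theorem shift_mem_uniFilt {c : ℂ} {e : ℤ} {g : A⟦X⟧} (hg : g ∈ uniFilt M e) :
    shift c g ∈ uniFilt M e := by
  intro r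
  rw [shift, coeff_mk]
  refine sum_mem fun a ha => Submodule.smul_mem _ _ (filt_mono ?_ (hg a))
  have := Finset.mem_range.1 ha
  omega

/-- A shift adds to the coefficient of `u^{-r}` only multiples of earlier coefficients, each of
degree at least two less. Hence `κ` disappears from leading terms. -/
theorem shift_sub_mem_uniFilt {c : ℂ} {e : ℤ} {g : A⟦X⟧} (hg : g ∈ uniFilt M e) :
    shift c g - g ∈ uniFilt M (e - 2) := by
  intro r
  rw [map_sub, coeff_shift_eq, add_sub_cancel_right]
  refine sum_mem fun a ha => Submodule.smul_mem _ _ (filt_mono ?_ (hg a))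
  have := Finset.mem_range.1 ha
  omega

end Filtration

/-! ### Leading terms of the relations -/

section Leading

variable {τ : ClassicalType} {n : ℕ} {A : Type} [Ring A] [Algebra ℂ A]
  {M : Matrix (Idx τ n) (Idx τ n) A⟦X⟧}

variable (M) in
/-- A solution `M(u) = 1 + O(u⁻¹)` of the `RTT` relation. -/
structure Solution : Prop where
  pos : 1 ≤ n
  kappa_ne : kappa τ n ≠ 0
  coeff_zero : ∀ i j, coeff 0 (M i j) = if i = j then 1 else 0
  rtt : rttLeft M = rttRight M

/-- `δ_{ij}` as a series. -/
def delta (i j : Idx τ n) : A⟦X⟧ := if i = j then 1 else 0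

variable (M) in
/-- The series `t_{ij}(u) - δ_{ij}`. -/
def T0 (i j : Idx τ n) : A⟦X⟧ := M i j - delta i j

variable (M) in
theorem T_eq (i j : Idx τ n) : M i j = delta i j + T0 M i j := by
  rw [T0, add_sub_cancel]

theorem coeff_zero_T0 (hM : Solution M) (i j : Idx τ n) : coeff 0 (T0 M i j) = 0 := by
  rw [T0, map_sub, hM.coeff_zero, delta]
  split_ifs <;> simp

theorem coeff_succ_T0 (i j : Idx τ n) (r : ℕ) : coeff (r + 1) (T0 M i j) = gen M (i, j, r) := by
  rw [T0, map_sub, delta, gen]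
  split_ifs <;> simp [coeff_one]

theorem T0_mem (hM : Solution M) (i j : Idx τ n) : T0 M i j ∈ uniFilt M (-1) := by
  intro r
  rcases r with _ | r
  · rw [coeff_zero_T0 hM]; exact zero_mem _
  · rw [coeff_succ_T0]
    exact filt_mono (by simp only [wt]; push_cast; omega) (gen_mem (i, j, r))

theorem delta_mul (i j : Idx τ n) (g : A⟦X⟧) : delta i j * g = if i = j then g else 0 := by
  rw [delta]; split_ifs <;> simp

theorem mul_delta (i j : Idx τ n) (g : A⟦X⟧) : g * delta i j = if i = j then g else 0 := by
  rw [delta]; split_ifs <;> simp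

theorem shift_delta (c : ℂ) (i j : Idx τ n) : shift c (delta i j : A⟦X⟧) = delta i j := by
  rw [delta]
  split_ifs
  · have := shift_C c (1 : A)
    simpa using this
  · exact map_zero (shiftₗ _ c)

theorem transp_mul_T (hM : Solution M) (i j : Idx τ n) :
    ∑ a, theta τ i a • (shift (kappa τ n) (M (neg a) (neg i)) * M a j) =
      delta i j * zSeries M := by
  have h := congrFun (congrFun (transp_mul_and_mul_transp hM.pos hM.kappa_ne hM.rtt).1 i) j
  rw [Matrix.mul_apply, Matrix.diagonal_apply] at h
  rw [delta_mul, ← h]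
  refine Finset.sum_congr rfl fun a _ => ?_
  rw [transp, smul_mul_assoc]

variable (M) in
/-- The series `z(u) - 1`. -/
def z0 : A⟦X⟧ := zSeries M - 1

/-- Insert `M = δ + T0` into `Mᵗ(u + κ) M(u) = z(u)`: the expression is the linear part, and what
remains is quadratic or due to the shift. -/
theorem relation_z (hM : Solution M) (i j : Idx τ n) :
    T0 M i j + theta τ i j • T0 M (neg j) (neg i) - delta i j * z0 M ∈ uniFilt M (-2) := by
  have h := transp_mul_T hM i j
  have hs : ∀ a b : Idx τ n, shift (kappa τ n) (M a b) =
      delta a b + shift (kappa τ n) (T0 M a b) := by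
    intro a b
    rw [T_eq M, ← shiftₗ_apply, map_add, shiftₗ_apply, shift_delta, shiftₗ_apply]
  have hd : ∀ a, (delta (neg a) (neg i) : A⟦X⟧) = delta i a := by
    intro a
    by_cases h : i = a
    · subst h; simp [delta]
    · rw [delta, delta, if_neg h, if_neg (fun h' => h (neg_injective h').symm)]
  have e : T0 M i j + theta τ i j • T0 M (neg j) (neg i) - delta i j * z0 M =
      theta τ i j • (T0 M (neg j) (neg i) - shift (kappa τ n) (T0 M (neg j) (neg i))) -
        ∑ a, theta τ i a • (shift (kappa τ n) (T0 M (neg a) (neg i)) * T0 M a j) := by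
    simp only [hs, T_eq M _ j, hd] at h
    simp only [add_mul, mul_add, delta_mul i, mul_delta, smul_add, Finset.sum_add_distrib,
      smul_ite, smul_zero, Finset.sum_ite_eq, Finset.sum_ite_eq', Finset.mem_univ, if_true,
      theta_self, one_smul] at h
    rw [z0, mul_sub, mul_one, smul_sub, delta_mul i j (zSeries M), ← h]
    abel
  rw [e]
  refine sub_mem (zsmul_mem ?_ _) (sum_mem fun a _ => zsmul_mem ?_ _)
  · rw [← neg_sub]
    exact neg_mem (uniFilt_mono (by omega) (shift_sub_mem_uniFilt (T0_mem hM _ _)))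
  · exact uniFilt_mono (by norm_num)
      (mul_mem_uniFilt (shift_mem_uniFilt (T0_mem hM (neg a) (neg i))) (T0_mem hM a j))

variable (M) in
/-- The leading term of `[t_{ij}(u), t_{kl}(v)]`: the first part. -/
def ell1 (i j k l : Idx τ n) : A⟦X⟧ := delta k j * T0 M i l - delta i l * T0 M k j

variable (M) in
/-- The leading term of `[t_{ij}(u), t_{kl}(v)]`: the second part. -/
def ell2 (i j k l : Idx τ n) : A⟦X⟧ :=
  (if l = neg j then theta τ i j • T0 M k (neg i) else 0) -
    (if k = neg i then theta τ i j • T0 M (neg j) l else 0)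

theorem delta_mul_mem {e : ℤ} {g : A⟦X⟧} (h : g ∈ uniFilt M e) (i j : Idx τ n) :
    delta i j * g ∈ uniFilt M e := by
  rw [delta_mul]
  split_ifs
  · exact h
  · exact zero_mem _

theorem ell2_mem (hM : Solution M) (i j k l : Idx τ n) : ell2 M i j k l ∈ uniFilt M (-1) := by
  rw [ell2]
  refine sub_mem ?_ ?_
  · split_ifs
    · exact zsmul_mem (T0_mem hM _ _) _
    · exact zero_mem _
  · split_ifs
    · exact zsmul_mem (T0_mem hM _ _) _
    · exact zero_mem _

/-- The double series `x y (ℓ(v) - ℓ(u)) / (y - x)`. -/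
def divided (g : A⟦X⟧) : A⟦X⟧⟦X⟧ :=
  PowerSeries.mk fun s => PowerSeries.mk fun r =>
    if r = 0 ∨ s = 0 then 0 else coeff (r + s - 1) g

theorem coeff_divided (g : A⟦X⟧) (r s : ℕ) : coeff r (coeff s (divided g)) =
    if r = 0 ∨ s = 0 then 0 else coeff (r + s - 1) g := by
  rw [divided, coeff_mk, coeff_mk]

/-- Coefficientwise this is `(y - x) ∑ x^{a+1} y^{b+1} = x y (y^m - x^m)`, summed over `a + b = m -
1`. -/
theorem denP_mul_divided {g : A⟦X⟧} (h0 : coeff 0 g = 0) :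
    denP _ * divided g = uInv _ * (vInv _ * (atV g - atU g)) := by
  ext s r
  have hU : ∀ G : A⟦X⟧⟦X⟧, coeff 0 (coeff s (uInv _ * G)) = 0 := by
    intro G
    rw [uInv, coeff_C_mul, coeff_zero_X_mul]
  rcases s with _ | s
  · rw [denP, sub_mul, map_sub, map_sub, vInv, uInv, coeff_zero_X_mul, coeff_C_mul, coeff_C_mul,
      coeff_zero_X_mul, mul_zero]
    have : coeff 0 (divided g) = 0 := by
      ext r
      rw [coeff_divided, if_pos (Or.inr rfl), map_zero]
    rw [this]
    simp
  · rcases r with _ | r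
    · rw [hU, denP, sub_mul, map_sub, map_sub, hU, vInv, coeff_succ_X_mul, coeff_divided]
      simp
    · rw [coeff_denP_mul, coeff_divided, coeff_divided, uInv, vInv, coeff_C_mul, coeff_succ_X_mul,
        coeff_succ_X_mul, map_sub, map_sub, atV, atU, PowerSeries.coeff_map, coeff_C, coeff_C]
      rcases r with _ | r
      · rcases s with _ | s
        · simp [h0]
        · simp
      · rcases s with _ | s
        · simp
        · simp only [Nat.add_eq_zero_iff, one_ne_zero, and_false, or_self, if_false]
          rw [show r + 1 + 1 + (s + 1) - 1 = r + s + 2 by omega,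
            show r + 1 + (s + 1 + 1) - 1 = r + s + 2 by omega]
          simp

theorem T0_atU_mul_atV_mem (hM : Solution M) (i j k l : Idx τ n) :
    atU (T0 M i j) * atV (T0 M k l) ∈ biFilt M (-2) :=
  biFilt_mono (by norm_num) (atU_mul_atV_mem (T0_mem hM i j) (T0_mem hM k l))

theorem T0_atV_mul_atU_mem (hM : Solution M) (i j k l : Idx τ n) :
    atV (T0 M i j) * atU (T0 M k l) ∈ biFilt M (-2) :=
  biFilt_mono (by norm_num) (atV_mul_atU_mem (T0_mem hM k l) (T0_mem hM i j))

/-- After inserting `M = δ + T0` the constants cancel, the linear terms are those of `ell1`, and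
only the quadratic ones remain. -/
theorem commutator_first (hM : Solution M) (i j k l : Idx τ n) :
    atU (M k j) * atV (M i l) - atV (M k j) * atU (M i l)
      - (atV (ell1 M i j k l) - atU (ell1 M i j k l)) ∈ biFilt M (-2) := by
  have e : atU (M k j) * atV (M i l) - atV (M k j) * atU (M i l)
      - (atV (ell1 M i j k l) - atU (ell1 M i j k l)) =
      atU (T0 M k j) * atV (T0 M i l) - atV (T0 M k j) * atU (T0 M i l) := by
    rw [T_eq M, T_eq M, ell1]
    by_cases h : k = j <;> by_cases h' : i = l <;> simp only [delta, h, h', if_true, if_false,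
      map_add, map_sub, map_one, map_zero, one_mul, zero_mul, zero_add, mul_add, add_mul, mul_one]
    · abel
    · abel
    · abel
    · abel
  rw [e]
  exact sub_mem (T0_atU_mul_atV_mem hM _ _ _ _)
    (T0_atV_mul_atU_mem hM _ _ _ _)

theorem commutator_second_left (hM : Solution M) (i j l : Idx τ n) :
    ∑ a, theta τ i a • (atU (M a j) * atV (M (neg a) l)) -
      (if l = neg j then theta τ i j • 1 else 0) - theta τ i j • atV (T0 M (neg j) l)
      - theta τ i (neg l) • atU (T0 M (neg l) j) ∈ biFilt M (-2) := by
  have hd : ∀ a, (delta (neg a) l : A⟦X⟧) = delta (neg l) a := by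
    intro a
    have : neg a = l ↔ neg l = a := by rw [neg_eq_iff, eq_comm]
    simp only [delta, this]
  have e : ∑ a, theta τ i a • (atU (M a j) * atV (M (neg a) l)) -
      (if l = neg j then theta τ i j • 1 else 0) - theta τ i j • atV (T0 M (neg j) l)
      - theta τ i (neg l) • atU (T0 M (neg l) j) =
      ∑ a, theta τ i a • (atU (T0 M a j) * atV (T0 M (neg a) l)) := by
    have h1 : ∀ a, atU (M a j) * atV (M (neg a) l) =
        (if a = j then (if l = neg j then 1 else 0) else 0) +
        (if a = j then atV (T0 M (neg j) l) else 0) +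
        (if neg l = a then atU (T0 M (neg l) j) else 0) + atU (T0 M a j) * atV (T0 M (neg a) l) := by
      intro a
      rw [T_eq M, T_eq M, hd]
      have h2 : l = neg j ↔ neg l = j := neg_eq_iff.symm
      simp only [h2]
      by_cases h : a = j
      · subst h
        by_cases h' : neg l = a
        · subst h'
          simp only [delta, if_true, map_add, map_one, neg_neg']
          simp only [mul_add, add_mul, one_mul, mul_one]
          abel
        · simp only [delta, if_true, if_neg h', map_add, map_one, map_zero]
          simp only [mul_add, add_mul, one_mul, mul_zero, zero_add]
          abel
      · by_cases h' : neg l = a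
        · subst h'
          simp only [delta, if_true, if_neg h, map_add, map_one, map_zero, neg_neg']
          simp only [mul_add, zero_mul, mul_one, zero_add]
        · simp only [delta, if_neg h', if_neg h, map_add, map_zero, zero_add]
    simp only [h1, smul_add, Finset.sum_add_distrib, smul_ite, smul_zero, Finset.sum_ite_eq,
      Finset.sum_ite_eq', Finset.mem_univ, if_true]
    abel
  rw [e]
  exact sum_mem fun a _ => zsmul_mem (T0_atU_mul_atV_mem hM _ _ _ _) _

theorem commutator_second_right (hM : Solution M) (i j k : Idx τ n) :
    ∑ a, theta τ a j • (atV (M k (neg a)) * atU (M i a)) -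
      (if k = neg i then theta τ i j • 1 else 0) - theta τ i j • atV (T0 M k (neg i))
      - theta τ (neg k) j • atU (T0 M i (neg k)) ∈ biFilt M (-2) := by
  have e : ∑ a, theta τ a j • (atV (M k (neg a)) * atU (M i a)) -
      (if k = neg i then theta τ i j • 1 else 0) - theta τ i j • atV (T0 M k (neg i))
      - theta τ (neg k) j • atU (T0 M i (neg k)) =
      ∑ a, theta τ a j • (atV (T0 M k (neg a)) * atU (T0 M i a)) := by
    have h1 : ∀ a, atV (M k (neg a)) * atU (M i a) =
        (if i = a then (if k = neg i then 1 else 0) else 0) +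
        (if i = a then atV (T0 M k (neg i)) else 0) +
        (if neg k = a then atU (T0 M i (neg k)) else 0) + atV (T0 M k (neg a)) * atU (T0 M i a) := by
      intro a
      rw [T_eq M, T_eq M]
      have h3 : k = neg a ↔ neg k = a := neg_eq_iff.symm
      by_cases h : i = a
      · subst h
        by_cases h' : neg k = i
        · have h4 := h3.2 h'
          simp only [delta, if_pos h4, if_pos h', if_true, map_add, map_one]
          simp only [mul_add, add_mul, one_mul, mul_one, h']
          abel
        · have h4 := fun h => h' (h3.1 h)
          simp only [delta, if_neg h4, if_neg h', if_true, map_add, map_one, map_zero]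
          simp only [mul_add, mul_one, zero_add, add_zero]
      · by_cases h' : neg k = a
        · have h4 := h3.2 h'
          simp only [delta, if_pos h4, if_pos h', if_neg h, map_add, map_one, map_zero]
          simp only [add_mul, one_mul, zero_add, h']
        · have h4 := fun h => h' (h3.1 h)
          simp only [delta, if_neg h4, if_neg h', if_neg h, map_add, map_zero, zero_add]
    simp only [h1, smul_add, Finset.sum_add_distrib, smul_ite, smul_zero, Finset.sum_ite_eq,
      Finset.sum_ite_eq', Finset.mem_univ, if_true]
    abel
  rw [e]
  exact sum_mem fun a _ => zsmul_mem (T0_atV_mul_atU_mem hM _ _ _ _) _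

end Leading

/-! ### The leading term of a commutator of two generators -/

section Commutators

variable {τ : ClassicalType} {n : ℕ} {A : Type} [Ring A] [Algebra ℂ A]
  {M : Matrix (Idx τ n) (Idx τ n) A⟦X⟧}

theorem atU_zsmul (a : ℤ) (g : A⟦X⟧) : atU (a • g) = a • atU g :=
  map_zsmul _ a g

theorem atV_zsmul (a : ℤ) (g : A⟦X⟧) : atV (a • g) = a • atV g :=
  map_zsmul (PowerSeries.map (PowerSeries.C : A →+* A⟦X⟧)) a g

/-- The terms linear in `T0(u)` come with the wrong indices; `relation_z` trades `T0` at `(-l, j)`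
for minus `θ` times `T0` at `(-j, l)`, and likewise on the right. The multiples of `z0` that arise
cancel, since they occur only if both index conditions hold. -/
theorem commutator_second (hM : Solution M) (i j k l : Idx τ n) :
    (if k = neg i then ∑ a, theta τ i a • (atU (M a j) * atV (M (neg a) l)) else 0) -
      (if l = neg j then ∑ a, theta τ a j • (atV (M k (neg a)) * atU (M i a)) else 0) +
      (atV (ell2 M i j k l) - atU (ell2 M i j k l)) ∈ biFilt M (-2) := by
  have h1 := commutator_second_left hM i j l
  have h2 := commutator_second_right hM i j k
  have h3 := zsmul_mem (atU_mem (relation_z hM (neg l) j)) (theta τ i (neg l))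
  have h4 := zsmul_mem (atU_mem (relation_z hM i (neg k))) (theta τ (neg k) j)
  have hl : l = neg j ↔ neg l = j := neg_eq_iff.symm
  have hk : k = neg i ↔ i = neg k := by rw [eq_comm, neg_eq_iff]
  have e1 : theta τ i (neg l) * theta τ (neg l) j = theta τ i j := theta_mul _ _ _
  have e2 : theta τ (neg k) j * theta τ i (neg k) = theta τ i j := by
    rw [mul_comm]; exact theta_mul _ _ _
  have aU : ∀ g h : A⟦X⟧, atU (g + h) = atU g + atU h := fun g h => map_add _ g h
  have sU : ∀ g h : A⟦X⟧, atU (g - h) = atU g - atU h := fun g h => map_sub _ g h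
  simp only [aU, sU, atU_zsmul, smul_add, smul_sub, smul_smul, e1, e2, neg_neg', delta] at h3 h4
  have z1 : atU (0 : A⟦X⟧) = 0 := map_zero _
  have z2 : atV (0 : A⟦X⟧) = 0 := map_zero _
  have sV : ∀ g h : A⟦X⟧, atV (g - h) = atV g - atV h := fun g h => map_sub (PowerSeries.map _) g h
  by_cases ck : k = neg i <;> by_cases cl : l = neg j
  · rw [if_pos (hl.1 cl), one_mul] at h3
    rw [if_pos (hk.1 ck), one_mul] at h4
    have e3 : theta τ i (neg l) = theta τ i j := by rw [hl.1 cl]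
    have e4 : theta τ (neg k) j = theta τ i j := by rw [← hk.1 ck]
    rw [if_pos cl] at h1
    rw [if_pos ck] at h2
    have := sub_mem (add_mem h1 h3) (add_mem h2 h4)
    simp only [ell2, if_pos ck, if_pos cl, sU, sV, atU_zsmul, atV_zsmul, e3, e4] at this ⊢
    convert this using 1
    abel
  · rw [if_neg (fun h => cl (hl.2 h)), zero_mul, z1, smul_zero, sub_zero] at h3
    rw [if_neg cl] at h1
    have := add_mem h1 h3
    simp only [ell2, if_pos ck, if_neg cl, sU, sV, atU_zsmul, atV_zsmul, z1, z2] at this ⊢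
    convert this using 1
    abel
  · rw [if_neg (fun h => ck (hk.2 h)), zero_mul, z1, smul_zero, sub_zero] at h4
    rw [if_neg ck] at h2
    have := neg_mem (add_mem h2 h4)
    simp only [ell2, if_neg ck, if_pos cl, sU, sV, atU_zsmul, atV_zsmul, z1, z2] at this ⊢
    convert this using 1
    abel
  · simp only [ell2, if_neg ck, if_neg cl, sU, sV, z1, z2, sub_zero, add_zero]
    exact zero_mem _

theorem divided_mem {e : ℤ} {g : A⟦X⟧} (h : g ∈ uniFilt M e) : divided g ∈ biFilt M (e - 2) := by
  intro r s
  rw [coeff_divided]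
  split_ifs with h0
  · exact zero_mem _
  · exact filt_mono (by omega) (h (r + s - 1))

/-- In leading order both denominators act as `u - v`, so each part of the commutator is its linear
part divided by `u - v`. Replacing `u - v - κ` by `u - v` in the `Q` part costs one further term, of
still lower degree. -/
theorem commutator_mem (hM : Solution M) (i j k l : Idx τ n) :
    atU (M i j) * atV (M k l) - atV (M k l) * atU (M i j)
      - (divided (ell1 M i j k l) + divided (ell2 M i j k l)) ∈ biFilt M (-4) := by
  have h0 : ∀ g : A⟦X⟧, coeff 0 (divided g) = 0 := by
    intro g
    ext r
    rw [coeff_divided, if_pos (Or.inr rfl), map_zero]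
  have c1 : coeff 0 (ell1 M i j k l) = 0 := by
    rw [ell1, map_sub, delta_mul, delta_mul]
    split_ifs <;> simp only [coeff_zero_T0 hM, map_zero, sub_zero]
  have c2 : coeff 0 (ell2 M i j k l) = 0 := by
    rw [ell2, map_sub]
    split_ifs <;> simp only [map_zsmul, coeff_zero_T0 hM, map_zero, sub_zero, smul_zero]
  set d1 := divided (ell1 M i j k l) with hd1
  set d2 := divided (ell2 M i j k l) with hd2
  set W := atU (M i j) * atV (M k l) - atV (M k l) * atU (M i j) with hW
  have w0 : coeff 0 (W - (d1 + d2)) = 0 := by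
    ext r
    rw [map_sub, map_add, h0, h0, add_zero, sub_zero, hW, map_sub, map_sub, coeff_atU_mul_atV,
      coeff_atV_mul_atU, hM.coeff_zero k l]
    split_ifs <;> simp
  have w1 : coeff 0 (denQ τ n A * (W - (d1 + d2))) = 0 := by
    rw [coeff_mul, Finset.Nat.antidiagonal_zero, Finset.sum_singleton, w0, mul_zero]
  -- Each division raises the degree bound by two, so the product with both denominators has to be
  -- bounded by `-8`.
  refine mem_of_denQ_mul_mem w0 (mem_of_denP_mul_mem w1 ?_)
  have hr := rtt_entry hM.rtt i j k l
  set E1 := atU (M k j) * atV (M i l) - atV (M k j) * atU (M i l) with hE1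
  obtain ⟨f1, hf1, m1⟩ : ∃ f, E1 = (atV (ell1 M i j k l) - atU (ell1 M i j k l)) + f ∧
      f ∈ biFilt M (-2) := ⟨_, (add_sub_cancel _ _).symm, commutator_first hM i j k l⟩
  have h2 := commutator_second hM i j k l
  set E2 := (if k = neg i then ∑ a, theta τ i a • (atU (M a j) * atV (M (neg a) l)) else 0) -
      (if l = neg j then ∑ a, theta τ a j • (atV (M k (neg a)) * atU (M i a)) else 0) with hE2
  obtain ⟨f2, hf2, m2⟩ : ∃ f, E2 = f - (atV (ell2 M i j k l) - atU (ell2 M i j k l)) ∧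
      f ∈ biFilt M (-2) := ⟨_, (add_sub_cancel_right _ _).symm, h2⟩
  have k1 := denP_mul_divided c1
  have k2 := denP_mul_divided c2
  rw [← hd1] at k1
  rw [← hd2] at k2
  have cQ : ∀ G : A⟦X⟧⟦X⟧, denQ τ n A * G = denP A * G - kappaC τ n A * (uInv A * (vInv A * G)) := by
    intro G
    rw [denQ_eq, sub_mul, mul_assoc, mul_assoc]
  have key : denP A * (denQ τ n A * (W - (d1 + d2))) =
      uInv A * (vInv A * (denQ τ n A * f1)) - uInv A * (vInv A * (denP A * f2)) +
        denP A * (kappaC τ n A * (uInv A * (vInv A * d2))) := by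
    have a1 : uInv A * vInv A * denQ τ n A * (atV (ell1 M i j k l) - atU (ell1 M i j k l)) =
        denP A * (denQ τ n A * d1) := by
      rw [← mul_assoc (denP A), (denP_comm (denQ τ n A)).eq, mul_assoc (denQ τ n A), k1,
        ← mul_assoc (uInv A), ← mul_assoc (denQ τ n A), (denQ_comm (uInv A * vInv A)).eq]
    have a2 : uInv A * vInv A * denP A * (atV (ell2 M i j k l) - atU (ell2 M i j k l)) =
        denP A * (denP A * d2) := by
      rw [k2, ← mul_assoc (uInv A), ← mul_assoc (denP A), (denP_comm (uInv A * vInv A)).eq]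
    have a3 : denP A * (denP A * d2) = denP A * (denQ τ n A * d2) +
        denP A * (kappaC τ n A * (uInv A * (vInv A * d2))) := by
      rw [cQ d2, mul_sub, sub_add_cancel]
    have e3 : denP A * (denQ τ n A * (W - (d1 + d2))) =
        denP A * denQ τ n A * W - denP A * (denQ τ n A * d1) - denP A * (denQ τ n A * d2) := by
      simp only [mul_sub, mul_add, mul_assoc]
      abel
    rw [e3, hr, hf1, hf2, mul_add, mul_sub (uInv A * vInv A * denP A), a1, a2, a3]
    simp only [mul_assoc]
    abel
  rw [key]
  refine add_mem (sub_mem ?_ ?_) ?_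
  · exact uInv_mul_mem (biFilt_mono (by norm_num) (vInv_mul_mem (denQ_mul_mem m1)))
  · exact uInv_mul_mem (biFilt_mono (by norm_num) (vInv_mul_mem (denP_mul_mem m2)))
  · refine denP_mul_mem (biFilt_mono (by norm_num) (kappaC_mul_mem (uInv_mul_mem (vInv_mul_mem
      (divided_mem (ell2_mem hM i j k l))))))

/-- The listed terms have degree `2 (r + s) + 1`, one less than the sum of the weights. So
commutators drop the degree, and the top part that survives is linear in the generators. -/
theorem gen_commutator (hM : Solution M) (i j k l : Idx τ n) (r s : ℕ) :
    gen M (i, j, r) * gen M (k, l, s) - gen M (k, l, s) * gen M (i, j, r) -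
      ((if k = j then gen M (i, l, r + s) else 0) - (if i = l then gen M (k, j, r + s) else 0) +
        ((if l = neg j then theta τ i j • gen M (k, neg i, r + s) else 0) -
          (if k = neg i then theta τ i j • gen M (neg j, l, r + s) else 0)))
      ∈ filt M (2 * (r + s)) := by
  have h := commutator_mem hM i j k l (r + 1) (s + 1)
  rw [map_sub, map_sub, map_sub, map_sub, map_add, map_add, coeff_atU_mul_atV, coeff_atV_mul_atU,
    coeff_divided, coeff_divided, if_neg (by omega), if_neg (by omega),
    show r + 1 + (s + 1) - 1 = r + s + 1 by omega, ell1, ell2, map_sub, map_sub, delta_mul,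
    delta_mul, apply_ite (coeff (r + s + 1)), apply_ite (coeff (r + s + 1)),
    apply_ite (coeff (r + s + 1)), apply_ite (coeff (r + s + 1)), map_zsmul, map_zsmul,
    coeff_succ_T0, coeff_succ_T0, coeff_succ_T0, coeff_succ_T0, map_zero] at h
  exact filt_mono (by push_cast; omega) h

end Commutators

/-! ### Symbols -/

section Symbols

variable {τ : ClassicalType} {n : ℕ} {A : Type} [Ring A] [Algebra ℂ A]
  {M : Matrix (Idx τ n) (Idx τ n) A⟦X⟧}

/-- The polynomial algebra in which the symbols live: a variable for every generator and for every
coefficient of `z(u)`. -/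
abbrev Poly (τ : ClassicalType) (n : ℕ) : Type := MvPolynomial (Gen τ n ⊕ ℕ) ℂ

/-- The symbol of a generator. -/
def sigma (g : Gen τ n) : Poly τ n :=
  MvPolynomial.X (Sum.inl g) -
    theta τ g.1 g.2.1 • MvPolynomial.X (Sum.inl (neg g.2.1, neg g.1, g.2.2)) +
    if g.1 = g.2.1 then MvPolynomial.X (Sum.inr g.2.2) else 0

/-- The symbol of a word. -/
def sword (L : List (Gen τ n)) : Poly τ n := (L.map sigma).prod

theorem sword_nil : sword ([] : List (Gen τ n)) = 1 := rfl

theorem sword_cons (g : Gen τ n) (L : List (Gen τ n)) : sword (g :: L) = sigma g * sword L := by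
  simp [sword]

variable (M) in
/-- The pairs of an element of degree `e` and its symbol. -/
def symbol (e : ℤ) : Submodule ℂ (A × Poly τ n) :=
  Submodule.span ℂ ({p | p.1 ∈ filt M (e - 1) ∧ p.2 = 0} ∪
    {p | ∃ L : List (Gen τ n), (wtL L : ℤ) = e ∧ p = (word M L, sword L)})

theorem symbol_of_lower {e : ℤ} {x : A} (h : x ∈ filt M (e - 1)) : (x, 0) ∈ symbol M e :=
  Submodule.subset_span (Or.inl ⟨h, rfl⟩)

theorem symbol_word (L : List (Gen τ n)) : (word M L, sword L) ∈ symbol M (wtL L) :=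
  Submodule.subset_span (Or.inr ⟨L, rfl, rfl⟩)

theorem symbol_gen (g : Gen τ n) : (gen M g, sigma g) ∈ symbol M (wt g) := by
  have := symbol_word (M := M) [g]
  simpa [word_cons, word_nil, sword_cons, sword_nil, wtL_cons, wtL_nil] using this

theorem fst_mem_of_symbol {e : ℤ} {p : A × Poly τ n} (h : p ∈ symbol M e) : p.1 ∈ filt M e := by
  induction h using Submodule.span_induction with
  | mem p hp =>
    rcases hp with ⟨h, -⟩ | ⟨L, hL, rfl⟩
    · exact filt_mono (by omega) h
    · exact word_mem hL.le
  | zero => exact zero_mem _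
  | add p q _ _ h h' => exact add_mem h h'
  | smul c p _ h => exact Submodule.smul_mem _ _ h

theorem exists_symbol {e : ℤ} {x : A} (h : x ∈ filt M e) : ∃ q, (x, q) ∈ symbol M e := by
  induction h using Submodule.span_induction with
  | mem x hx =>
    obtain ⟨L, hL, rfl⟩ := hx
    rcases hL.lt_or_eq with h | h
    · exact ⟨0, symbol_of_lower (word_mem (by omega))⟩
    · exact ⟨_, h ▸ symbol_word L⟩
  | zero => exact ⟨0, zero_mem _⟩
  | add x y _ _ h h' =>
    obtain ⟨q, hq⟩ := h
    obtain ⟨q', hq'⟩ := h'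
    exact ⟨q + q', add_mem hq hq'⟩
  | smul c x _ h =>
    obtain ⟨q, hq⟩ := h
    exact ⟨c • q, Submodule.smul_mem _ c hq⟩

theorem symbol_cast {a b : ℤ} {p : A × Poly τ n} (h : p ∈ symbol M a) (hab : a = b) :
    p ∈ symbol M b := hab ▸ h

theorem symbol_add_lower {e : ℤ} {x y : A} {q : Poly τ n} (h : (x, q) ∈ symbol M e)
    (hy : y - x ∈ filt M (e - 1)) : (y, q) ∈ symbol M e := by
  have := add_mem h (symbol_of_lower hy)
  rwa [Prod.mk_add_mk, add_sub_cancel, add_zero] at this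

theorem symbol_mul {a b : ℤ} {p q : A × Poly τ n} (hp : p ∈ symbol M a) (hq : q ∈ symbol M b) :
    p * q ∈ symbol M (a + b) := by
  have hq1 := fst_mem_of_symbol hq
  induction hp using Submodule.span_induction with
  | mem p hp =>
    rcases hp with ⟨h, h0⟩ | ⟨L, hL, rfl⟩
    · have : p * q = (p.1 * q.1, 0) := Prod.ext rfl (by rw [Prod.snd_mul, h0, zero_mul])
      rw [this]
      exact symbol_of_lower (mul_mem_filt' h hq1 (by omega))
    · induction hq using Submodule.span_induction with
      | mem q hq =>
        rcases hq with ⟨h, h0⟩ | ⟨L', hL', rfl⟩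
        · have : (word M L, sword L) * q = (word M L * q.1, 0) :=
            Prod.ext rfl (by rw [Prod.snd_mul, h0, mul_zero])
          rw [this]
          exact symbol_of_lower (mul_mem_filt' (word_mem hL.le) h (by omega))
        · have := symbol_word (M := M) (L ++ L')
          rw [word_append, wtL_append] at this
          have h2 : sword (L ++ L') = sword L * sword L' := by simp [sword]
          rw [h2] at this
          exact symbol_cast this (by push_cast; omega)
      | zero => rw [mul_zero]; exact zero_mem _
      | add q q' h1 h2 h h' =>
        rw [mul_add]
        exact add_mem (h (fst_mem_of_symbol h1)) (h' (fst_mem_of_symbol h2))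
      | smul c q h1 h =>
        rw [mul_smul_comm]
        exact Submodule.smul_mem _ c (h (fst_mem_of_symbol h1))
  | zero => rw [zero_mul]; exact zero_mem _
  | add p p' _ _ h h' => rw [add_mul]; exact add_mem h h'
  | smul c p _ h => rw [smul_mul_assoc]; exact Submodule.smul_mem _ c h

theorem constantCoeff_of_symbol {e : ℤ} (he : 0 < e) {p : A × Poly τ n} (h : p ∈ symbol M e) :
    MvPolynomial.constantCoeff p.2 = 0 := by
  induction h using Submodule.span_induction with
  | mem p hp =>
    rcases hp with ⟨-, h⟩ | ⟨L, hL, rfl⟩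
    · rw [h, map_zero]
    · cases L with
      | nil => rw [wtL_nil] at hL; simp at hL; omega
      | cons g L =>
        have : MvPolynomial.constantCoeff (sigma g) = 0 := by
          rw [sigma, map_add, map_sub, map_zsmul]
          split_ifs <;> simp
        rw [sword_cons, map_mul, this, zero_mul]
  | zero => exact map_zero _
  | add p q _ _ h h' => rw [Prod.snd_add, map_add, h, h', add_zero]
  | smul c p _ h => rw [Prod.smul_snd, MvPolynomial.smul_eq_C_mul, map_mul, h, mul_zero]

variable (M) in
/-- A linear map that is, up to lower terms, a derivation of degree `s`, with a given symbol. -/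
structure HasSymbol (δ : A →ₗ[ℂ] A) (D : Derivation ℂ (Poly τ n) (Poly τ n)) (s : ℤ) : Prop where
  mul : ∀ (a b : ℤ) (x y : A), x ∈ filt M a → y ∈ filt M b →
    δ (x * y) - (x * δ y + δ x * y) ∈ filt M (a + b + s - 1)
  gen : ∀ g, (δ (gen M g), D (sigma g)) ∈ symbol M (wt g + s)

/-- The Leibniz rule is applied letter by letter on both sides; its defect in the algebra is below
the degree that a symbol sees. -/
theorem HasSymbol.word {δ : A →ₗ[ℂ] A} {D : Derivation ℂ (Poly τ n) (Poly τ n)} {s : ℤ}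
    (h : HasSymbol M δ D s) (L : List (Gen τ n)) :
    (δ (word M L), D (sword L)) ∈ symbol M (wtL L + s) := by
  induction L with
  | nil =>
    have h1 := h.mul 0 0 1 1 (one_mem_filt le_rfl) (one_mem_filt le_rfl)
    rw [one_mul, one_mul, mul_one, sub_add_cancel_left, neg_mem_iff] at h1
    rw [word_nil, sword_nil, D.map_one_eq_zero]
    exact symbol_of_lower (filt_mono (by rw [wtL_nil]; push_cast; omega) h1)
  | cons g L ih =>
    have h1 := symbol_mul (symbol_gen (M := M) g) ih
    have h2 := symbol_mul (h.gen g) (symbol_word (M := M) L)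
    have h3 := h.mul _ _ _ _ (gen_mem g) (word_mem (M := M) (L := L) le_rfl)
    have h4 := add_mem (symbol_cast h1 (b := wtL (g :: L) + s) (by rw [wtL_cons]; push_cast; ring))
      (symbol_cast h2 (by rw [wtL_cons]; push_cast; ring))
    rw [word_cons, sword_cons]
    rw [Prod.mk_mul_mk, Prod.mk_mul_mk, Prod.mk_add_mk] at h4
    have h5 : D (sigma g * sword L) = sigma g * D (sword L) + D (sigma g) * sword L := by
      rw [D.leibniz, smul_eq_mul, smul_eq_mul, mul_comm (sword L)]
    rw [h5]
    refine symbol_add_lower h4 (filt_mono ?_ h3)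
    rw [wtL_cons]
    push_cast
    omega

theorem HasSymbol.mem {δ : A →ₗ[ℂ] A} {D : Derivation ℂ (Poly τ n) (Poly τ n)} {s : ℤ}
    (h : HasSymbol M δ D s) {e : ℤ} {x : A} (hx : x ∈ filt M e) : δ x ∈ filt M (e + s) := by
  induction hx using Submodule.span_induction with
  | mem x hx =>
    obtain ⟨L, hL, rfl⟩ := hx
    exact filt_mono (by omega) (fst_mem_of_symbol (h.word L))
  | zero => rw [map_zero]; exact zero_mem _
  | add x y _ _ h h' => rw [map_add]; exact add_mem h h'
  | smul c x _ h => rw [map_smul]; exact Submodule.smul_mem _ c h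

theorem HasSymbol.apply {δ : A →ₗ[ℂ] A} {D : Derivation ℂ (Poly τ n) (Poly τ n)} {s : ℤ}
    (h : HasSymbol M δ D s) {e : ℤ} {p : A × Poly τ n} (hp : p ∈ symbol M e) :
    (δ p.1, D p.2) ∈ symbol M (e + s) := by
  induction hp using Submodule.span_induction with
  | mem p hp =>
    rcases hp with ⟨h1, h0⟩ | ⟨L, hL, rfl⟩
    · rw [h0, map_zero]
      exact symbol_of_lower (filt_mono (by omega) (h.mem h1))
    · exact symbol_cast (h.word L) (by rw [hL])
  | zero =>
    rw [Prod.fst_zero, Prod.snd_zero, map_zero, map_zero]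
    exact zero_mem _
  | add p q _ _ h h' =>
    have := add_mem h h'
    rwa [Prod.mk_add_mk, ← map_add, ← map_add] at this
  | smul c p _ h =>
    have := Submodule.smul_mem _ c h
    rwa [Prod.smul_mk, ← map_smul, ← D.map_smul] at this

theorem symbol_of_neg {e : ℤ} (he : e < 0) {p : A × Poly τ n} (h : p ∈ symbol M e) : p = 0 := by
  induction h using Submodule.span_induction with
  | mem p hp =>
    rcases hp with ⟨h1, h0⟩ | ⟨L, hL, rfl⟩
    · rw [filt_of_neg (by omega)] at h1
      exact Prod.ext h1 h0
    · omega
  | zero => rfl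
  | add p q _ _ h h' => rw [h, h', add_zero]
  | smul c p _ h => rw [h, smul_zero]

theorem symbol_zero {p : A × Poly τ n} (h : p ∈ symbol M 0) : ∃ c : ℂ, p = c • 1 := by
  induction h using Submodule.span_induction with
  | mem p hp =>
    rcases hp with ⟨h1, h0⟩ | ⟨L, hL, rfl⟩
    · rw [filt_of_neg (by omega)] at h1
      exact ⟨0, by rw [zero_smul]; exact Prod.ext h1 h0⟩
    · rw [eq_nil_of_wtL (by omega : wtL L = 0)]
      exact ⟨1, by rw [one_smul, word_nil, sword_nil]; rfl⟩
  | zero => exact ⟨0, by rw [zero_smul]⟩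
  | add p q _ _ h h' =>
    obtain ⟨c, rfl⟩ := h
    obtain ⟨d, rfl⟩ := h'
    exact ⟨c + d, by rw [add_smul]⟩
  | smul a p _ h =>
    obtain ⟨c, rfl⟩ := h
    exact ⟨a * c, by rw [mul_smul]⟩

theorem eq_C_of_pderiv_eq_zero {ι : Type} {q : MvPolynomial ι ℂ}
    (h : ∀ v, MvPolynomial.pderiv v q = 0) : q = MvPolynomial.C (MvPolynomial.constantCoeff q) := by
  classical
  ext m
  rw [MvPolynomial.coeff_C]
  split_ifs with hm
  · rw [← hm]; rfl
  · obtain ⟨v, hv⟩ : ∃ v, m v ≠ 0 := by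
      by_contra! h'
      exact hm (Finsupp.ext fun v => (h' v).symm)
    -- Lowering the exponent of `v` by one multiplies the coefficient by a positive integer, which
    -- is invertible in `ℂ`.
    have h1 := congrArg (MvPolynomial.coeff (m - Finsupp.single v 1)) (h v)
    rw [MvPolynomial.coeff_pderiv, MvPolynomial.coeff_zero] at h1
    have h2 : m - Finsupp.single v 1 + Finsupp.single v 1 = m := by
      ext w
      by_cases hw : w = v
      · subst hw
        simp
        omega
      · simp [Finsupp.single_apply, Ne.symm hw]
    rw [h2, mul_eq_zero] at h1
    rcases h1 with h1 | h1
    · exact h1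
    · exfalso
      norm_cast at h1

/-- The degree of a variable. -/
def wtV : Gen τ n ⊕ ℕ → ℕ
  | Sum.inl g => wt g
  | Sum.inr r => 2 * r + 1

theorem wtV_pos (v : Gen τ n ⊕ ℕ) : 0 < wtV v := by
  cases v <;> simp [wtV, wt]

variable (M) in
/-- All partial derivatives are symbols. -/
def Separated : Prop :=
  ∀ v : Gen τ n ⊕ ℕ, ∃ δ : A →ₗ[ℂ] A, HasSymbol M δ (MvPolynomial.pderiv v) (-(wtV v : ℤ))

/-- This is the Poincaré–Birkhoff–Witt theorem. A separating operator turns `(0, q)` into `(0, ∂_v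
q)` in smaller degree, so by induction `q` is constant, and symbols of positive degree have no
constant term. Degree zero needs `1 ≠ 0` in the algebra. -/
theorem symbol_unique [Nontrivial A] (hM : Separated M) (e : ℕ) {q : Poly τ n}
    (h : (0, q) ∈ symbol M e) : q = 0 := by
  induction e using Nat.strong_induction_on generalizing q with
  | _ e ih =>
    rcases Nat.eq_zero_or_pos e with rfl | he
    · obtain ⟨c, hc⟩ := symbol_zero h
      have h1 : c • (1 : A) = 0 := (congrArg Prod.fst hc).symm
      rcases smul_eq_zero.1 h1 with rfl | h1
      · rw [zero_smul] at hc
        exact congrArg Prod.snd hc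
      · exact absurd h1 one_ne_zero
    · have h1 : ∀ v, MvPolynomial.pderiv v q = 0 := by
        intro v
        obtain ⟨δ, hδ⟩ := hM v
        have h2 := hδ.apply h
        rw [map_zero] at h2
        have h3 := wtV_pos v
        by_cases hv : wtV v ≤ e
        · exact ih (e - wtV v) (by omega) (symbol_cast h2 (by push_cast [hv]; ring))
        · exact congrArg Prod.snd (symbol_of_neg (by omega) h2)
      rw [eq_C_of_pderiv_eq_zero h1, constantCoeff_of_symbol (by exact_mod_cast he) h, map_zero]

end Symbols

/-! ### Elements with a given symbol -/

section Evaluation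

variable {τ : ClassicalType} {n : ℕ} {A : Type} [Ring A] [Algebra ℂ A]
  {M : Matrix (Idx τ n) (Idx τ n) A⟦X⟧}

theorem commutator_gen_mem (hM : Solution M) (g h : Gen τ n) :
    gen M g * gen M h - gen M h * gen M g ∈ filt M (wt g + wt h - 1) := by
  obtain ⟨i, j, r⟩ := g
  obtain ⟨k, l, s⟩ := h
  have h1 := gen_commutator hM i j k l r s
  have h2 : ∀ a b : Idx τ n, gen M (a, b, r + s) ∈ filt M (2 * (r + s) + 1) := fun a b =>
    filt_mono (by simp only [wt]; push_cast; omega) (gen_mem (a, b, r + s))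
  have h3 : ((if k = j then gen M (i, l, r + s) else 0) -
      (if i = l then gen M (k, j, r + s) else 0) +
        ((if l = neg j then theta τ i j • gen M (k, neg i, r + s) else 0) -
          (if k = neg i then theta τ i j • gen M (neg j, l, r + s) else 0))) ∈
      filt M (2 * (r + s) + 1) := by
    refine add_mem (sub_mem ?_ ?_) (sub_mem ?_ ?_)
    · split_ifs
      exacts [h2 _ _, zero_mem _]
    · split_ifs
      exacts [h2 _ _, zero_mem _]
    · split_ifs
      exacts [zsmul_mem (h2 _ _) _, zero_mem _]
    · split_ifs
      exacts [zsmul_mem (h2 _ _) _, zero_mem _]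
  have h4 := add_mem (filt_mono (by omega) h1) h3
  rw [sub_add_cancel] at h4
  exact filt_mono (by simp only [wt]; push_cast; omega) h4

theorem commutator_gen_word_mem (hM : Solution M) (g : Gen τ n) (L : List (Gen τ n)) :
    gen M g * word M L - word M L * gen M g ∈ filt M (wt g + wtL L - 1) := by
  induction L with
  | nil => rw [word_nil, one_mul, mul_one, sub_self]; exact zero_mem _
  | cons h L ih =>
    have e : gen M g * word M (h :: L) - word M (h :: L) * gen M g =
        (gen M g * gen M h - gen M h * gen M g) * word M L +
          gen M h * (gen M g * word M L - word M L * gen M g) := by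
      rw [word_cons]
      simp only [sub_mul, mul_sub, mul_assoc]
      abel
    rw [e, wtL_cons]
    exact add_mem (mul_mem_filt' (commutator_gen_mem hM g h) (word_mem le_rfl)
      (by push_cast; omega)) (mul_mem_filt' (gen_mem h) ih (by push_cast; omega))

theorem commutator_word_mem (hM : Solution M) (L L' : List (Gen τ n)) :
    word M L * word M L' - word M L' * word M L ∈ filt M (wtL L + wtL L' - 1) := by
  induction L with
  | nil => rw [word_nil, one_mul, mul_one, sub_self]; exact zero_mem _
  | cons h L ih =>
    have e : word M (h :: L) * word M L' - word M L' * word M (h :: L) =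
        gen M h * (word M L * word M L' - word M L' * word M L) +
          (gen M h * word M L' - word M L' * gen M h) * word M L := by
      rw [word_cons]
      simp only [sub_mul, mul_sub, mul_assoc]
      abel
    rw [e, wtL_cons]
    exact add_mem (mul_mem_filt' (gen_mem h) ih (by push_cast; omega))
      (mul_mem_filt' (commutator_gen_word_mem hM h L') (word_mem le_rfl) (by push_cast; omega))

/-- The commutator lowers the degree. -/
theorem commutator_mem_filt (hM : Solution M) {a b : ℤ} {x y : A} (hx : x ∈ filt M a)
    (hy : y ∈ filt M b) : x * y - y * x ∈ filt M (a + b - 1) := by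
  induction hx using Submodule.span_induction with
  | mem x hx =>
    obtain ⟨L, hL, rfl⟩ := hx
    induction hy using Submodule.span_induction with
    | mem y hy =>
      obtain ⟨L', hL', rfl⟩ := hy
      exact filt_mono (by omega) (commutator_word_mem hM L L')
    | zero => rw [mul_zero, zero_mul, sub_zero]; exact zero_mem _
    | add y y' _ _ h h' =>
      rw [mul_add, add_mul, add_sub_add_comm]
      exact add_mem h h'
    | smul c y _ h =>
      rw [mul_smul_comm, smul_mul_assoc, ← smul_sub]
      exact Submodule.smul_mem _ c h
  | zero => rw [mul_zero, zero_mul, sub_zero]; exact zero_mem _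
  | add x x' _ _ h h' =>
    rw [mul_add, add_mul, add_sub_add_comm]
    exact add_mem h h'
  | smul c x _ h =>
    rw [mul_smul_comm, smul_mul_assoc, ← smul_sub]
    exact Submodule.smul_mem _ c h

variable (M) in
/-- The coefficients of `z(u)`. -/
def zc (r : ℕ) : A := coeff (r + 1) (zSeries M)

theorem coeff_succ_z0 (r : ℕ) : coeff (r + 1) (z0 M) = zc M r := by
  rw [z0, map_sub, zc, coeff_one, if_neg (by omega), sub_zero]

theorem relation_zc (hM : Solution M) (i j : Idx τ n) (r : ℕ) :
    gen M (i, j, r) + theta τ i j • gen M (neg j, neg i, r) - (if i = j then zc M r else 0) ∈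
      filt M (2 * r) := by
  have h := relation_z hM i j (r + 1)
  rw [delta_mul, map_sub, map_add, map_zsmul, coeff_succ_T0, coeff_succ_T0,
    apply_ite (coeff (r + 1)), coeff_succ_z0, map_zero] at h
  exact filt_mono (by push_cast; omega) h

theorem zc_mem (hM : Solution M) (r : ℕ) : zc M r ∈ filt M (2 * r + 1) := by
  obtain ⟨o⟩ := idx_nonempty (τ := τ) hM.pos
  have h := relation_zc hM o o r
  rw [if_pos rfl] at h
  have h1 : ∀ a b : Idx τ n, gen M (a, b, r) ∈ filt M (2 * r + 1) := fun a b =>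
    filt_mono (by simp only [wt]; push_cast; omega) (gen_mem (a, b, r))
  have h2 := sub_mem (add_mem (h1 o o) (zsmul_mem (h1 (neg o) (neg o)) (theta τ o o)))
    (filt_mono (by omega) h)
  rwa [sub_sub_cancel] at h2

variable (M) in
/-- The elements that replace the variables. -/
def evVar : Gen τ n ⊕ ℕ → A
  | Sum.inl g => (2⁻¹ : ℂ) • (gen M g - if g.1 = g.2.1 then (2⁻¹ : ℂ) • zc M g.2.2 else 0)
  | Sum.inr r => (2⁻¹ : ℂ) • zc M r

theorem evVar_mem (hM : Solution M) (v : Gen τ n ⊕ ℕ) : evVar M v ∈ filt M (wtV v) := by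
  rcases v with g | r
  · refine Submodule.smul_mem _ _ (sub_mem (gen_mem g) ?_)
    split_ifs
    · exact Submodule.smul_mem _ _ (filt_mono (by simp [wtV, wt]) (zc_mem hM g.2.2))
    · exact zero_mem _
  · exact Submodule.smul_mem _ _ (filt_mono (by simp [wtV]) (zc_mem hM r))

variable (M) in
/-- The elements with given symbols: a monomial is sent to an ordered product. -/
def ev : Poly τ n →ₗ[ℂ] A :=
  (MvPolynomial.basisMonomials (Gen τ n ⊕ ℕ) ℂ).constr ℂ fun m =>
    (m.toMultiset.toList.map (evVar M)).prod

theorem ev_monomial (m : Gen τ n ⊕ ℕ →₀ ℕ) :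
    ev M (MvPolynomial.monomial m 1) = (m.toMultiset.toList.map (evVar M)).prod := by
  have := (MvPolynomial.basisMonomials (Gen τ n ⊕ ℕ) ℂ).constr_basis ℂ
    (fun m => (m.toMultiset.toList.map (evVar M)).prod) m
  rwa [MvPolynomial.coe_basisMonomials] at this

/-- The degree of a list of variables. -/
def wtVL (V : List (Gen τ n ⊕ ℕ)) : ℕ := (V.map wtV).sum

theorem prod_evVar_mem (hM : Solution M) (V : List (Gen τ n ⊕ ℕ)) :
    (V.map (evVar M)).prod ∈ filt M (wtVL V) := by
  induction V with
  | nil => exact one_mem_filt (by simp [wtVL])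
  | cons v V ih =>
    rw [List.map_cons, List.prod_cons]
    exact mul_mem_filt' (evVar_mem hM v) ih (by simp [wtVL])

/-- As commutators lower the degree, the arbitrary order of factors chosen in `ev` does not matter
up to lower terms. -/
theorem prod_evVar_perm (hM : Solution M) {V W : List (Gen τ n ⊕ ℕ)} (h : V.Perm W) :
    (V.map (evVar M)).prod - (W.map (evVar M)).prod ∈ filt M (wtVL V - 1) := by
  induction h with
  | nil => rw [sub_self]; exact zero_mem _
  | cons v h ih =>
    rw [List.map_cons, List.map_cons, List.prod_cons, List.prod_cons, ← mul_sub]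
    exact mul_mem_filt' (evVar_mem hM v) ih (by simp [wtVL, add_sub_assoc])
  | swap v w V =>
    have e : ((w :: v :: V).map (evVar M)).prod - ((v :: w :: V).map (evVar M)).prod =
        (evVar M w * evVar M v - evVar M v * evVar M w) * (V.map (evVar M)).prod := by
      simp [sub_mul, mul_assoc]
    rw [e]
    exact mul_mem_filt' (commutator_mem_filt hM (evVar_mem hM w) (evVar_mem hM v))
      (prod_evVar_mem hM V) (by simp [wtVL]; omega)
  | trans h h' ih ih' =>
    have := add_mem ih (filt_mono (by
      rw [wtVL, wtVL, (h.map wtV).sum_eq]) ih')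
    rwa [sub_add_sub_cancel] at this

theorem ev_prod (hM : Solution M) (V : List (Gen τ n ⊕ ℕ)) :
    (V.map (evVar M)).prod - ev M (V.map MvPolynomial.X).prod ∈ filt M (wtVL V - 1) := by
  classical
  have h : ((V.map MvPolynomial.X).prod : Poly τ n) =
      MvPolynomial.monomial (Multiset.toFinsupp (V : Multiset (Gen τ n ⊕ ℕ))) 1 := by
    induction V with
    | nil => simp
    | cons v V ih =>
      rw [List.map_cons, List.prod_cons, ih, MvPolynomial.X, MvPolynomial.monomial_mul, one_mul,
        ← Multiset.cons_coe, ← Multiset.singleton_add, map_add, Multiset.toFinsupp_singleton]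
  rw [h, ev_monomial]
  refine prod_evVar_perm hM (Multiset.coe_eq_coe.1 ?_)
  rw [Multiset.coe_toList, Multiset.toFinsupp_toMultiset]

variable (M) in
/-- The pairs of an element of degree `e` and its symbol, in terms of the variables. -/
def symbolV (e : ℤ) : Submodule ℂ (A × Poly τ n) :=
  Submodule.span ℂ ({p | p.1 ∈ filt M (e - 1) ∧ p.2 = 0} ∪
    {p | ∃ V : List (Gen τ n ⊕ ℕ), (wtVL V : ℤ) = e ∧
      p = ((V.map (evVar M)).prod, (V.map MvPolynomial.X).prod)})

theorem symbolV_var (v : Gen τ n ⊕ ℕ) : (evVar M v, MvPolynomial.X v) ∈ symbolV M (wtV v) :=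
  Submodule.subset_span (Or.inr ⟨[v], by simp [wtVL], by simp⟩)

theorem symbolV_sub_ev (hM : Solution M) {e : ℤ} {p : A × Poly τ n} (h : p ∈ symbolV M e) :
    p.1 - ev M p.2 ∈ filt M (e - 1) := by
  induction h using Submodule.span_induction with
  | mem p hp =>
    rcases hp with ⟨h, h0⟩ | ⟨V, hV, rfl⟩
    · rw [h0, map_zero, sub_zero]
      exact h
    · rw [← hV]
      exact ev_prod hM V
  | zero => rw [Prod.fst_zero, Prod.snd_zero, map_zero, sub_zero]; exact zero_mem _
  | add p q _ _ h h' =>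
    rw [Prod.fst_add, Prod.snd_add, map_add, add_sub_add_comm]
    exact add_mem h h'
  | smul c p _ h =>
    rw [Prod.smul_fst, Prod.smul_snd, map_smul, ← smul_sub]
    exact Submodule.smul_mem _ c h

theorem fst_mem_of_symbolV (hM : Solution M) {e : ℤ} {p : A × Poly τ n} (h : p ∈ symbolV M e) :
    p.1 ∈ filt M e := by
  induction h using Submodule.span_induction with
  | mem p hp =>
    rcases hp with ⟨h, -⟩ | ⟨L, hL, rfl⟩
    · exact filt_mono (by omega) h
    · exact hL ▸ prod_evVar_mem hM L
  | zero => exact zero_mem _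
  | add p q _ _ h h' => exact add_mem h h'
  | smul c p _ h => exact Submodule.smul_mem _ _ h

theorem symbolV_mul (hM : Solution M) {a b : ℤ} {p q : A × Poly τ n} (hp : p ∈ symbolV M a)
    (hq : q ∈ symbolV M b) : p * q ∈ symbolV M (a + b) := by
  have hq1 := fst_mem_of_symbolV hM hq
  induction hp using Submodule.span_induction with
  | mem p hp =>
    rcases hp with ⟨h, h0⟩ | ⟨L, hL, rfl⟩
    · have : p * q = (p.1 * q.1, 0) := Prod.ext rfl (by rw [Prod.snd_mul, h0, zero_mul])
      rw [this]
      exact Submodule.subset_span (Or.inl ⟨mul_mem_filt' h hq1 (by omega), rfl⟩)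
    · induction hq using Submodule.span_induction with
      | mem q hq =>
        rcases hq with ⟨h, h0⟩ | ⟨L', hL', rfl⟩
        · refine Submodule.subset_span (Or.inl ⟨?_, ?_⟩)
          · exact mul_mem_filt' (hL ▸ prod_evVar_mem hM L) h (by omega)
          · rw [Prod.snd_mul, h0, mul_zero]
        · refine Submodule.subset_span (Or.inr ⟨L ++ L', ?_, ?_⟩)
          · rw [← hL, ← hL']; simp [wtVL]
          · simp
      | zero => rw [mul_zero]; exact zero_mem _
      | add q q' h1 h2 h h' =>
        rw [mul_add]
        exact add_mem (h (fst_mem_of_symbolV hM h1)) (h' (fst_mem_of_symbolV hM h2))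
      | smul c q h1 h =>
        rw [mul_smul_comm]
        exact Submodule.smul_mem _ c (h (fst_mem_of_symbolV hM h1))
  | zero => rw [zero_mul]; exact zero_mem _
  | add p p' _ _ h h' => rw [add_mul]; exact add_mem h h'
  | smul c p _ h => rw [smul_mul_assoc]; exact Submodule.smul_mem _ c h

/-- This explains the halves in `evVar`: substituting into `sigma` gives half of `t_{ij} - θ_{ij}
t_{-j,-i} + δ_{ij} z`, and by `relation_zc` this is `t_{ij}` up to lower terms. -/
theorem symbolV_gen (hM : Solution M) (g : Gen τ n) :
    (gen M g, sigma g) ∈ symbolV M (wt g) := by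
  obtain ⟨i, j, r⟩ := g
  have h1 : _ ∈ symbolV M (wt ((i, j, r) : Gen τ n)) := symbolV_var (M := M) (Sum.inl (i, j, r))
  have h2 := zsmul_mem (symbolV_var (M := M) (Sum.inl (neg j, neg i, r))) (theta τ i j)
  have h3 := symbolV_var (M := M) (τ := τ) (n := n) (Sum.inr r)
  have h4 := relation_zc hM i j r
  have h5 : ((if i = j then evVar M (Sum.inr r) else 0 : A),
      (if i = j then MvPolynomial.X (Sum.inr r) else 0 : Poly τ n)) ∈
        symbolV M (wt ((i, j, r) : Gen τ n)) := by
    split_ifs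
    · exact h3
    · exact zero_mem _
  have h6 : ((2⁻¹ : ℂ) • (gen M (i, j, r) + theta τ i j • gen M (neg j, neg i, r) -
      (if i = j then zc M r else 0)), (0 : Poly τ n)) ∈ symbolV M (wt ((i, j, r) : Gen τ n)) :=
    Submodule.subset_span (Or.inl ⟨Submodule.smul_mem _ _ (filt_mono (by simp [wt]) h4), rfl⟩)
  have h7 := add_mem (add_mem (sub_mem h1 h2) h5) h6
  convert h7 using 1
  refine Prod.ext ?_ ?_
  · simp only [Prod.fst_add, Prod.fst_sub, Prod.smul_fst, evVar]
    by_cases h : i = j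
    · subst h
      simp only [if_true, theta_self, one_smul]
      module
    · have h' : neg j ≠ neg i := fun h' => h (neg_injective h').symm
      simp only [if_neg h, if_neg h', sub_zero, add_zero, smul_add, smul_sub]
      rw [smul_comm (theta τ i j) (2⁻¹ : ℂ)]
      module
  · simp only [Prod.snd_add, Prod.snd_sub, Prod.smul_snd, sigma, add_zero]

theorem symbol_le_symbolV (hM : Solution M) (e : ℤ) : symbol M e ≤ symbolV M e := by
  refine Submodule.span_le.2 ?_
  rintro p (h | ⟨L, hL, rfl⟩)
  · exact Submodule.subset_span (Or.inl h)
  · rw [← hL]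
    clear hL
    induction L with
    | nil => exact Submodule.subset_span (Or.inr ⟨[], by simp [wtVL, wtL], rfl⟩)
    | cons g L ih =>
      have := symbolV_mul hM (symbolV_gen hM g) ih
      rw [wtL_cons, Nat.cast_add]
      exact this

/-- An element is determined by its symbol up to lower terms. -/
theorem sub_ev_mem (hM : Solution M) {e : ℤ} {x : A} {q : Poly τ n} (h : (x, q) ∈ symbol M e) :
    x - ev M q ∈ filt M (e - 1) :=
  symbolV_sub_ev hM (symbol_le_symbolV hM e h)

theorem mem_lower_of_symbol (hM : Solution M) {e : ℤ} {x : A} (h : (x, 0) ∈ symbol M e) :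
    x ∈ filt M (e - 1) := by
  have := sub_ev_mem hM h
  rwa [map_zero, sub_zero] at this

end Evaluation

/-! ### The operators that come from the vector representation -/

section VectorRepresentation

variable {τ : ClassicalType} {n : ℕ} {A : Type} [Ring A] [Algebra ℂ A]
  {M : Matrix (Idx τ n) (Idx τ n) A⟦X⟧}

variable (τ n A) in
/-- Scalars in the tensor product of `A` with `(End V)[c]`. -/
def leftIncl : A →ₐ[ℂ] Matrix (Idx τ n) (Idx τ n) (Polynomial A) :=
  (Matrix.scalarAlgHom (Idx τ n) ℂ).comp Polynomial.CAlgHom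

variable (τ n A) in
/-- `(End V)[c]` in its tensor product with `A`. -/
def rightIncl : Matrix (Idx τ n) (Idx τ n) (Polynomial ℂ) →ₐ[ℂ]
    Matrix (Idx τ n) (Idx τ n) (Polynomial A) :=
  (Polynomial.mapAlgHom (Algebra.ofId ℂ A)).mapMatrix

theorem leftIncl_apply (x : A) :
    leftIncl τ n A x = Matrix.diagonal fun _ => Polynomial.C x := rfl

theorem rightIncl_apply (x : Matrix (Idx τ n) (Idx τ n) (Polynomial ℂ)) (a b : Idx τ n) :
    rightIncl τ n A x a b = (x a b).map (algebraMap ℂ A) := rfl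

theorem coeff_rightIncl (x : Matrix (Idx τ n) (Idx τ n) (Polynomial ℂ)) (a b : Idx τ n) (m : ℕ) :
    (rightIncl τ n A x a b).coeff m = algebraMap ℂ A ((x a b).coeff m) := by
  rw [rightIncl_apply, Polynomial.coeff_map]

theorem leftIncl_mul_apply (x : A) (y : Matrix (Idx τ n) (Idx τ n) (Polynomial A)) (a b : Idx τ n) :
    (leftIncl τ n A x * y) a b = Polynomial.C x * y a b := by
  rw [leftIncl_apply, Matrix.diagonal_mul]

theorem mul_leftIncl_apply (x : A) (y : Matrix (Idx τ n) (Idx τ n) (Polynomial A)) (a b : Idx τ n) :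
    (y * leftIncl τ n A x) a b = y a b * Polynomial.C x := by
  rw [leftIncl_apply, Matrix.mul_diagonal]

theorem leftIncl_rightIncl_commute (x : A) (y : Matrix (Idx τ n) (Idx τ n) (Polynomial ℂ)) :
    Commute (leftIncl τ n A x) (rightIncl τ n A y) := by
  show _ = _
  ext a b m
  rw [leftIncl_mul_apply, mul_leftIncl_apply, Polynomial.coeff_C_mul, Polynomial.coeff_mul_C,
    coeff_rightIncl, Algebra.commutes]

variable (M) in
/-- The image of `T(u)` under the coproduct and the vector representation. -/
def coprod : Matrix (Idx τ n) (Idx τ n) (Matrix (Idx τ n) (Idx τ n) (Polynomial A))⟦X⟧ :=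
  M.map (PowerSeries.map (leftIncl τ n A : A →+* _)) *
    (vecRep τ n).map (PowerSeries.map (rightIncl τ n A : _ →+* _))

theorem coprod_commute : EntriesCommute (M.map (PowerSeries.map (leftIncl τ n A : A →+* _)))
    ((vecRep τ n).map (PowerSeries.map (rightIncl τ n A : Matrix (Idx τ n) (Idx τ n) (Polynomial ℂ) →+*
      Matrix (Idx τ n) (Idx τ n) (Polynomial A)))) := by
  intro i j k l r s
  rw [Matrix.map_apply, Matrix.map_apply, PowerSeries.coeff_map, PowerSeries.coeff_map]
  exact leftIncl_rightIncl_commute _ _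

theorem rtt_coprod (hM : Solution M) : rttLeft (coprod M) = rttRight (coprod M) :=
  rtt_mul (rtt_map _ hM.rtt) (rtt_map _ (rtt_vecRep τ n)) coprod_commute

/-- The coefficients of the vector representation. -/
def vecCoeff (p j a b : Idx τ n) (s m : ℕ) : ℂ := ((coeff s (vecRep τ n p j)) a b).coeff m

theorem vecCoeff_zero (p j a b : Idx τ n) (m : ℕ) :
    vecCoeff p j a b 0 m = if p = j ∧ a = b ∧ m = 0 then 1 else 0 := by
  rw [vecCoeff, vecRep, coeff_mk, Matrix.of_apply, coeff_zero_geom, coeff_zero_geom, coeff_zero_one]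
  by_cases h : p = j ∧ a = b
  · rw [if_pos h]
    by_cases hm : m = 0 <;> simp [h, hm, Polynomial.coeff_one]
  · rw [if_neg h, if_neg (fun h' : p = j ∧ a = b ∧ m = 0 => h ⟨h'.1, h'.2.1⟩)]
    simp

theorem natDegree_cShift_pow (s : ℕ) : (cShift τ n ^ s).natDegree ≤ s := by
  refine (Polynomial.natDegree_pow_le).trans ?_
  rw [cShift, Polynomial.natDegree_X_add_C, mul_one]

/-- The coefficient of `u^{-s-1}` in `1 / (u - c)` or `1 / (u - c - κ)` is a polynomial in `c` of
degree `s`. -/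
theorem vecCoeff_succ_of_lt (p j a b : Idx τ n) {s m : ℕ} (h : s < m) :
    vecCoeff p j a b (s + 1) m = 0 := by
  rw [vecCoeff, vecRep, coeff_mk, Matrix.of_apply, coeff_succ_geom, coeff_succ_geom, coeff_one]
  have h1 : (cShift τ n ^ s).coeff m = 0 :=
    Polynomial.coeff_eq_zero_of_natDegree_lt ((natDegree_cShift_pow s).trans_lt h)
  rw [if_neg (by omega : ¬ s + 1 = 0), ite_self, Polynomial.coeff_add, Polynomial.coeff_sub]
  split_ifs <;> simp [Polynomial.coeff_X_pow, h.ne', h1]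

theorem coeff_cShift_pow_self (s : ℕ) : (cShift τ n ^ s).coeff s = 1 := by
  have h : (cShift τ n).Monic := Polynomial.monic_X_add_C _
  have := (h.pow s).coeff_natDegree
  rwa [h.natDegree_pow, cShift, Polynomial.natDegree_X_add_C, mul_one, ← cShift] at this

/-- The top coefficient is that of `-P + Q`, since `c^s` and `(c + κ)^s` are both monic in `c`. -/
theorem vecCoeff_succ_self (p j a b : Idx τ n) (s : ℕ) :
    vecCoeff p j a b (s + 1) s =
      -(if j = a ∧ p = b then 1 else 0) + if a = neg p ∧ b = neg j then (theta τ p j : ℂ) else 0 := by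
  rw [vecCoeff, vecRep, coeff_mk, Matrix.of_apply, coeff_succ_geom, coeff_succ_geom, coeff_one,
    if_neg (by omega : ¬ s + 1 = 0), ite_self, Polynomial.coeff_add, Polynomial.coeff_sub]
  congr 1
  · split_ifs <;> simp [Polynomial.coeff_X_pow]
  · split_ifs
    · rw [← zsmul_eq_mul, Polynomial.coeff_smul, coeff_cShift_pow_self, zsmul_one]
    · simp

variable (Θ : A →ₐ[ℂ] Matrix (Idx τ n) (Idx τ n) (Polynomial A))

/-- The coefficients of `Θ(x) - x`. -/
def vecDiff (a b : Idx τ n) (m : ℕ) : A →ₗ[ℂ] A where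
  toFun x := ((Θ x - leftIncl τ n A x) a b).coeff m
  map_add' x y := by
    rw [map_add, map_add, add_sub_add_comm, Matrix.add_apply, Polynomial.coeff_add]
  map_smul' c x := by
    rw [map_smul, map_smul, ← smul_sub, Matrix.smul_apply, Polynomial.coeff_smul, RingHom.id_apply]

theorem vecDiff_apply (a b : Idx τ n) (m : ℕ) (x : A) :
    vecDiff Θ a b m x = ((Θ x - leftIncl τ n A x) a b).coeff m := rfl

/-- For a homomorphism `Θ` the difference `Θ - 1` fails to be a derivation exactly by the product of
two differences, and these lower the degree twice. -/
theorem vecDiff_mul (a b : Idx τ n) (m : ℕ) (x y : A) :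
    vecDiff Θ a b m (x * y) - (x * vecDiff Θ a b m y + vecDiff Θ a b m x * y) =
      ∑ p, ∑ q ∈ Finset.HasAntidiagonal.antidiagonal m,
        vecDiff Θ a p q.1 x * vecDiff Θ p b q.2 y := by
  have e : Θ (x * y) - leftIncl τ n A (x * y) =
      leftIncl τ n A x * (Θ y - leftIncl τ n A y) + (Θ x - leftIncl τ n A x) * leftIncl τ n A y +
        (Θ x - leftIncl τ n A x) * (Θ y - leftIncl τ n A y) := by
    rw [map_mul, map_mul]
    noncomm_ring
  simp only [vecDiff_apply]
  rw [e, Matrix.add_apply, Matrix.add_apply, Polynomial.coeff_add, Polynomial.coeff_add,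
    leftIncl_mul_apply, mul_leftIncl_apply, Polynomial.coeff_C_mul, Polynomial.coeff_mul_C,
    add_sub_cancel_left, Matrix.mul_apply, Polynomial.finsetSum_coeff]
  simp only [Polynomial.coeff_mul]

variable {Θ}

theorem coeff_theta (hΘ : M.map (PowerSeries.map (Θ : A →+* _)) = coprod M) (i j a b : Idx τ n)
    (R m : ℕ) : ((Θ (coeff R (M i j))) a b).coeff m =
      ∑ q ∈ Finset.HasAntidiagonal.antidiagonal R,
        ∑ p, vecCoeff p j a b q.2 m • coeff q.1 (M i p) := by
  have h := congrArg (coeff R) (congrFun (congrFun hΘ i) j)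
  rw [Matrix.map_apply, PowerSeries.coeff_map, coprod, Matrix.mul_apply, map_sum] at h
  simp only [coeff_mul, Matrix.map_apply, PowerSeries.coeff_map, RingHom.coe_coe] at h
  rw [h, Finset.sum_comm, Matrix.sum_apply, Polynomial.finsetSum_coeff]
  refine Finset.sum_congr rfl fun q _ => ?_
  rw [Matrix.sum_apply, Polynomial.finsetSum_coeff]
  refine Finset.sum_congr rfl fun p _ => ?_
  rw [leftIncl_mul_apply, Polynomial.coeff_C_mul, coeff_rightIncl, ← Algebra.commutes,
    ← Algebra.smul_def]
  rfl

/-- The constant term of `R(u - c)` is the identity; its contribution is the subtracted `leftIncl`,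
which accounts for the shift in `q.2 + 1`. -/
theorem vecDiff_coeff (hΘ : M.map (PowerSeries.map (Θ : A →+* _)) = coprod M) (i j a b : Idx τ n)
    (R m : ℕ) : vecDiff Θ a b m (coeff (R + 1) (M i j)) =
      ∑ q ∈ Finset.HasAntidiagonal.antidiagonal R,
        ∑ p, vecCoeff p j a b (q.2 + 1) m • coeff q.1 (M i p) := by
  rw [vecDiff_apply, Matrix.sub_apply, Polynomial.coeff_sub, coeff_theta hΘ,
    Finset.Nat.sum_antidiagonal_succ', leftIncl_apply, Matrix.diagonal_apply]
  simp only [vecCoeff_zero]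
  rw [add_comm, add_sub_assoc, add_eq_left, sub_eq_zero]
  rw [Finset.sum_eq_single j]
  · by_cases hab : a = b <;> by_cases hm : m = 0 <;> simp [hab, hm, Polynomial.coeff_C]
  · intro p _ hp
    simp [hp]
  · simp

theorem coeff_mem_lower (hM : Solution M) (i j : Idx τ n) (r : ℕ) {e : ℤ} (h : 2 * (r : ℤ) - 1 ≤ e)
    (h0 : 0 ≤ e) : coeff r (M i j) ∈ filt M e := by
  rcases r with _ | r
  · rw [hM.coeff_zero]
    split_ifs
    · exact one_mem_filt h0
    · exact zero_mem _
  · exact filt_mono (by simp only [wt]; push_cast at h ⊢; omega) (gen_mem (i, j, r))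

/-- The bound is one below `2 (r - m)`, the degree a symbol would have, so for `m < r` the symbol is
zero. -/
theorem vecDiff_gen_of_gt (hM : Solution M) (hΘ : M.map (PowerSeries.map (Θ : A →+* _)) = coprod M)
    (i j a b : Idx τ n) {r m : ℕ} (h : m < r) :
    vecDiff Θ a b m (gen M (i, j, r)) ∈ filt M (2 * (r : ℤ) - 2 * m - 1) := by
  rw [gen, vecDiff_coeff hΘ]
  refine sum_mem fun q hq => sum_mem fun p _ => ?_
  have hq' : q.1 + q.2 = r := by simpa using hq
  by_cases hm : q.2 < m
  · rw [vecCoeff_succ_of_lt _ _ _ _ hm, zero_smul]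
    exact zero_mem _
  · exact Submodule.smul_mem _ _ (coeff_mem_lower hM _ _ _ (by omega) (by omega))

theorem vecDiff_gen_of_lt (hΘ : M.map (PowerSeries.map (Θ : A →+* _)) = coprod M)
    (i j a b : Idx τ n) {r m : ℕ} (h : r < m) : vecDiff Θ a b m (gen M (i, j, r)) = 0 := by
  rw [gen, vecDiff_coeff hΘ]
  refine Finset.sum_eq_zero fun q hq => Finset.sum_eq_zero fun p _ => ?_
  have hq' : q.1 + q.2 = r := by simpa using hq
  rw [vecCoeff_succ_of_lt _ _ _ _ (by omega), zero_smul]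

/-- The power `c^r` occurs only with `u^{-r-1}` taken entirely from `R(u - c)`, so `T(u)`
contributes just its constant term `1`. -/
theorem vecDiff_gen_self (hM : Solution M) (hΘ : M.map (PowerSeries.map (Θ : A →+* _)) = coprod M)
    (i j a b : Idx τ n) (r : ℕ) : vecDiff Θ a b r (gen M (i, j, r)) =
      (-(if j = a ∧ i = b then 1 else 0) +
        if a = neg i ∧ b = neg j then (theta τ i j : ℂ) else 0) • (1 : A) := by
  rw [gen, vecDiff_coeff hΘ, Finset.sum_eq_single (0, r)]
  · rw [Finset.sum_eq_single i]
    · simp only [hM.coeff_zero, if_true, vecCoeff_succ_self]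
    · intro p _ hp
      simp only [hM.coeff_zero, if_neg (Ne.symm hp), smul_zero]
    · simp
  · rintro ⟨q1, q2⟩ hq hne
    refine Finset.sum_eq_zero fun p _ => ?_
    have hq' : q1 + q2 = r := by simpa using hq
    have : q2 < r := by
      by_contra h
      exact hne (Prod.ext (show q1 = 0 by omega) (show q2 = r by omega))
    rw [vecCoeff_succ_of_lt _ _ _ _ this, zero_smul]
  · simp

theorem vecDiff_gen_mem (hM : Solution M) (hΘ : M.map (PowerSeries.map (Θ : A →+* _)) = coprod M)
    (g : Gen τ n) (a b : Idx τ n) (m : ℕ) :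
    vecDiff Θ a b m (gen M g) ∈ filt M ((wt g : ℤ) - 2 * m - 1) := by
  obtain ⟨i, j, r⟩ := g
  rcases lt_trichotomy r m with h | rfl | h
  · rw [vecDiff_gen_of_lt hΘ _ _ _ _ h]
    exact zero_mem _
  · rw [vecDiff_gen_self hM hΘ]
    exact Submodule.smul_mem _ _ (one_mem_filt (by simp only [wt]; push_cast; omega))
  · exact filt_mono (by simp only [wt]; push_cast; omega) (vecDiff_gen_of_gt hM hΘ i j a b h)

theorem vecDiff_mem (hM : Solution M) (hΘ : M.map (PowerSeries.map (Θ : A →+* _)) = coprod M)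
    {e : ℤ} {x : A} (hx : x ∈ filt M e) (a b : Idx τ n) (m : ℕ) :
    vecDiff Θ a b m x ∈ filt M (e - 2 * m - 1) := by
  induction hx using Submodule.span_induction with
  | mem x hx =>
    obtain ⟨L, hL, rfl⟩ := hx
    refine filt_mono (show (wtL L : ℤ) - 2 * m - 1 ≤ e - 2 * m - 1 by omega) ?_
    clear hL
    induction L generalizing a b m with
    | nil =>
      rw [word_nil, vecDiff_apply, map_one, map_one, sub_self]
      exact zero_mem _
    | cons g L ih =>
      rw [word_cons, sub_eq_iff_eq_add.1 (vecDiff_mul Θ a b m _ _), wtL_cons]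
      refine add_mem (sum_mem fun p _ => sum_mem fun q hq => ?_) (add_mem ?_ ?_)
      · have hq' : q.1 + q.2 = m := by simpa using hq
        exact mul_mem_filt' (vecDiff_gen_mem hM hΘ g a p q.1) (ih p b q.2) (by push_cast; omega)
      · exact mul_mem_filt' (gen_mem g) (ih a b m) (by push_cast; omega)
      · exact mul_mem_filt' (vecDiff_gen_mem hM hΘ g a b m) (word_mem le_rfl) (by push_cast; omega)
  | zero => rw [map_zero]; exact zero_mem _
  | add x y _ _ h h' => rw [map_add]; exact add_mem h h'
  | smul c x _ h => rw [map_smul]; exact Submodule.smul_mem _ c h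

theorem pderiv_inl_sigma (b a i j : Idx τ n) (m r : ℕ) :
    MvPolynomial.pderiv (Sum.inl (b, a, m)) (sigma (i, j, r)) =
      if r = m then ((if j = a ∧ i = b then 1 else 0 : ℂ) -
        if a = neg i ∧ b = neg j then (theta τ i j : ℂ) else 0) • 1 else 0 := by
  classical
  have h1 : MvPolynomial.pderiv (Sum.inl (b, a, m))
      (if i = j then MvPolynomial.X (Sum.inr r) else 0 : Poly τ n) = 0 := by
    split_ifs
    · rw [MvPolynomial.pderiv_X_of_ne (by simp)]
    · exact map_zero _
  rw [sigma, map_add, map_sub, map_zsmul, h1, add_zero, MvPolynomial.pderiv_X,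
    MvPolynomial.pderiv_X]
  by_cases hr : r = m
  · subst hr
    have e1 : ((i, j, r) : Gen τ n) = (b, a, r) ↔ (j = a ∧ i = b) := by
      simp only [Prod.mk.injEq]; tauto
    have e2 : ((neg j, neg i, r) : Gen τ n) = (b, a, r) ↔ (a = neg i ∧ b = neg j) := by
      simp only [Prod.mk.injEq, and_true]
      constructor <;> rintro ⟨h, h'⟩ <;> exact ⟨h'.symm, h.symm⟩
    rw [if_pos rfl, sub_smul]
    congr 1
    · rw [Pi.single_apply]
      simp only [Sum.inl.injEq, eq_comm (a := ((b, a, r) : Gen τ n)), e1]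
      split_ifs <;> simp
    · rw [Pi.single_apply]
      simp only [Sum.inl.injEq, eq_comm (a := ((b, a, r) : Gen τ n)), e2]
      split_ifs
      · rw [Int.cast_smul_eq_zsmul]
      · simp
  · rw [if_neg hr, Pi.single_eq_of_ne (by simp; tauto), Pi.single_eq_of_ne (by simp; tauto),
      smul_zero, sub_zero]

/-- The minus sign and the exchange of `a` and `b` match the leading coefficient of `-P + Q` with
the derivative of `sigma`. The defect of the Leibniz rule lowers the degree by `2 m + 2`, against `2
m + 1` for the operator. -/
theorem hasSymbol_vecDiff (hM : Solution M)
    (hΘ : M.map (PowerSeries.map (Θ : A →+* _)) = coprod M) (b a : Idx τ n) (m : ℕ) :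
    HasSymbol M (-vecDiff Θ a b m) (MvPolynomial.pderiv (Sum.inl (b, a, m)))
      (-(wtV (Sum.inl (b, a, m) : Gen τ n ⊕ ℕ) : ℤ)) where
  mul := by
    intro d e x y hx hy
    have h := vecDiff_mul Θ a b m x y
    rw [LinearMap.neg_apply, LinearMap.neg_apply, LinearMap.neg_apply, mul_neg, neg_mul,
      ← neg_add, ← neg_sub', h]
    refine neg_mem (sum_mem fun p _ => sum_mem fun q hq => ?_)
    have hq' : q.1 + q.2 = m := by simpa using hq
    exact mul_mem_filt' (vecDiff_mem hM hΘ hx a p q.1) (vecDiff_mem hM hΘ hy p b q.2)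
      (by simp only [wtV, wt]; push_cast; omega)
  gen := by
    rintro ⟨i, j, r⟩
    rw [LinearMap.neg_apply, pderiv_inl_sigma]
    rcases lt_trichotomy r m with h | rfl | h
    · rw [vecDiff_gen_of_lt hΘ _ _ _ _ h, if_neg h.ne, neg_zero]
      exact zero_mem _
    · rw [vecDiff_gen_self hM hΘ, if_pos rfl, ← neg_smul, neg_add, neg_neg, ← sub_eq_add_neg]
      have h1 : ((1, 1) : A × Poly τ n) ∈ symbol M 0 := symbol_word (M := M) []
      exact symbol_cast (Submodule.smul_mem _ _ h1) (by simp [wtV, wt])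
    · rw [if_neg h.ne']
      refine symbol_of_lower (neg_mem (filt_mono ?_ (vecDiff_gen_of_gt hM hΘ i j a b h)))
      simp only [wtV, wt]
      push_cast
      omega

end VectorRepresentation

/-! ### The operators that come from the automorphisms `T(u) ↦ f(u) T(u)` -/

section Scaling

variable {τ : ClassicalType} {n : ℕ} {A : Type} [Ring A] [Algebra ℂ A]
  {M : Matrix (Idx τ n) (Idx τ n) A⟦X⟧}

/-- The scalar matrix `1 + η u^{-r-1}`. -/
def scalarSol (τ : ClassicalType) (n r : ℕ) : Matrix (Idx τ n) (Idx τ n) (Polynomial ℂ)⟦X⟧ :=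
  Matrix.diagonal fun _ =>
    1 + PowerSeries.C (Polynomial.X : Polynomial ℂ) * PowerSeries.X ^ (r + 1)

variable (M) in
/-- The matrix `(1 + η u^{-r-1}) T(u)`. -/
def scaledBy (r : ℕ) : Matrix (Idx τ n) (Idx τ n) (Polynomial A)⟦X⟧ :=
  M.map (PowerSeries.map ((Polynomial.CAlgHom : A →ₐ[ℂ] Polynomial A) : A →+* Polynomial A)) *
    (scalarSol τ n r).map (PowerSeries.map
      ((Polynomial.mapAlgHom (Algebra.ofId ℂ A) : Polynomial ℂ →ₐ[ℂ] Polynomial A) :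
        Polynomial ℂ →+* Polynomial A))

theorem C_map_commute (x : A) (y : Polynomial ℂ) : Commute (Polynomial.CAlgHom (R := ℂ) x)
    ((Polynomial.mapAlgHom (Algebra.ofId ℂ A) : Polynomial ℂ →ₐ[ℂ] Polynomial A) y) := by
  show Polynomial.C x * y.map (algebraMap ℂ A) = y.map (algebraMap ℂ A) * Polynomial.C x
  ext m
  rw [Polynomial.coeff_C_mul, Polynomial.coeff_mul_C, Polynomial.coeff_map, Algebra.commutes]

theorem scaledBy_apply (i j : Idx τ n) (r : ℕ) : scaledBy M r i j =
    PowerSeries.map (Polynomial.C : A →+* Polynomial A) (M i j) *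
      (1 + PowerSeries.C (Polynomial.X : Polynomial A) * PowerSeries.X ^ (r + 1)) := by
  rw [scaledBy, Matrix.mul_apply, Finset.sum_eq_single j]
  · rw [Matrix.map_apply, Matrix.map_apply, scalarSol, Matrix.diagonal_apply_eq]
    congr 1
    rw [map_add, map_mul, map_pow, map_one, PowerSeries.map_X, PowerSeries.map_C]
    congr 3
    exact Polynomial.map_X _
  · intro p _ hp
    rw [Matrix.map_apply (M := scalarSol τ n r), scalarSol, Matrix.diagonal_apply_ne _ hp, map_zero,
      mul_zero]
  · simp

theorem coeff_scaledBy (i j : Idx τ n) (r R : ℕ) : coeff R (scaledBy M r i j) =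
    Polynomial.C (coeff R (M i j)) +
      Polynomial.C (if r + 1 ≤ R then coeff (R - (r + 1)) (M i j) else 0) * Polynomial.X := by
  rw [scaledBy_apply, mul_add, mul_one, map_add, PowerSeries.coeff_map, ← mul_assoc,
    coeff_mul_X_pow']
  congr 1
  split_ifs
  · rw [coeff_mul_C, PowerSeries.coeff_map]
  · rw [map_zero, zero_mul]

theorem rtt_scaledBy (hM : Solution M) (r : ℕ) : rttLeft (scaledBy M r) = rttRight (scaledBy M r) := by
  refine rtt_mul (rtt_map _ hM.rtt) (rtt_map _ (rtt_diagonal fun a b => mul_comm _ _)) ?_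
  intro i j k l a b
  rw [Matrix.map_apply, Matrix.map_apply, PowerSeries.coeff_map, PowerSeries.coeff_map]
  exact C_map_commute _ _

/-- The coefficient of `η`. -/
def scaleDer (Φ : A →ₐ[ℂ] Polynomial A) : A →ₗ[ℂ] A where
  toFun x := (Φ x).coeff 1
  map_add' x y := by rw [map_add, Polynomial.coeff_add]
  map_smul' c x := by rw [map_smul, Polynomial.coeff_smul, RingHom.id_apply]

theorem scaleDer_apply (Φ : A →ₐ[ℂ] Polynomial A) (x : A) : scaleDer Φ x = (Φ x).coeff 1 := rfl

theorem word_induction (hex : ∀ x : A, ∃ e : ℕ, x ∈ filt M e) {B : Type} [Ring B] [Algebra ℂ B]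
    {f g : A →ₐ[ℂ] B} (h : ∀ a, f (gen M a) = g (gen M a)) : f = g := by
  ext x
  obtain ⟨e, hx⟩ := hex x
  induction hx using Submodule.span_induction with
  | mem x hx =>
    obtain ⟨L, -, rfl⟩ := hx
    rw [word, map_list_prod, map_list_prod, List.map_map, List.map_map]
    congr 2
    ext a
    exact h a
  | zero => rw [map_zero, map_zero]
  | add x y _ _ h h' => rw [map_add, map_add, h, h']
  | smul c x _ h => rw [map_smul, map_smul, h]

theorem coeff_zero_scale (hex : ∀ x : A, ∃ e : ℕ, x ∈ filt M e) {r : ℕ} {Φ : A →ₐ[ℂ] Polynomial A}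
    (hΦ : M.map (PowerSeries.map (Φ : A →+* _)) = scaledBy M r) (x : A) : (Φ x).coeff 0 = x := by
  let c0 : Polynomial A →ₐ[ℂ] A :=
    { Polynomial.constantCoeff with
      commutes' := fun c => by
        show (algebraMap ℂ (Polynomial A) c).coeff 0 = _
        rw [Polynomial.algebraMap_apply, Polynomial.coeff_C_zero] }
  have h : c0.comp Φ = AlgHom.id ℂ A := by
    refine word_induction hex fun g => ?_
    have h1 := congrArg (coeff (g.2.2 + 1)) (congrFun (congrFun hΦ g.1) g.2.1)
    rw [Matrix.map_apply, PowerSeries.coeff_map, coeff_scaledBy] at h1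
    show (Φ (gen M g)).coeff 0 = gen M g
    rw [gen]
    refine (congrArg (fun p : Polynomial A => p.coeff 0) h1).trans ?_
    simp
  exact congrArg (fun f : A →ₐ[ℂ] A => f x) h

theorem scaleDer_coeff {r : ℕ} {Φ : A →ₐ[ℂ] Polynomial A}
    (hΦ : M.map (PowerSeries.map (Φ : A →+* _)) = scaledBy M r) (i j : Idx τ n) (R : ℕ) :
    scaleDer Φ (coeff R (M i j)) = if r + 1 ≤ R then coeff (R - (r + 1)) (M i j) else 0 := by
  have h1 := congrArg (coeff R) (congrFun (congrFun hΦ i) j)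
  rw [Matrix.map_apply, PowerSeries.coeff_map, coeff_scaledBy] at h1
  refine (congrArg (fun p : Polynomial A => p.coeff 1) h1).trans ?_
  simp [Polynomial.coeff_C]

theorem pderiv_inr_sigma (i j : Idx τ n) (m r : ℕ) :
    MvPolynomial.pderiv (Sum.inr m) (sigma (i, j, r)) = if i = j ∧ r = m then 1 else 0 := by
  classical
  rw [sigma, map_add, map_sub, map_zsmul, MvPolynomial.pderiv_X_of_ne (by simp),
    MvPolynomial.pderiv_X_of_ne (by simp), smul_zero, sub_zero, zero_add]
  by_cases h : i = j
  · rw [if_pos h, MvPolynomial.pderiv_X, Pi.single_apply]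
    simp only [h, true_and, Sum.inr.injEq]
  · rw [if_neg h, if_neg (fun h' => h h'.1), map_zero]

/-- The coefficient of `η` in a homomorphism that is the identity at `η = 0` is an honest
derivation. On generators it lowers the index of `T(u)` by `m + 1`: for `r = m` it gives `δ_{ij}`,
and for `r > m` the result falls one short of the degree of a symbol. -/
theorem hasSymbol_scaleDer (hM : Solution M) (hex : ∀ x : A, ∃ e : ℕ, x ∈ filt M e) {m : ℕ}
    {Φ : A →ₐ[ℂ] Polynomial A} (hΦ : M.map (PowerSeries.map (Φ : A →+* _)) = scaledBy M m) :
    HasSymbol M (scaleDer Φ) (MvPolynomial.pderiv (Sum.inr m))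
      (-(wtV (Sum.inr m : Gen τ n ⊕ ℕ) : ℤ)) where
  mul := by
    intro d e x y _ _
    have h : scaleDer Φ (x * y) = x * scaleDer Φ y + scaleDer Φ x * y := by
      rw [scaleDer_apply, map_mul, Polynomial.coeff_mul, Finset.Nat.sum_antidiagonal_succ]
      simp [coeff_zero_scale hex hΦ, scaleDer_apply]
    rw [h, sub_self]
    exact zero_mem _
  gen := by
    rintro ⟨i, j, r⟩
    have hg : ExtendedYangian.gen M (i, j, r) = coeff (r + 1) (M i j) := rfl
    rw [hg, scaleDer_coeff hΦ, pderiv_inr_sigma]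
    rcases lt_trichotomy r m with h | rfl | h
    · rw [if_neg (by omega), if_neg (fun h' => h.ne h'.2)]
      exact zero_mem _
    · simp only [le_refl, if_true, Nat.sub_self, hM.coeff_zero, and_true]
      split_ifs
      · exact symbol_cast (symbol_word (M := M) []) (by simp [wtV, wt, wtL_nil])
      · exact zero_mem _
    · rw [if_pos (by omega), if_neg (fun h' => h.ne' h'.2)]
      refine symbol_of_lower (coeff_mem_lower hM _ _ _ ?_ ?_) <;> simp only [wtV, wt] <;>
        push_cast <;> omega

end Scaling

/-! ### Centrality of `z(u)` -/

section Central

variable {τ : ClassicalType} {n : ℕ} {A B K : Type} [Ring A] [Algebra ℂ A] [Ring B] [Algebra ℂ B]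
  [Ring K] [Algebra ℂ K] {M : Matrix (Idx τ n) (Idx τ n) A⟦X⟧}

theorem coeff_zero_zSeries (hM : Solution M) : coeff 0 (zSeries M) = 1 := by
  obtain ⟨o⟩ := idx_nonempty (τ := τ) hM.pos
  have h := congrArg (coeff 0) (transp_mul_T hM o o)
  rw [delta_mul, if_pos rfl, map_sum] at h
  rw [← h, Finset.sum_eq_single o]
  · rw [map_zsmul, coeff_mul, Finset.Nat.antidiagonal_zero, Finset.sum_singleton, coeff_zero_shift,
      hM.coeff_zero, hM.coeff_zero, if_pos rfl, if_pos rfl, theta_self, one_smul, mul_one]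
  · intro a _ ha
    rw [map_zsmul, coeff_mul, Finset.Nat.antidiagonal_zero, Finset.sum_singleton, hM.coeff_zero a o,
      if_neg ha, mul_zero, smul_zero]
  · simp

/-- Both `z(u)` and `T(u)` are mapped to products. If all smaller indices commute, then the
correction terms drop out of the commutator and only its first-factor copy is left. -/
theorem map_commutator_zSeries (hM : Solution M) {N : Matrix (Idx τ n) (Idx τ n) K⟦X⟧}
    (hN : Solution N) {ι₁ : A →ₐ[ℂ] B} {ι₂ : K →ₐ[ℂ] B} (hc : ∀ x y, Commute (ι₁ x) (ι₂ y))
    (hζ : ∀ r b, Commute (ι₂ (coeff r (zSeries N))) b) {Ψ : A →ₐ[ℂ] B}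
    (hΨ : M.map (PowerSeries.map (Ψ : A →+* B)) =
      M.map (PowerSeries.map (ι₁ : A →+* B)) * N.map (PowerSeries.map (ι₂ : K →+* B)))
    {a s : ℕ} (ha : ∀ b < a, ∀ x, Commute (coeff b (zSeries M)) x)
    (hs : ∀ s' < s, ∀ i j, Commute (coeff a (zSeries M)) (coeff s' (M i j))) (i j : Idx τ n) :
    Ψ (coeff a (zSeries M) * coeff s (M i j) - coeff s (M i j) * coeff a (zSeries M)) =
      ι₁ (coeff a (zSeries M) * coeff s (M i j) - coeff s (M i j) * coeff a (zSeries M)) := by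
  have hcomm : EntriesCommute (M.map (PowerSeries.map (ι₁ : A →+* B)))
      (N.map (PowerSeries.map (ι₂ : K →+* B))) := by
    intro i j k l r s
    rw [Matrix.map_apply, Matrix.map_apply, PowerSeries.coeff_map, PowerSeries.coeff_map]
    exact hc _ _
  have hz : PowerSeries.map (Ψ : A →+* B) (zSeries M) =
      PowerSeries.map (ι₁ : A →+* B) (zSeries M) * PowerSeries.map (ι₂ : K →+* B) (zSeries N) := by
    rw [← zSeries_map, ← zSeries_map, ← zSeries_map, hΨ]
    refine zSeries_mul hM.pos hM.kappa_ne (rtt_map _ hM.rtt) (rtt_map _ hN.rtt) hcomm ?_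
    intro k l r s
    rw [zSeries_map, PowerSeries.coeff_map, Matrix.map_apply, PowerSeries.coeff_map]
    exact hc _ _
  have ht : ∀ s, Ψ (coeff s (M i j)) = ∑ p, ∑ q ∈ Finset.HasAntidiagonal.antidiagonal s,
      ι₁ (coeff q.1 (M i p)) * ι₂ (coeff q.2 (N p j)) := by
    intro s
    have h := congrArg (coeff s) (congrFun (congrFun hΨ i) j)
    rw [Matrix.map_apply, PowerSeries.coeff_map, Matrix.mul_apply, map_sum] at h
    simpa only [coeff_mul, Matrix.map_apply, PowerSeries.coeff_map, RingHom.coe_coe] using h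
  -- The correction `w` involves earlier coefficients of `z(u)`, central by `ha`, and images of
  -- `zSeries N`, central by `hζ`.
  have h1 : ∃ w, Ψ (coeff a (zSeries M)) = ι₁ (coeff a (zSeries M)) + w ∧
      Commute w (Ψ (coeff s (M i j))) := by
    have h := congrArg (coeff a) hz
    rw [PowerSeries.coeff_map, coeff_mul] at h
    simp only [PowerSeries.coeff_map, RingHom.coe_coe] at h
    rw [← Finset.add_sum_erase _ _ (show (a, 0) ∈ _ by simp), coeff_zero_zSeries hN, map_one,
      mul_one] at h
    refine ⟨_, h, Commute.sum_left _ _ _ fun p hp => ?_⟩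
    have hp1 : p.1 + p.2 = a := by simpa using (Finset.mem_erase.1 hp).2
    have hp2 : p.1 < a := by
      by_contra h'
      exact (Finset.mem_erase.1 hp).1 (Prod.ext (show p.1 = a by omega) (show p.2 = 0 by omega))
    refine Commute.mul_left ?_ (hζ _ _)
    rw [ht]
    exact Commute.sum_right _ _ _ fun p' _ => Commute.sum_right _ _ _ fun q _ =>
      Commute.mul_right ((ha _ hp2 _).map ι₁) (hc _ _)
  -- The correction `v` involves only earlier coefficients of `T(u)` in the first factor, which
  -- commute with the coefficient of `z(u)` by `hs`.
  have h2 : ∃ v, Ψ (coeff s (M i j)) = ι₁ (coeff s (M i j)) + v ∧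
      Commute (ι₁ (coeff a (zSeries M))) v := by
    have h := ht s
    have e : ∀ p, ∑ q ∈ Finset.HasAntidiagonal.antidiagonal s,
        ι₁ (coeff q.1 (M i p)) * ι₂ (coeff q.2 (N p j)) = (if p = j then ι₁ (coeff s (M i j)) else 0) +
          ∑ q ∈ (Finset.HasAntidiagonal.antidiagonal s).erase (s, 0),
            ι₁ (coeff q.1 (M i p)) * ι₂ (coeff q.2 (N p j)) := by
      intro p
      rw [← Finset.add_sum_erase _ _ (show (s, 0) ∈ Finset.HasAntidiagonal.antidiagonal s by simp)]
      congr 1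
      rw [hN.coeff_zero]
      split_ifs with h'
      · rw [h', map_one, mul_one]
      · rw [map_zero, mul_zero]
    simp only [e, Finset.sum_add_distrib, Finset.sum_ite_eq', Finset.mem_univ, if_true] at h
    refine ⟨_, h, Commute.sum_right _ _ _ fun p _ => Commute.sum_right _ _ _ fun q hq => ?_⟩
    have hp1 : q.1 + q.2 = s := by simpa using (Finset.mem_erase.1 hq).2
    have hp2 : q.1 < s := by
      by_contra h'
      exact (Finset.mem_erase.1 hq).1 (Prod.ext (show q.1 = s by omega) (show q.2 = 0 by omega))
    exact Commute.mul_right ((hs _ hp2 _ _).map ι₁) (hc _ _)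
  obtain ⟨w, hw, cw⟩ := h1
  obtain ⟨v, hv, cv⟩ := h2
  rw [map_sub, map_mul, map_mul, map_sub, map_mul, map_mul, hw, add_mul, mul_add, cw.eq,
    add_sub_add_right_eq_sub, hv, mul_add, add_mul, cv.eq, add_sub_add_right_eq_sub]

/-- By uniqueness of symbols all partial derivatives of the symbol vanish, so in positive degree the
symbol is zero and the element lies one step lower in the filtration. -/
theorem exists_const_of_killed [Nontrivial A] (hM : Solution M) {δ : Gen τ n ⊕ ℕ → A →ₗ[ℂ] A}
    (hδ : ∀ v, HasSymbol M (δ v) (MvPolynomial.pderiv v) (-(wtV v : ℤ))) {x : A} {e : ℕ}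
    (hx : x ∈ filt M e) (hk : ∀ v, δ v x = 0) : ∃ c : ℂ, x = c • 1 := by
  induction e with
  | zero => exact mem_filt_zero hx
  | succ e ih =>
    obtain ⟨q, hq⟩ := exists_symbol hx
    have h1 : ∀ v, MvPolynomial.pderiv v q = 0 := by
      intro v
      have h2 := (hδ v).apply hq
      rw [hk v] at h2
      have h3 := wtV_pos v
      by_cases hv : wtV v ≤ e + 1
      · exact symbol_unique (fun v => ⟨_, hδ v⟩) (e + 1 - wtV v)
          (symbol_cast h2 (by push_cast [hv]; ring))
      · exact congrArg Prod.snd (symbol_of_neg (by omega) h2)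
    have h2 : q = 0 := by
      rw [eq_C_of_pderiv_eq_zero h1, constantCoeff_of_symbol (by omega) hq, map_zero]
    rw [h2] at hq
    have h3 := mem_lower_of_symbol hM hq
    exact ih (filt_mono (by omega) h3)

end Central

/-! ### Separating operators on the extended Yangian -/

section Universal

variable {τ : ClassicalType} {n : ℕ}

theorem mkAlgHom_ι (g : Gen τ n) :
    RingQuot.mkAlgHom ℂ (Rel τ n) (FreeAlgebra.ι ℂ g) = gen (T τ n) g := by
  simp only [gen, T, Matrix.map_apply, PowerSeries.coeff_map, RingHom.coe_coe, freeT, coeff_mk]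

/-- Induction on the extended Yangian. -/
theorem ey_induction {P : EY τ n → Prop} (h1 : ∀ c : ℂ, P (algebraMap ℂ _ c))
    (hg : ∀ g, P (gen (T τ n) g)) (hm : ∀ x y, P x → P y → P (x * y)) (ha : ∀ x y, P x → P y → P (x + y))
    (x : EY τ n) : P x := by
  obtain ⟨y, rfl⟩ := RingQuot.mkAlgHom_surjective ℂ (Rel τ n) x
  induction y using FreeAlgebra.induction with
  | grade0 c => rw [AlgHom.commutes]; exact h1 c
  | grade1 g => rw [mkAlgHom_ι]; exact hg g
  | mul x y hx hy => rw [map_mul]; exact hm _ _ hx hy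
  | add x y hx hy => rw [map_add]; exact ha _ _ hx hy

theorem exists_mem_filt (x : EY τ n) : ∃ e : ℕ, x ∈ filt (T τ n) e := by
  induction x using ey_induction with
  | h1 c =>
    rw [Algebra.algebraMap_eq_smul_one]
    exact ⟨0, Submodule.smul_mem _ _ (one_mem_filt le_rfl)⟩
  | hg g => exact ⟨_, gen_mem g⟩
  | hm x y hx hy =>
    obtain ⟨a, ha⟩ := hx
    obtain ⟨b, hb⟩ := hy
    exact ⟨a + b, by rw [Nat.cast_add]; exact mul_mem_filt ha hb⟩
  | ha x y hx hy =>
    obtain ⟨a, ha⟩ := hx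
    obtain ⟨b, hb⟩ := hy
    exact ⟨a + b, add_mem (filt_mono (by omega) ha) (filt_mono (by omega) hb)⟩


theorem solution_T (hn : 1 ≤ n) (hD : τ = ClassicalType.D → 2 ≤ n) : Solution (T τ n) :=
  ⟨hn, kappa_ne_zero hn hD, coeff_zero_T τ n, rtt_T τ n⟩

theorem solution_vecRep (h : Solution (T τ n)) : Solution (vecRep τ n) := by
  refine ⟨h.pos, h.kappa_ne, fun i j => ?_, rtt_vecRep τ n⟩
  ext a b m
  have h1 := vecCoeff_zero i j a b m
  rw [vecCoeff] at h1
  rw [h1]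
  by_cases hij : i = j <;> by_cases hab : a = b <;> by_cases hm : m = 0 <;>
    simp [hij, hab, hm, Polynomial.coeff_one, Matrix.one_apply]

theorem solution_scalarSol (h : Solution (T τ n)) (r : ℕ) : Solution (scalarSol τ n r) := by
  refine ⟨h.pos, h.kappa_ne, fun i j => ?_, rtt_diagonal fun a b => mul_comm _ _⟩
  rw [scalarSol, Matrix.diagonal_apply]
  split_ifs
  · simp
  · simp

theorem coeff_zero_mul_of {A : Type} [Ring A] {M N : Matrix (Idx τ n) (Idx τ n) A⟦X⟧}
    (hM : ∀ i j, coeff 0 (M i j) = if i = j then 1 else 0)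
    (hN : ∀ i j, coeff 0 (N i j) = if i = j then 1 else 0) (i j : Idx τ n) :
    coeff 0 ((M * N) i j) = if i = j then 1 else 0 := by
  rw [Matrix.mul_apply, map_sum, Finset.sum_eq_single i]
  · rw [coeff_mul, Finset.Nat.antidiagonal_zero, Finset.sum_singleton, hM, hN, if_pos rfl, one_mul]
  · intro p _ hp
    rw [coeff_mul, Finset.Nat.antidiagonal_zero, Finset.sum_singleton, hM, if_neg (Ne.symm hp),
      zero_mul]
  · simp

theorem coeff_zero_map_of {A B : Type} [Ring A] [Algebra ℂ A] [Ring B] [Algebra ℂ B]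
    (φ : A →ₐ[ℂ] B) {M : Matrix (Idx τ n) (Idx τ n) A⟦X⟧}
    (hM : ∀ i j, coeff 0 (M i j) = if i = j then 1 else 0) (i j : Idx τ n) :
    coeff 0 (M.map (PowerSeries.map (φ : A →+* B)) i j) = if i = j then 1 else 0 := by
  rw [Matrix.map_apply, PowerSeries.coeff_map, hM, RingHom.coe_coe, apply_ite φ, map_one, map_zero]

/-- The coproduct followed by the vector representation. -/
def vecHom (h : Solution (T τ n)) :
    EY τ n →ₐ[ℂ] Matrix (Idx τ n) (Idx τ n) (Polynomial (EY τ n)) :=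
  lift (coprod (T τ n)) (coeff_zero_mul_of (coeff_zero_map_of _ h.coeff_zero)
    (coeff_zero_map_of _ (solution_vecRep h).coeff_zero)) (rtt_coprod h)

theorem map_vecHom (h : Solution (T τ n)) :
    (T τ n).map (PowerSeries.map (vecHom h : EY τ n →+* _)) = coprod (T τ n) :=
  map_lift_T _ _ _

/-- The homomorphism `T(u) ↦ (1 + η u^{-r-1}) T(u)`. -/
def scaleHom (h : Solution (T τ n)) (r : ℕ) : EY τ n →ₐ[ℂ] Polynomial (EY τ n) :=
  lift (scaledBy (T τ n) r) (coeff_zero_mul_of (coeff_zero_map_of _ h.coeff_zero)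
    (coeff_zero_map_of _ (solution_scalarSol h r).coeff_zero)) (rtt_scaledBy h r)

theorem map_scaleHom (h : Solution (T τ n)) (r : ℕ) :
    (T τ n).map (PowerSeries.map (scaleHom h r : EY τ n →+* _)) = scaledBy (T τ n) r :=
  map_lift_T _ _ _

variable (τ n) in
/-- The character `T(u) ↦ g(u) 1`. -/
def character (g : ℂ⟦X⟧) (hg : constantCoeff g = 1) : EY τ n →ₐ[ℂ] ℂ :=
  lift (Matrix.diagonal fun _ => g) (by
    intro i j
    rw [Matrix.diagonal_apply]
    split_ifs
    · rw [coeff_zero_eq_constantCoeff_apply, hg]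
    · exact map_zero _) (rtt_diagonal fun a b => mul_comm _ _)

theorem map_character (g : ℂ⟦X⟧) (hg : constantCoeff g = 1) :
    (T τ n).map (PowerSeries.map (character τ n g hg : EY τ n →+* ℂ)) =
      Matrix.diagonal fun _ => g :=
  map_lift_T _ _ _

instance : Nontrivial (EY τ n) :=
  (character τ n 1 (map_one _) : EY τ n →+* ℂ).domain_nontrivial

/-- The operators whose symbols are the partial derivatives. -/
def separating (h : Solution (T τ n)) : Gen τ n ⊕ ℕ → EY τ n →ₗ[ℂ] EY τ n
  | Sum.inl g => -vecDiff (vecHom h) g.2.1 g.1 g.2.2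
  | Sum.inr r => scaleDer (scaleHom h r)

theorem hasSymbol_separating (h : Solution (T τ n)) (v : Gen τ n ⊕ ℕ) :
    HasSymbol (T τ n) (separating h v) (MvPolynomial.pderiv v) (-(wtV v : ℤ)) := by
  rcases v with ⟨b, a, m⟩ | r
  · exact hasSymbol_vecDiff h (map_vecHom h) b a m
  · exact hasSymbol_scaleDer h exists_mem_filt (map_scaleHom h r)

theorem separated_T (h : Solution (T τ n)) : Separated (T τ n) :=
  fun v => ⟨_, hasSymbol_separating h v⟩

theorem rightIncl_diagonal_commute (A : Type) [Ring A] [Algebra ℂ A] (p : Polynomial ℂ)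
    (y : Matrix (Idx τ n) (Idx τ n) (Polynomial A)) :
    Commute (rightIncl τ n A (Matrix.diagonal fun _ => p)) y := by
  have e : rightIncl τ n A (Matrix.diagonal fun _ => p) =
      Matrix.diagonal fun _ => p.map (algebraMap ℂ A) := by
    ext1 a b
    rw [rightIncl_apply, Matrix.diagonal_apply, Matrix.diagonal_apply]
    split_ifs
    · rfl
    · exact Polynomial.map_zero _
  have hp : ∀ q : Polynomial A, p.map (algebraMap ℂ A) * q = q * p.map (algebraMap ℂ A) := by
    intro q
    ext m
    rw [Polynomial.coeff_mul, Polynomial.coeff_mul, ← Finset.Nat.sum_antidiagonal_swap]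
    refine Finset.sum_congr rfl fun x _ => ?_
    rw [Polynomial.coeff_map, Polynomial.coeff_map, Algebra.commutes]
    rfl
  show _ = _
  ext1 a b
  rw [e, Matrix.diagonal_mul, Matrix.mul_diagonal, hp]

theorem mapAlgHom_commute (A : Type) [Ring A] [Algebra ℂ A] (p : Polynomial ℂ) (q : Polynomial A) :
    Commute ((Polynomial.mapAlgHom (Algebra.ofId ℂ A) : Polynomial ℂ →ₐ[ℂ] Polynomial A) p) q := by
  show p.map (algebraMap ℂ A) * q = q * p.map (algebraMap ℂ A)
  ext m
  rw [Polynomial.coeff_mul, Polynomial.coeff_mul, ← Finset.Nat.sum_antidiagonal_swap]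
  refine Finset.sum_congr rfl fun x _ => ?_
  rw [Polynomial.coeff_map, Polynomial.coeff_map, Algebra.commutes]
  rfl

/-- Elements that commute with the generators are central. -/
theorem commute_of_gen {x : EY τ n} (h : ∀ g, Commute x (gen (T τ n) g)) (y : EY τ n) :
    Commute x y := by
  induction y using ey_induction with
  | h1 c => exact (Algebra.commutes c x).symm
  | hg g => exact h g
  | hm y y' h h' => exact h.mul_right h'
  | ha y y' h h' => exact h.add_right h'

/-- A character has commutative values, so it sends a commutator to zero but the scalar `c` to
itself. -/
theorem eq_zero_of_commutator_const {A : Type} [Ring A] [Algebra ℂ A] (ε : A →ₐ[ℂ] ℂ) {x y : A}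
    {c : ℂ} (h : x * y - y * x = c • 1) : Commute x y := by
  have h1 := congrArg ε h
  rw [map_sub, map_mul, map_mul, mul_comm (ε y), sub_self, map_smul, map_one, smul_eq_mul,
    mul_one] at h1
  rw [← h1, zero_smul, sub_eq_zero] at h
  exact h

/-- Induction on `a`, then on `s`: the commutator `w` with a coefficient of `u^{-s}` is sent to its
plain copy by `vecHom` and by every `scaleHom`. Thus all separating operators kill it, and it is a
scalar commutator. -/
theorem zSeries_coeff_commute (h : Solution (T τ n)) (a : ℕ) (x : EY τ n) :
    Commute (coeff a (zSeries (T τ n))) x := by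
  induction a using Nat.strong_induction_on generalizing x with
  | _ a iha =>
    have key : ∀ s i j, Commute (coeff a (zSeries (T τ n))) (coeff s (T τ n i j)) := by
      intro s
      induction s using Nat.strong_induction_on with
      | _ s ihs =>
        intro i j
        set w := coeff a (zSeries (T τ n)) * coeff s (T τ n i j) -
          coeff s (T τ n i j) * coeff a (zSeries (T τ n)) with hw
        have h1 : vecHom h w = leftIncl τ n (EY τ n) w := by
          refine map_commutator_zSeries h (solution_vecRep h) leftIncl_rightIncl_commute ?_
            (map_vecHom h) iha ihs i j
          obtain ⟨g, hg⟩ := exists_zSeries_vecRep τ n h.pos h.kappa_ne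
          intro r b
          rw [hg]
          exact rightIncl_diagonal_commute _ _ _
        have h2 : ∀ r, scaleHom h r w = Polynomial.CAlgHom (R := ℂ) w := fun r =>
          map_commutator_zSeries h (solution_scalarSol h r) C_map_commute
            (fun _ b => mapAlgHom_commute _ _ b) (map_scaleHom h r) iha ihs i j
        obtain ⟨e, he⟩ := exists_mem_filt w
        obtain ⟨c, hc⟩ := exists_const_of_killed h (hasSymbol_separating h) he (by
          rintro (⟨b, d, m⟩ | r)
          · show -vecDiff (vecHom h) d b m w = 0
            rw [vecDiff_apply, h1, sub_self, Matrix.zero_apply, Polynomial.coeff_zero, neg_zero]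
          · show scaleDer (scaleHom h r) w = 0
            rw [scaleDer_apply, h2]
            exact Polynomial.coeff_C_succ)
        exact eq_zero_of_commutator_const (character τ n 1 (map_one _)) (hw.symm.trans hc)
    exact commute_of_gen (fun g => key _ _ _) x

end Universal

/-! ### The symbols of the inner derivations -/

section Inner

variable {τ : ClassicalType} {n : ℕ} {A : Type} [Ring A] [Algebra ℂ A]
  {M : Matrix (Idx τ n) (Idx τ n) A⟦X⟧}

/-- The symbol of the commutator with a generator. -/
def adSymbol (k l : Idx τ n) (s : ℕ) : Derivation ℂ (Poly τ n) (Poly τ n) :=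
  MvPolynomial.mkDerivation ℂ fun v =>
    match v with
    | Sum.inl g => (if k = g.2.1 then sigma (g.1, l, g.2.2 + s) else 0) -
        if g.1 = l then sigma (k, g.2.1, g.2.2 + s) else 0
    | Sum.inr _ => 0

theorem adSymbol_inl (k l i j : Idx τ n) (r s : ℕ) :
    adSymbol k l s (MvPolynomial.X (Sum.inl (i, j, r))) =
      (if k = j then sigma (i, l, r + s) else 0) - if i = l then sigma (k, j, r + s) else 0 :=
  MvPolynomial.mkDerivation_X _ _ _

theorem adSymbol_inr (k l : Idx τ n) (r s : ℕ) :
    adSymbol k l s (MvPolynomial.X (Sum.inr r)) = 0 :=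
  MvPolynomial.mkDerivation_X _ _ _

/-- On variables the derivation follows the bracket of matrix units; the antisymmetrization in
`sigma` then produces the remaining two terms of `gen_commutator`. -/
theorem adSymbol_sigma (k l i j : Idx τ n) (r s : ℕ) :
    adSymbol k l s (sigma (i, j, r)) =
      ((if k = j then sigma (i, l, r + s) else 0) - (if i = l then sigma (k, j, r + s) else 0)) +
        ((if l = neg j then theta τ i j • sigma (k, neg i, r + s) else 0) -
          (if k = neg i then theta τ i j • sigma (neg j, l, r + s) else 0)) := by
  have h1 : adSymbol k l s (if i = j then MvPolynomial.X (Sum.inr r) else 0) = 0 := by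
    split_ifs
    · exact adSymbol_inr _ _ _ _
    · exact map_zero _
  rw [sigma, map_add, map_sub, map_zsmul, h1, add_zero, adSymbol_inl, adSymbol_inl]
  simp only [eq_comm (a := neg j), smul_sub, smul_ite, smul_zero]
  abel

/-- The commutator with a fixed element. -/
def adR (y : A) : A →ₗ[ℂ] A := LinearMap.mulRight ℂ y - LinearMap.mulLeft ℂ y

theorem adR_apply (x y : A) : adR y x = x * y - y * x := rfl

theorem hasSymbol_adR (hM : Solution M) (k l : Idx τ n) (s : ℕ) :
    HasSymbol M (adR (gen M (k, l, s))) (adSymbol k l s) (2 * s) where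
  mul := by
    intro a b x y _ _
    have e : adR (gen M (k, l, s)) (x * y) -
        (x * adR (gen M (k, l, s)) y + adR (gen M (k, l, s)) x * y) = 0 := by
      simp only [adR_apply]
      noncomm_ring
    rw [e]
    exact zero_mem _
  gen := by
    rintro ⟨i, j, r⟩
    rw [adR_apply, adSymbol_sigma]
    have h := gen_commutator hM i j k l r s
    refine symbol_add_lower ?_ (filt_mono ?_ h)
    · have hg : ∀ a b : Idx τ n, (ExtendedYangian.gen M (a, b, r + s), sigma (a, b, r + s)) ∈
          symbol M ((wt ((i, j, r) : Gen τ n) : ℤ) + 2 * s) := fun a b =>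
        symbol_cast (symbol_gen (M := M) (a, b, r + s)) (by simp only [wt]; push_cast; ring)
      have hi : ∀ (p : Prop) [Decidable p] (a b : Idx τ n) (c : ℤ),
          (if p then c • ExtendedYangian.gen M (a, b, r + s) else 0,
            if p then c • sigma (a, b, r + s) else 0) ∈
          symbol M ((wt ((i, j, r) : Gen τ n) : ℤ) + 2 * s) := by
        intro p _ a b c
        split_ifs
        · exact zsmul_mem (hg a b) c
        · exact zero_mem _
      have h1 := hi (k = j) i l 1
      have h2 := hi (i = l) k j 1
      simp only [one_smul] at h1 h2
      exact add_mem (sub_mem h1 h2) (sub_mem (hi _ _ _ _) (hi _ _ _ _))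
    · simp only [wt]
      push_cast
      omega

/-- A commutator of smaller degree than expected has symbol zero, while by `hasSymbol_adR` its
symbol is `adSymbol k l s q`; symbols are unique. -/
theorem adSymbol_eq_zero [Nontrivial A] (hM : Solution M) (hS : Separated M) {e : ℕ} {w : A}
    {q : Poly τ n} (hq : (w, q) ∈ symbol M e) (k l : Idx τ n) (s : ℕ)
    (h : w * gen M (k, l, s) - gen M (k, l, s) * w ∈ filt M (e + 2 * s - 1)) :
    adSymbol k l s q = 0 := by
  have h1 := (hasSymbol_adR hM k l s).apply hq
  have h2 := sub_mem h1 (symbol_of_lower h)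
  rw [adR_apply, Prod.mk_sub_mk, sub_self, sub_zero] at h2
  exact symbol_unique hS (e + 2 * s) (symbol_cast h2 (by push_cast; ring))

end Inner

/-! ### Invariant polynomials -/

section Invariants

variable {τ : ClassicalType} {n : ℕ}

/-- Polynomials in the symbols of the generators. -/
def sigmaAlg (τ : ClassicalType) (n : ℕ) : Subalgebra ℂ (Poly τ n) :=
  Algebra.adjoin ℂ (Set.range sigma)

theorem snd_mem_sigmaAlg {A : Type} [Ring A] [Algebra ℂ A] {M : Matrix (Idx τ n) (Idx τ n) A⟦X⟧}
    {e : ℤ} {p : A × Poly τ n} (h : p ∈ symbol M e) : p.2 ∈ sigmaAlg τ n := by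
  induction h using Submodule.span_induction with
  | mem p hp =>
    rcases hp with ⟨-, h⟩ | ⟨L, -, rfl⟩
    · rw [h]; exact zero_mem _
    · refine list_prod_mem fun x hx => ?_
      obtain ⟨g, -, rfl⟩ := List.mem_map.1 hx
      exact Algebra.subset_adjoin ⟨g, rfl⟩
  | zero => exact zero_mem _
  | add p q _ _ h h' => exact add_mem h h'
  | smul c p _ h => exact Subalgebra.smul_mem _ h c

/-- The derivation `∂_{(-j,-i,r)} + θ_{ij} ∂_{(i,j,r)}` kills every `sigma`, hence all polynomials
in them. -/
theorem pderiv_neg {q : Poly τ n} (hq : q ∈ sigmaAlg τ n) (i j : Idx τ n) (r : ℕ) :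
    MvPolynomial.pderiv (Sum.inl (neg j, neg i, r)) q =
      -((theta τ i j : ℂ) • MvPolynomial.pderiv (Sum.inl (i, j, r)) q) := by
  let D : Derivation ℂ (Poly τ n) (Poly τ n) := MvPolynomial.pderiv (Sum.inl (neg j, neg i, r)) +
    (theta τ i j : ℂ) • MvPolynomial.pderiv (Sum.inl (i, j, r))
  have hDa : ∀ x, D x = MvPolynomial.pderiv (Sum.inl (neg j, neg i, r)) x +
      (theta τ i j : ℂ) • MvPolynomial.pderiv (Sum.inl (i, j, r)) x := fun x => rfl
  have hD : Set.EqOn D (0 : Derivation ℂ (Poly τ n) (Poly τ n)) (Set.range sigma) := by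
    rintro _ ⟨⟨a, b, m⟩, rfl⟩
    rw [hDa, Derivation.zero_apply, pderiv_inl_sigma, pderiv_inl_sigma]
    by_cases hm : m = r
    · rw [if_pos hm, if_pos hm, smul_smul, ← add_smul]
      have e1 : (b = neg i ∧ a = neg j) ↔ (j = neg a ∧ i = neg b) := by
        constructor <;> rintro ⟨rfl, rfl⟩ <;> simp
      have e2 : (neg i = neg a ∧ neg j = neg b) ↔ (b = j ∧ a = i) := by
        constructor
        · rintro ⟨h, h'⟩
          exact ⟨(neg_injective h').symm, (neg_injective h).symm⟩
        · rintro ⟨rfl, rfl⟩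
          exact ⟨rfl, rfl⟩
      have e3 : ((if b = neg i ∧ a = neg j then 1 else 0 : ℂ) -
          if neg i = neg a ∧ neg j = neg b then (theta τ a b : ℂ) else 0) + (theta τ i j : ℂ) *
          ((if b = j ∧ a = i then 1 else 0 : ℂ) -
            if j = neg a ∧ i = neg b then (theta τ a b : ℂ) else 0) = 0 := by
        simp only [e1, e2]
        have t1 : (b = j ∧ a = i) → (theta τ a b : ℂ) = theta τ i j := by rintro ⟨rfl, rfl⟩; rfl
        have t2 : (j = neg a ∧ i = neg b) → (theta τ i j : ℂ) * theta τ a b = 1 := by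
          rintro ⟨rfl, rfl⟩
          rw [theta_neg_neg, theta_comm b a]
          exact_mod_cast theta_mul_self a b
        by_cases c1 : b = j ∧ a = i <;> by_cases c2 : j = neg a ∧ i = neg b
        · rw [if_pos c1, if_pos c1, if_pos c2, if_pos c2, t1 c1, mul_sub, ← t1 c1, t1 c1]
          have := t2 c2
          rw [t1 c1] at this
          rw [this]
          ring
        · rw [if_pos c1, if_pos c1, if_neg c2, if_neg c2, t1 c1]; ring
        · rw [if_neg c1, if_neg c1, if_pos c2, if_pos c2, zero_sub, mul_neg, t2 c2]; ring
        · rw [if_neg c1, if_neg c1, if_neg c2, if_neg c2]; ring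
      rw [e3, zero_smul]
    · rw [if_neg hm, if_neg hm, smul_zero, add_zero]
  have h := Derivation.eqOn_adjoin hD hq
  rw [hDa, Derivation.zero_apply] at h
  exact eq_neg_of_add_eq_zero_left h

theorem exists_pderiv_eq_zero (q : Poly τ n) :
    ∃ s : ℕ, ∀ (m : ℕ) (i j : Idx τ n), s ≤ m → MvPolynomial.pderiv (Sum.inl (i, j, m)) q = 0 := by
  classical
  refine ⟨(q.vars.sup fun v => Sum.elim (fun g => g.2.2) id v) + 1, fun m i j hm => ?_⟩
  refine MvPolynomial.pderiv_eq_zero_of_notMem_vars fun h => ?_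
  have := Finset.le_sup (f := fun v : Gen τ n ⊕ ℕ => Sum.elim (fun g => g.2.2) id v) h
  simp only [Sum.elim_inl] at this
  omega

/-- The relation between the partial derivatives of an invariant polynomial. -/
theorem pderiv_relation {q : Poly τ n} (h : ∀ k l s, adSymbol k l s q = 0) (b a k l : Idx τ n)
    (r : ℕ) :
    (if l = a then MvPolynomial.pderiv (Sum.inl (b, k, r)) q else 0) -
      (if b = neg l then
        (theta τ (neg a) l : ℂ) • MvPolynomial.pderiv (Sum.inl (neg a, k, r)) q else 0) -
      ((if k = b then MvPolynomial.pderiv (Sum.inl (l, a, r)) q else 0) -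
      (if a = neg k then
        (theta τ k (neg b) : ℂ) • MvPolynomial.pderiv (Sum.inl (l, neg b, r)) q else 0)) = 0 := by
  classical
  -- Beyond this index `q` involves no generator variables, so `∂_{(b,a,r+s)}` kills it. The
  -- derivation `adSymbol k l s` kills it by assumption, so their bracket does too.
  obtain ⟨s, hs⟩ := exists_pderiv_eq_zero q
  let D : Derivation ℂ (Poly τ n) (Poly τ n) :=
    (if l = a then (1 : ℂ) else 0) • MvPolynomial.pderiv (Sum.inl (b, k, r)) -
      (if b = neg l then (theta τ (neg a) l : ℂ) else 0) •
        MvPolynomial.pderiv (Sum.inl (neg a, k, r)) -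
      ((if k = b then (1 : ℂ) else 0) • MvPolynomial.pderiv (Sum.inl (l, a, r)) -
      (if a = neg k then (theta τ k (neg b) : ℂ) else 0) •
        MvPolynomial.pderiv (Sum.inl (l, neg b, r)))
  have eD : ∀ q, D q = (if l = a then (1 : ℂ) else 0) • MvPolynomial.pderiv (Sum.inl (b, k, r)) q -
      (if b = neg l then (theta τ (neg a) l : ℂ) else 0) •
        MvPolynomial.pderiv (Sum.inl (neg a, k, r)) q -
      ((if k = b then (1 : ℂ) else 0) • MvPolynomial.pderiv (Sum.inl (l, a, r)) q -
      (if a = neg k then (theta τ k (neg b) : ℂ) else 0) •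
        MvPolynomial.pderiv (Sum.inl (l, neg b, r)) q) := fun q => rfl
  -- As `adSymbol k l s` raises the index by `s`, the bracket only sees variables of index `r`: it
  -- is a constant-coefficient combination of their partial derivatives. It suffices to compare
  -- values on variables.
  have key : ⁅(MvPolynomial.pderiv (Sum.inl (b, a, r + s)) : Derivation ℂ (Poly τ n) (Poly τ n)),
      adSymbol k l s⁆ = D := by
    refine MvPolynomial.derivation_ext fun v => ?_
    rw [Derivation.commutator_apply]
    have e0 : adSymbol k l s (MvPolynomial.pderiv (Sum.inl (b, a, r + s)) (MvPolynomial.X v)) = 0 := by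
      rw [MvPolynomial.pderiv_X, Pi.single_apply]
      split_ifs
      · exact Derivation.map_one_eq_zero _
      · exact map_zero _
    rw [e0, sub_zero]
    rcases v with ⟨i, j, m⟩ | m
    · have hX : ∀ c d : Idx τ n, (MvPolynomial.pderiv (Sum.inl (c, d, r))
          (MvPolynomial.X (Sum.inl (i, j, m))) : Poly τ n) =
          (if m = r then if c = i ∧ d = j then (1 : ℂ) else 0 else 0) • 1 := by
        intro c d
        rw [MvPolynomial.pderiv_X, Pi.single_apply]
        simp only [Sum.inl.injEq, Prod.mk.injEq]
        by_cases h1 : m = r <;> by_cases h2 : c = i <;> by_cases h3 : d = j <;>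
          simp [h1, h2, h3, eq_comm (a := i), eq_comm (a := j)]
      rw [eD, hX, hX, hX, hX, adSymbol_inl, map_sub, apply_ite (MvPolynomial.pderiv _),
        apply_ite (MvPolynomial.pderiv _), map_zero, pderiv_inl_sigma, pderiv_inl_sigma]
      by_cases hm : m = r
      · have hm' : m + s = r + s := by rw [hm]
        simp only [if_pos hm, if_pos hm', smul_smul, ← sub_smul]
        have hz : ∀ (p : Prop) [Decidable p] (c : ℂ), (if p then c • (1 : Poly τ n) else 0) =
            (if p then c else 0) • 1 := by
          intro p _ c
          split_ifs
          · rfl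
          · rw [zero_smul]
        rw [hz, hz, ← sub_smul]
        congr 1
        have t1 : (a = neg i ∧ b = neg l) ↔ (b = neg l ∧ neg a = i) := by
          rw [and_comm, neg_eq_iff]
        have t2 : (a = neg k ∧ b = neg j) ↔ (a = neg k ∧ neg b = j) := by rw [neg_eq_iff]
        simp only [t1, t2]
        have s1 : (if k = j then ((if l = a ∧ i = b then (1 : ℂ) else 0) -
            if b = neg l ∧ neg a = i then (theta τ i l : ℂ) else 0) else 0) =
            (if l = a then (1 : ℂ) else 0) * (if b = i ∧ k = j then 1 else 0) -
            (if b = neg l then (theta τ (neg a) l : ℂ) else 0) *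
              (if neg a = i ∧ k = j then 1 else 0) := by
          by_cases c1 : k = j
          · have : (if b = neg l ∧ neg a = i then (theta τ i l : ℂ) else 0) =
              (if b = neg l then (theta τ (neg a) l : ℂ) else 0) * if neg a = i then 1 else 0 := by
              by_cases c2 : neg a = i
              · simp [c2]
              · simp [c2]
            rw [if_pos c1, this]
            simp only [c1, and_true]
            by_cases c3 : l = a <;> simp [c3, eq_comm (a := i)]
          · simp [c1]
        have s2 : (if i = l then ((if j = a ∧ k = b then (1 : ℂ) else 0) -
            if a = neg k ∧ neg b = j then (theta τ k j : ℂ) else 0) else 0) =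
            (if k = b then (1 : ℂ) else 0) * (if l = i ∧ a = j then 1 else 0) -
            (if a = neg k then (theta τ k (neg b) : ℂ) else 0) *
              (if l = i ∧ neg b = j then 1 else 0) := by
          by_cases c1 : l = i
          · have : (if a = neg k ∧ neg b = j then (theta τ k j : ℂ) else 0) =
              (if a = neg k then (theta τ k (neg b) : ℂ) else 0) * if neg b = j then 1 else 0 := by
              by_cases c2 : neg b = j
              · simp [c2]
              · simp [c2]
            rw [if_pos c1.symm, this]
            simp only [c1, true_and]
            by_cases c3 : k = b <;> simp [c3, eq_comm (a := j)]
          · simp [c1, eq_comm (a := i)]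
        rw [s1, s2]
      · have hm' : ¬ m + s = r + s := by omega
        simp only [if_neg hm, if_neg hm', zero_smul, smul_zero, sub_zero, ite_self]
    · rw [eD, adSymbol_inr, map_zero]
      simp [MvPolynomial.pderiv_X, Pi.single_apply]
  have h1 := congrArg (fun D : Derivation ℂ (Poly τ n) (Poly τ n) => D q) key
  simp only [Derivation.commutator_apply] at h1
  rw [h, hs _ _ _ (Nat.le_add_left _ _), map_zero, map_zero, sub_zero] at h1
  have h2 := h1.symm
  rw [eD] at h2
  simpa only [ite_smul, one_smul, zero_smul] using h2

theorem neg_eq_self_iff {i : Idx τ n} : neg i = i ↔ i.1 = 0 := by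
  rw [Subtype.ext_iff]
  show -i.1 = i.1 ↔ _
  omega

/-- An orthogonal algebra with `κ ≠ 0` has `N ≥ 3`. -/
theorem exists_ne_ne (hn : 1 ≤ n) (hκ : kappa τ n ≠ 0) (hC : τ ≠ ClassicalType.C) (b : Idx τ n) :
    ∃ a : Idx τ n, a ≠ b ∧ a ≠ neg b := by
  classical
  have h3 : 3 ≤ size τ n := by
    cases τ with
    | B => simp only [size]; omega
    | C => exact absurd rfl hC
    | D =>
      have : n ≠ 1 := by
        rintro rfl
        exact hκ (by norm_num [kappa, size])
      simp only [size]
      omega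
  have h : ({b, neg b} : Finset (Idx τ n)) ≠ Finset.univ := by
    intro h
    have h1 := Finset.card_le_two (a := b) (b := neg b)
    rw [h, Finset.card_univ, card_idx] at h1
    omega
  by_contra! h'
  refine h (Finset.eq_univ_iff_forall.2 fun a => ?_)
  by_cases ha : a = b
  · simp [ha]
  · simp [h' a ha]

/-- An invariant polynomial depends on the central variables only. -/
theorem pderiv_eq_zero_of_invariant (hn : 1 ≤ n) (hκ : kappa τ n ≠ 0) {q : Poly τ n}
    (hq : q ∈ sigmaAlg τ n) (h : ∀ k l s, adSymbol k l s q = 0) (i j : Idx τ n) (r : ℕ) :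
    MvPolynomial.pderiv (Sum.inl (i, j, r)) q = 0 := by
  have hrel := fun b a k l => pderiv_relation h b a k l r
  have hanti := fun i j => pderiv_neg hq i j r
  generalize hp : (fun a b => MvPolynomial.pderiv (Sum.inl (a, b, r)) q) = p
  have hp' : ∀ a b, MvPolynomial.pderiv (Sum.inl (a, b, r)) q = p a b := fun a b => by rw [← hp]
  simp only [hp'] at hrel hanti ⊢
  clear hp hp'
  have two : ∀ {x : Poly τ n}, x + x = 0 → x = 0 := fun {x} hx => by
    rw [← two_smul ℂ, smul_eq_zero] at hx
    exact hx.resolve_left two_ne_zero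
  by_cases hij : i = j
  · subst hij
    have h1 := hanti i i
    rw [theta_self, Int.cast_one, one_smul] at h1
    by_cases hi : neg i = i
    · rw [hi] at h1
      exact two (add_eq_zero_iff_eq_neg.2 h1)
    · by_cases hC : τ = ClassicalType.C
      · subst hC
        -- In the symplectic case all four terms survive and add up to `4 p i i`.
        have h2 := hrel i (neg i) i (neg i)
        have ht : theta ClassicalType.C i (neg i) = -1 := theta_neg_self i
        simp only [neg_neg', if_true, ht, h1] at h2
        refine two (two ?_)
        push_cast at h2
        rw [← h2]
        module
      -- In the orthogonal case an index `a ≠ ±i` gives `p i i = p a a` and `p i i = p (-a) (-a)`,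
      -- whereas `p (-a) (-a) = -p a a`.
      · have h3 : ∀ a, a ≠ i → a ≠ neg i → p i i = p a a := by
          intro a ha ha'
          have h2 := hrel i a i a
          rw [if_pos rfl, if_neg (fun h => ha' (neg_eq_iff.1 h.symm)), if_pos rfl, if_neg ha', sub_zero,
            sub_zero] at h2
          exact sub_eq_zero.1 h2
        obtain ⟨a, ha, ha'⟩ := exists_ne_ne hn hκ hC i
        have h4 := h3 a ha ha'
        have h5 := h3 (neg a) (fun h => ha' (neg_eq_iff.1 h)) (fun h => ha (neg_injective h))
        have h6 := hanti a a
        rw [theta_self, Int.cast_one, one_smul, ← h5, ← h4] at h6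
        exact two (add_eq_zero_iff_eq_neg.2 h6)
  -- The indices are chosen so that `p i j` is left alone, or doubled when `j = -i`. For `i = 0` the
  -- choice of the second case would make it cancel against itself.
  · by_cases hi : neg i = i
    · have h2 := hrel i j j j
      have hj : j ≠ neg j := by
        intro hj
        refine hij (Subtype.ext ?_)
        rw [neg_eq_self_iff.1 hi, neg_eq_self_iff.1 hj.symm]
      rw [if_pos rfl, if_neg (fun h => hij (by rw [← hi, h, neg_neg'])), if_neg (Ne.symm hij),
        if_neg hj, sub_zero, sub_zero, sub_zero] at h2
      exact h2
    · have h2 := hrel i i j i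
      rw [if_pos rfl, if_neg (Ne.symm hi), if_neg (Ne.symm hij)] at h2
      by_cases hj : i = neg j
      · have hj' : neg i = j := neg_eq_iff.2 hj
        rw [if_pos hj, hj', theta_self, Int.cast_one, one_smul, sub_zero, zero_sub, sub_neg_eq_add]
          at h2
        exact two h2
      · rw [if_neg hj, sub_zero, sub_zero, sub_zero] at h2
        exact h2

end Invariants

/-! ### The centralizer of the Yangian -/

section Ratio

variable {τ : ClassicalType} {n : ℕ} {A : Type} [Ring A] [Algebra ℂ A]
  {M : Matrix (Idx τ n) (Idx τ n) A⟦X⟧}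

/-- To first order `t_{oo}⁻¹ t_{kl}` is `δ_{kl} + T0_{kl} - δ_{kl} T0_{oo}`. The error is `-T0_{oo}
(y - δ_{kl})`; it is bounded recursively because `T0_{oo}` has no constant term. -/
theorem ratio_mem (hM : Solution M) {o k l : Idx τ n} {y : A⟦X⟧} (hy : M o o * y = M k l) :
    y - delta k l - (T0 M k l - delta k l * T0 M o o) ∈ uniFilt M (-2) := by
  set y0 := y - delta k l with hy0
  have e : y0 = T0 M k l - delta k l * T0 M o o - T0 M o o * y0 := by
    have h1 : y = delta k l + y0 := by rw [hy0, add_sub_cancel]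
    rw [T_eq M o o, T_eq M k l, h1] at hy
    have h2 : (delta o o : A⟦X⟧) = 1 := if_pos rfl
    have h3 : T0 M o o * delta k l = delta k l * T0 M o o := by rw [mul_delta, delta_mul]
    rw [h2, add_mul, one_mul, mul_add, h3, add_assoc, add_right_inj] at hy
    rw [← hy]
    abel
  have hl : T0 M k l - delta k l * T0 M o o ∈ uniFilt M (-1) :=
    sub_mem (T0_mem hM _ _) (delta_mul_mem (T0_mem hM _ _) _ _)
  have h : y0 ∈ uniFilt M (-1) := by
    intro r
    induction r using Nat.strong_induction_on with
    | _ r ih =>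
      rw [e, map_sub, coeff_mul]
      refine sub_mem (hl r) (sum_mem fun p hp => ?_)
      have hp' : p.1 + p.2 = r := by simpa using hp
      rcases Nat.eq_zero_or_pos p.1 with h0 | h0
      · rw [h0, coeff_zero_T0 hM, zero_mul]
        exact zero_mem _
      · exact mul_mem_filt' (T0_mem hM _ _ _) (ih p.2 (by omega)) (by omega)
  have h4 : y0 - (T0 M k l - delta k l * T0 M o o) = -(T0 M o o * y0) := by
    nth_rewrite 1 [e]
    abel
  rw [h4]
  exact neg_mem (uniFilt_mono (by norm_num) (mul_mem_uniFilt (T0_mem hM o o) h))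

theorem coeff_ratio_mem (hM : Solution M) {o k l : Idx τ n} {y : A⟦X⟧} (hy : M o o * y = M k l)
    (s : ℕ) : coeff (s + 1) y - (gen M (k, l, s) - if k = l then gen M (o, o, s) else 0) ∈
      filt M (2 * s) := by
  have h := ratio_mem hM hy (s + 1)
  have hd : coeff (s + 1) (delta k l : A⟦X⟧) = 0 := by
    rw [delta]
    split_ifs <;> simp [coeff_one]
  rw [map_sub, map_sub, map_sub, hd, sub_zero, delta_mul, apply_ite (coeff (s + 1)), coeff_succ_T0,
    coeff_succ_T0, map_zero] at h
  exact filt_mono (by push_cast; omega) h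

/-- Leading terms of the ratios give all `t_{kl}` with `k ≠ l`, but only differences of the diagonal
ones; the missing diagonal direction is supplied by `z(u)`. -/
theorem commutator_mem_of_ratio (hM : Solution M) {e : ℤ} {w : A} (hw : w ∈ filt M e)
    (hz : ∀ r, Commute w (zc M r))
    (hy : ∀ o k l, ∃ y : A⟦X⟧, M o o * y = M k l ∧ ∀ s, Commute w (coeff s y)) (k l : Idx τ n)
    (s : ℕ) : w * gen M (k, l, s) - gen M (k, l, s) * w ∈ filt M (e + 2 * s - 1) := by
  have h1 : ∀ o k l, (w * gen M (k, l, s) - gen M (k, l, s) * w) -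
      (if k = l then w * gen M (o, o, s) - gen M (o, o, s) * w else 0) ∈
        filt M (e + 2 * s - 1) := by
    intro o k l
    obtain ⟨y, hy1, hy2⟩ := hy o k l
    have h := neg_mem (commutator_mem_filt hM hw (coeff_ratio_mem hM hy1 s))
    have hc := (hy2 (s + 1)).eq
    convert h using 1
    split_ifs
    · simp only [mul_sub, sub_mul, hc]
      abel
    · simp only [mul_sub, sub_mul, hc, mul_zero, zero_mul]
      abel
  by_cases hkl : k = l
  · subst hkl
    -- `h2` controls the commutator with the difference of the generators at `k` and `-k`, and `h3`
    -- the one with their sum, which is a coefficient of `z(u)` up to lower terms. Half the total is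
    -- the claim.
    have h2 := h1 (neg k) k k
    have h3 := commutator_mem_filt hM hw (relation_zc hM k k s)
    rw [if_pos rfl] at h2
    rw [if_pos rfl, theta_self, one_smul, mul_sub, sub_mul, (hz s).eq, sub_sub_sub_cancel_right,
      mul_add, add_mul] at h3
    have h4 := Submodule.smul_mem _ (2⁻¹ : ℂ) (add_mem h2 h3)
    convert h4 using 1
    module
  · have h2 := h1 k k l
    rwa [if_neg hkl, sub_zero] at h2

theorem ev_mem_of_pderiv_eq_zero {q : Poly τ n}
    (hq : ∀ i j r, MvPolynomial.pderiv (Sum.inl (i, j, r)) q = 0) :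
    ev M q ∈ Algebra.adjoin ℂ (Set.range (zc M)) := by
  rw [← MvPolynomial.support_sum_monomial_coeff q, map_sum]
  refine sum_mem fun m hm => ?_
  have h0 : ∀ g, m (Sum.inl g) = 0 := by
    rintro ⟨i, j, r⟩
    by_contra h'
    set v : Gen τ n ⊕ ℕ := Sum.inl (i, j, r)
    have h1 := congrArg (MvPolynomial.coeff (m - Finsupp.single v 1)) (hq i j r)
    rw [MvPolynomial.coeff_pderiv, MvPolynomial.coeff_zero] at h1
    have h2 : m - Finsupp.single v 1 + Finsupp.single v 1 = m := by
      ext w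
      by_cases hw : w = v
      · subst hw
        simp
        omega
      · simp [Finsupp.single_apply, Ne.symm hw]
    rw [h2, mul_eq_zero] at h1
    rcases h1 with h1 | h1
    · exact MvPolynomial.mem_support_iff.1 hm h1
    · norm_cast at h1
  rw [← mul_one (MvPolynomial.coeff m q), ← smul_eq_mul, ← MvPolynomial.smul_monomial, map_smul,
    ev_monomial]
  refine Subalgebra.smul_mem _ (list_prod_mem fun x hx => ?_) _
  obtain ⟨v, hv, rfl⟩ := List.mem_map.1 hx
  rw [Multiset.mem_toList, Finsupp.mem_toMultiset, Finsupp.mem_support_iff] at hv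
  rcases v with g | r
  · exact absurd (h0 g) hv
  · exact Subalgebra.smul_mem _ (Algebra.subset_adjoin (Set.mem_range_self r)) _

/-- An element that commutes with the ratios of the generating series is a polynomial in the
coefficients of `z(u)`. -/
theorem mem_adjoin_of_commute [Nontrivial A] (hM : Solution M) (hS : Separated M)
    (hz : ∀ r x, Commute x (zc M r)) {e : ℕ} {w : A} (hw : w ∈ filt M e)
    (hy : ∀ o k l, ∃ y : A⟦X⟧, M o o * y = M k l ∧ ∀ s, Commute w (coeff s y)) :
    w ∈ Algebra.adjoin ℂ (Set.range (zc M)) := by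
  induction e generalizing w with
  | zero =>
    obtain ⟨c, rfl⟩ := mem_filt_zero hw
    exact Subalgebra.smul_mem _ (one_mem _) c
  | succ e ih =>
    obtain ⟨q, hq⟩ := exists_symbol hw
    have h1 : ev M q ∈ Algebra.adjoin ℂ (Set.range (zc M)) :=
      ev_mem_of_pderiv_eq_zero (pderiv_eq_zero_of_invariant hM.pos hM.kappa_ne
        (snd_mem_sigmaAlg hq) fun k l s => adSymbol_eq_zero hM hS (e := e + 1) hq k l s
          (commutator_mem_of_ratio hM hw (fun r => hz r w) hy k l s))
    -- Being a polynomial in central elements, `ev M q` can be subtracted from `w` without losing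
    -- the commutation hypotheses; the difference has smaller degree.
    have h2 : ∀ x, Commute (ev M q) x := by
      intro x
      have h3 : Algebra.adjoin ℂ (Set.range (zc M)) ≤ Subalgebra.centralizer ℂ {x} := by
        refine Algebra.adjoin_le ?_
        rintro _ ⟨r, rfl⟩
        rw [SetLike.mem_coe, Subalgebra.mem_centralizer_iff]
        rintro y rfl
        exact (hz r y).eq
      exact ((Subalgebra.mem_centralizer_iff ℂ).1 (h3 h1) x rfl).symm
    have h4 := sub_ev_mem hM hq
    have h5 := ih (w := w - ev M q) (filt_mono (by push_cast; omega) h4) fun o k l => by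
      obtain ⟨y, hy1, hy2⟩ := hy o k l
      exact ⟨y, hy1, fun s => (hy2 s).sub_left (h2 _)⟩
    have h6 := add_mem h5 h1
    rwa [sub_add_cancel] at h6

end Ratio

/-! ### The center of the extended Yangian and the centralizer of the Yangian -/

section Yangian

variable {τ : ClassicalType} {n : ℕ}

theorem map_mulHom (f : ℂ⟦X⟧) (hf : constantCoeff f = 1) (i j : Idx τ n) :
    PowerSeries.map (mulHom τ n f hf : EY τ n →+* EY τ n) (T τ n i j) =
      scal (EY τ n) f * T τ n i j :=
  congrFun (congrFun (map_lift_T (scaled f (T τ n)) _ _) i) j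

/-- The scalar factor `f(u)` cancels in `t_{oo}(u)⁻¹ t_{kl}(u)`. -/
theorem exists_ratio (o k l : Idx τ n) : ∃ y : (EY τ n)⟦X⟧, T τ n o o * y = T τ n k l ∧
    ∀ s, coeff s y ∈ Yangian τ n := by
  have hc : constantCoeff (T τ n o o) = ((1 : (EY τ n)ˣ) : EY τ n) := by
    have := coeff_zero_T τ n o o
    rw [if_pos rfl, coeff_zero_eq_constantCoeff_apply] at this
    rw [this, Units.val_one]
  set G := invOfUnit (T τ n o o) 1
  have h1 : T τ n o o * G = 1 := mul_invOfUnit _ _ hc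
  have h2 : G * T τ n o o = 1 := invOfUnit_mul _ _ hc
  refine ⟨G * T τ n k l, by rw [← mul_assoc, h1, one_mul], fun s => ?_⟩
  simp only [Yangian, Algebra.mem_iInf]
  intro f hf
  rw [AlgHom.mem_equalizer, AlgHom.id_apply]
  have h3 := congrArg (PowerSeries.map (mulHom τ n f hf : EY τ n →+* EY τ n)) h2
  rw [map_mul, map_mulHom, map_one, ← mul_assoc] at h3
  have h4 : PowerSeries.map (mulHom τ n f hf : EY τ n →+* EY τ n) G * scal (EY τ n) f = G := by
    have := congrArg (· * G) h3
    simpa only [mul_assoc, h1, mul_one, one_mul] using this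
  have h5 : PowerSeries.map (mulHom τ n f hf : EY τ n →+* EY τ n) (G * T τ n k l) =
      G * T τ n k l := by
    rw [map_mul, map_mulHom, ← mul_assoc, h4]
  have h6 := congrArg (coeff s) h5
  rwa [PowerSeries.coeff_map] at h6

theorem ZX_eq : ZX τ n = Algebra.adjoin ℂ (Set.range (zc (T τ n))) := rfl

theorem mem_ZX_of_commute (h : Solution (T τ n)) {w : EY τ n}
    (hw : ∀ y ∈ Yangian τ n, Commute w y) : w ∈ ZX τ n := by
  obtain ⟨e, he⟩ := exists_mem_filt w
  rw [ZX_eq]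
  refine mem_adjoin_of_commute h (separated_T h) (fun r x => (zSeries_coeff_commute h _ x).symm) he
    fun o k l => ?_
  obtain ⟨y, hy1, hy2⟩ := exists_ratio o k l
  exact ⟨y, hy1, fun s => hw _ (hy2 s)⟩

theorem ZX_le_center (h : Solution (T τ n)) : ZX τ n ≤ Subalgebra.center ℂ (EY τ n) := by
  rw [ZX_eq]
  refine Algebra.adjoin_le ?_
  rintro _ ⟨r, rfl⟩
  exact Subalgebra.mem_center_iff.2 fun x => (zSeries_coeff_commute h _ x).symm.eq

theorem center_eq_ZX (h : Solution (T τ n)) : Subalgebra.center ℂ (EY τ n) = ZX τ n :=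
  le_antisymm (fun _ hw => mem_ZX_of_commute h fun y _ => (Subalgebra.mem_center_iff.1 hw y).symm)
    (ZX_le_center h)

end Yangian

/-! ### Algebraic independence -/

section Independence

/-- The series `g(u) g(u + c)`. -/
def selfProd (c : ℂ) (g : ℂ⟦X⟧) : ℂ⟦X⟧ := shift c g * g

theorem coeff_selfProd_congr (c : ℂ) {g h : ℂ⟦X⟧} {m : ℕ} (H : ∀ r ≤ m, coeff r g = coeff r h) :
    coeff m (selfProd c g) = coeff m (selfProd c h) := by
  rw [selfProd, selfProd, coeff_mul, coeff_mul]
  refine Finset.sum_congr rfl fun p hp => ?_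
  have hp' : p.1 + p.2 = m := by simpa using hp
  rw [H p.2 (by omega), shift, shift, coeff_mk, coeff_mk]
  congr 1
  refine Finset.sum_congr rfl fun r hr => ?_
  have := Finset.mem_range.1 hr
  rw [H r (by omega)]

/-- A new term `a u^{-m-1}` meets the constant term one in each of the two factors and the shift
does not alter its leading coefficient. So `g(u) g(u + c) = ζ(u)` can be solved one coefficient at a
time. -/
theorem coeff_selfProd_add (c a : ℂ) {g : ℂ⟦X⟧} (hg : coeff 0 g = 1) (m : ℕ) :
    coeff (m + 1) (selfProd c (g + monomial (m + 1) a)) = coeff (m + 1) (selfProd c g) + 2 * a := by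
  set t : ℂ⟦X⟧ := monomial (m + 1) a with ht
  have h1 : ∀ r ≤ m + 1, coeff r (shift c t) = coeff r t := by
    intro r hr
    rw [coeff_shift_eq, Finset.sum_eq_zero, zero_add]
    intro p hp
    have := Finset.mem_range.1 hp
    rw [ht, coeff_monomial, if_neg (by omega), smul_zero]
  have h2 : ∀ p : ℂ⟦X⟧, coeff (m + 1) (p * t) = coeff 0 p * a := by
    intro p
    rw [coeff_mul, Finset.sum_eq_single (0, m + 1)]
    · rw [ht, coeff_monomial_same]
    · rintro ⟨q1, q2⟩ hq hne
      have hq' : q1 + q2 = m + 1 := by simpa using hq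
      rw [ht, coeff_monomial, if_neg, mul_zero]
      intro h
      exact hne (Prod.ext (show q1 = 0 by omega) h)
    · simp
  have h3 : coeff (m + 1) (shift c t * g) = a := by
    have : coeff (m + 1) (shift c t * g) = coeff (m + 1) (g * t) := by
      rw [mul_comm g, coeff_mul, coeff_mul]
      refine Finset.sum_congr rfl fun p hp => ?_
      have hp' : p.1 + p.2 = m + 1 := by simpa using hp
      rw [h1 _ (by omega)]
    rw [this, h2, hg, one_mul]
  have h4 : coeff 0 (shift c t) = 0 := by
    rw [coeff_zero_shift, ht, coeff_monomial, if_neg (by omega)]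
  have e : selfProd c (g + t) =
      selfProd c g + shift c g * t + (shift c t * g + shift c t * t) := by
    have : shift c (g + t) = shift c g + shift c t := map_add (shiftₗ ℂ c) g t
    rw [selfProd, selfProd, this]
    ring
  rw [e, map_add, map_add, map_add, h2, h3, h2, h4, coeff_zero_shift, hg]
  ring

/-- Successive approximations of a solution of `g(u) g(u + c) = ζ(u)`. -/
def approx (c : ℂ) (ζ : ℂ⟦X⟧) : ℕ → ℂ⟦X⟧
  | 0 => 1
  | m + 1 => approx c ζ m + monomial (m + 1)
      (2⁻¹ * (coeff (m + 1) ζ - coeff (m + 1) (selfProd c (approx c ζ m))))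

theorem coeff_approx_succ (c : ℂ) (ζ : ℂ⟦X⟧) {m r : ℕ} (h : r ≤ m) :
    coeff r (approx c ζ (m + 1)) = coeff r (approx c ζ m) := by
  rw [approx, map_add, coeff_monomial, if_neg (by omega), add_zero]

theorem coeff_approx (c : ℂ) (ζ : ℂ⟦X⟧) {m r : ℕ} (h : r ≤ m) :
    coeff r (approx c ζ m) = coeff r (approx c ζ r) := by
  induction m, h using Nat.le_induction with
  | base => rfl
  | succ m h ih => rw [coeff_approx_succ c ζ h, ih]

theorem exists_selfProd_eq (c : ℂ) {ζ : ℂ⟦X⟧} (hζ : coeff 0 ζ = 1) :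
    ∃ g : ℂ⟦X⟧, constantCoeff g = 1 ∧ selfProd c g = ζ := by
  have h0 : coeff 0 (approx c ζ 0) = 1 := coeff_zero_one
  refine ⟨PowerSeries.mk fun m => coeff m (approx c ζ m), ?_, ?_⟩
  · rw [← coeff_zero_eq_constantCoeff_apply, coeff_mk, h0]
  · ext m
    rw [coeff_selfProd_congr c (h := approx c ζ m) fun r hr => by
      rw [coeff_mk, coeff_approx c ζ hr]]
    rcases m with _ | m
    · rw [selfProd, coeff_mul, Finset.Nat.antidiagonal_zero, Finset.sum_singleton, coeff_zero_shift,
        h0, hζ, one_mul]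
    · rw [approx, coeff_selfProd_add c _ ((coeff_approx c ζ (Nat.zero_le m)).trans h0)]
      ring

variable {τ : ClassicalType} {n : ℕ}

theorem zSeries_diagonal (hn : 1 ≤ n) (hκ : kappa τ n ≠ 0) (g : ℂ⟦X⟧) :
    zSeries (Matrix.diagonal fun _ : Idx τ n => g) = selfProd (kappa τ n) g := by
  obtain ⟨o⟩ := idx_nonempty (τ := τ) hn
  have h := (transp_mul_and_mul_transp (M := Matrix.diagonal fun _ : Idx τ n => g) hn hκ
    (rtt_diagonal fun a b => mul_comm _ _)).1
  have h1 := congrFun (congrFun h o) o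
  rw [Matrix.diagonal_apply_eq, Matrix.mul_diagonal, transp, Matrix.diagonal_apply_eq, theta_self,
    one_smul] at h1
  exact h1.symm

theorem character_zc (h : Solution (T τ n)) (g : ℂ⟦X⟧) (hg : constantCoeff g = 1) (r : ℕ) :
    character τ n g hg (zc (T τ n) r) = coeff (r + 1) (selfProd (kappa τ n) g) := by
  have h1 := zSeries_map (character τ n g hg) (T τ n)
  rw [map_character, zSeries_diagonal h.pos h.kappa_ne] at h1
  rw [h1, PowerSeries.coeff_map]
  rfl

/-- The coefficients of `z(u)` as elements of the center. -/
def zCenter (h : Solution (T τ n)) (r : ℕ) : Subalgebra.center ℂ (EY τ n) :=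
  ⟨zc (T τ n) r, ZX_le_center h (Algebra.subset_adjoin ⟨r, rfl⟩)⟩

/-- The polynomials in the coefficients of `z(u)`. -/
def zHom (h : Solution (T τ n)) : MvPolynomial ℕ ℂ →ₐ[ℂ] EY τ n :=
  (Subalgebra.center ℂ (EY τ n)).val.comp (MvPolynomial.aeval (zCenter h))

theorem zHom_X (h : Solution (T τ n)) (r : ℕ) : zHom h (MvPolynomial.X r) = zc (T τ n) r := by
  rw [zHom, AlgHom.comp_apply, MvPolynomial.aeval_X]
  rfl

/-- Take `g` with `g(u) g(u + κ) = 1 + x₀ u⁻¹ + x₁ u⁻² + …`: the coefficients of `z(u)` take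
arbitrary values at characters. -/
theorem exists_character (h : Solution (T τ n)) (x : ℕ → ℂ) : ∃ (g : ℂ⟦X⟧)
    (hg : constantCoeff g = 1), ∀ p, character τ n g hg (zHom h p) = MvPolynomial.eval x p := by
  obtain ⟨g, hg, hζ⟩ := exists_selfProd_eq (kappa τ n)
    (ζ := PowerSeries.mk fun m => Nat.casesOn m 1 x) (by rw [coeff_mk]; rfl)
  refine ⟨g, hg, fun p => ?_⟩
  have h1 : (character τ n g hg).comp (zHom h) = MvPolynomial.aeval x := by
    refine MvPolynomial.algHom_ext fun r => ?_
    rw [AlgHom.comp_apply, zHom_X, character_zc h, hζ, coeff_mk, MvPolynomial.aeval_X]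
  have h2 := congrArg (fun f : MvPolynomial ℕ ℂ →ₐ[ℂ] ℂ => f p) h1
  exact h2.trans (by rw [MvPolynomial.aeval_eq_eval])

theorem zHom_injective (h : Solution (T τ n)) : Function.Injective (zHom h) := by
  intro p q hpq
  refine MvPolynomial.funext fun x => ?_
  obtain ⟨g, hg, hx⟩ := exists_character h x
  rw [← hx, ← hx, hpq]

theorem range_zHom (h : Solution (T τ n)) : (zHom h).range = ZX τ n := by
  rw [ZX_eq, ← Algebra.map_top, ← MvPolynomial.adjoin_range_X, AlgHom.map_adjoin, ← Set.range_comp]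
  congr 2
  ext1 r
  exact zHom_X h r

theorem character_mulHom (g : ℂ⟦X⟧) (hg : constantCoeff g = 1) (x : EY τ n) :
    character τ n 1 (map_one _) (mulHom τ n g hg x) = character τ n g hg x := by
  have h : (character τ n 1 (map_one _)).comp (mulHom τ n g hg) = character τ n g hg := by
    refine word_induction exists_mem_filt fun a => ?_
    obtain ⟨i, j, r⟩ := a
    have h1 := congrArg (coeff (r + 1)) (congrFun (congrFun (map_character (τ := τ) (n := n) g hg) i) j)
    have h2 := congrArg (coeff (r + 1)) (map_mulHom (τ := τ) (n := n) g hg i j)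
    rw [Matrix.map_apply, PowerSeries.coeff_map] at h1
    rw [PowerSeries.coeff_map] at h2
    refine Eq.trans ?_ h1.symm
    refine (congrArg (character τ n 1 (map_one _)) h2).trans ?_
    have h3 := congrFun (congrFun (map_character (τ := τ) (n := n) 1 (map_one _)) i) j
    rw [Matrix.map_apply] at h3
    have h4 : PowerSeries.map (character τ n 1 (map_one _) : EY τ n →+* ℂ) (scal (EY τ n) g) = g := by
      ext m
      rw [PowerSeries.coeff_map, scal, PowerSeries.coeff_map, RingHom.coe_coe, AlgHom.commutes]
      rfl
    have h5 : PowerSeries.map (character τ n 1 (map_one _) : EY τ n →+* ℂ)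
        (scal (EY τ n) g * T τ n i j) = Matrix.diagonal (fun _ => g) i j := by
      rw [map_mul, h3, h4, Matrix.diagonal_apply, Matrix.diagonal_apply]
      split_ifs
      · exact mul_one g
      · exact mul_zero g
    have h6 := congrArg (coeff (r + 1)) h5
    rwa [PowerSeries.coeff_map] at h6
  exact congrArg (fun f : EY τ n →ₐ[ℂ] ℂ => f x) h

/-- By `character_mulHom` every character `T(u) ↦ g(u) 1` is the trivial one after `μ_g`, so on
elements fixed by all `μ_g` these characters agree. The polynomial is then constant as a function on
all points. -/
theorem exists_const_of_mem (h : Solution (T τ n)) {w : EY τ n} (hw : w ∈ ZX τ n)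
    (hY : w ∈ Yangian τ n) : ∃ c : ℂ, w = algebraMap ℂ (EY τ n) c := by
  rw [← range_zHom h] at hw
  obtain ⟨p, rfl⟩ := hw
  set c := character τ n 1 (map_one _) (zHom h p) with hc
  refine ⟨c, ?_⟩
  have h1 : p = MvPolynomial.C c := by
    refine MvPolynomial.funext fun x => ?_
    obtain ⟨g, hg, hx⟩ := exists_character h x
    rw [← hx, MvPolynomial.eval_C, ← character_mulHom]
    have h2 : mulHom τ n g hg (zHom h p) = zHom h p := by
      simp only [Yangian, Algebra.mem_iInf] at hY
      exact hY g hg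
    rw [h2]
  have h2 : zHom h p = zHom h (MvPolynomial.C c) := congrArg _ h1
  rw [← MvPolynomial.algebraMap_eq, AlgHom.commutes] at h2
  exact h2

end Independence

end ExtendedYangian

end

theorem corollary3p9 (τ : ExtendedYangian.ClassicalType) (n : ℕ) (hn : 1 ≤ n)
    (hD : τ = ExtendedYangian.ClassicalType.D → 2 ≤ n) :
    -- the series `z(u) = 1 + z₁ u⁻¹ + …` is the one with `Tᵗ(u+κ) T(u) = T(u) Tᵗ(u+κ) = z(u) 1`
    (ExtendedYangian.Tt τ n * ExtendedYangian.T τ n =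
        Matrix.diagonal (fun _ => ExtendedYangian.z τ n) ∧
      ExtendedYangian.T τ n * ExtendedYangian.Tt τ n =
        Matrix.diagonal (fun _ => ExtendedYangian.z τ n) ∧
      PowerSeries.coeff 0 (ExtendedYangian.z τ n) = 1) ∧
    -- (i)
    Subalgebra.center ℂ (ExtendedYangian.Yangian τ n) = ⊥ ∧
    -- (ii)
    Subalgebra.center ℂ (ExtendedYangian.EY τ n) = ExtendedYangian.ZX τ n ∧
    -- (iii)
    (∃ hz : ∀ r : ℕ, PowerSeries.coeff (r + 1) (ExtendedYangian.z τ n) ∈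
        Subalgebra.center ℂ (ExtendedYangian.EY τ n),
      AlgebraicIndependent ℂ (fun r : ℕ =>
        (⟨PowerSeries.coeff (r + 1) (ExtendedYangian.z τ n), hz r⟩ :
          Subalgebra.center ℂ (ExtendedYangian.EY τ n)))) ∧
    (∃ e : MvPolynomial ℕ ℂ ≃ₐ[ℂ] ExtendedYangian.ZX τ n, ∀ r : ℕ,
      (e (MvPolynomial.X r) : ExtendedYangian.EY τ n) =
        PowerSeries.coeff (r + 1) (ExtendedYangian.z τ n)) := by
  have h := ExtendedYangian.solution_T hn hD
  -- `Tt` and `z` are by definition `transp` and `zSeries` of `T`, so the general results apply as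
  -- they stand.
  have hT := ExtendedYangian.transp_mul_and_mul_transp h.pos h.kappa_ne h.rtt
  refine ⟨⟨hT.1, hT.2, ExtendedYangian.coeff_zero_zSeries h⟩, ?_,
    ExtendedYangian.center_eq_ZX h, ⟨fun r => (ExtendedYangian.zCenter h r).2, ?_⟩,
    ⟨(AlgEquiv.ofInjective _ (ExtendedYangian.zHom_injective h)).trans
      (Subalgebra.equivOfEq _ _ (ExtendedYangian.range_zHom h)),
      fun r => ExtendedYangian.zHom_X h r⟩⟩
  · refine eq_bot_iff.2 fun x hx => ?_
    have h1 : ∀ y ∈ ExtendedYangian.Yangian τ n, Commute (x : ExtendedYangian.EY τ n) y :=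
      fun y hy => (congrArg Subtype.val (Subalgebra.mem_center_iff.1 hx ⟨y, hy⟩)).symm
    obtain ⟨c, hc⟩ := ExtendedYangian.exists_const_of_mem h
      (ExtendedYangian.mem_ZX_of_commute h h1) x.2
    exact Algebra.mem_bot.2 ⟨c, Subtype.ext hc.symm⟩
  · rw [algebraicIndependent_iff_injective_aeval]
    exact Function.Injective.of_comp (f := Subtype.val) (ExtendedYangian.zHom_injective h)
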